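/- For real $\sigma$ let $H^\sigma(\mathbb R)$ be the Sobolev space of real-valued functions (tempered distributions if $\sigma<0$) with norm $\|f\|_{H^\sigma}=\big(\int_{\mathbb R}(1+|\xi|^2)^{\sigma}|\hat f(\xi)|^2\,d\xi\big)^{1/2}$. For $s>1/2$ let $$U^s=\{h:\mathbb R\to\mathbb R \;:\; h-1\in H^s(\mathbb R),\ h(x)>0 \text{ for all } x\in\mathbb R\},$$ where elements of $H^s(\mathbb R)$ are identified with their continuous representatives and $U^s$ has the topology of the subset $U^s-1$ of $H^s(\mathbb R)$. For $h\in U^s$ let $A_h:H^{s+1}(\mathbb R)\to H^{s-1}(\mathbb R)$, $A_h w=3hw-\partial_x(h^3 w_x)$. The one-dimensional Green–Naghdi system in nonlocal form is $$u_t+uu_x=-A_h^{-1}\big(3hh_x+2\partial_x(h^3u_x^2)\big),\qquad h_t+\partial_x(hu)=0,\qquad h(0)=h_0,\ u(0)=u_0, \tag{GN}$$ where $h h_x\in H^{s-1}(\mathbb R)$ is the product of $h$ with the distribution $h_x\in H^{s-1}(\mathbb R)$. A solution of (GN) on $[0,T]$, $T>0$, is a pair $$(h,u)\in C\big([0,T];U^s\times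 H^{s+1}(\mathbb R)\big)\cap C^1\big([0,T];(1+H^{s-1}(\mathbb R))\times H^s(\mathbb R)\big)$$ satisfying (GN) for all $t\in[0,T]$. **Theorem.** Let $s>1/2$. Then (GN) is locally well-posed for $(h,u)$ in $U^s\times H^{s+1}(\mathbb R)$, that is: 1. (Existence and continuous dependence.) For every $(h_0,u_0)\in U^s\times H^{s+1}(\mathbb R)$ there are $T>0$ and a neighborhood $V$ of $(h_0,u_0)$ in $U^s\times H^{s+1}(\mathbb R)$ such that for every initial value in $V$ there is a solution of (GN) on $[0,T]$, and the solution depends continuously on the initial value in $V$, as a map from $V$ to $C([0,T];U^s\times H^{s+1}(\mathbb R))\cap C^1([0,T];(1+H^{s-1}(\mathbb R))\times H^s(\mathbb R))$. 2. (Uniqueness.) For every $(h_0,u_0)\in U^s\times H^{s+1}(\mathbb R)$ and every $T>0$, any two solutions of (GN) on $[0,T]$ with initial value $(h_0,u_0)$ coincide on $[0,T]$. -/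

import Mathlib

open Set Filter Topology MeasureTheory TemperedDistribution
open scoped SchwartzMap

noncomputable section

namespace GreenNaghdi

/-! ### Real Sobolev spaces of arbitrary real order on the line -/

/-- A tempered distribution is real if it is real on real test functions. -/
def IsRealDist (F : 𝓢'(ℝ, ℂ)) : Prop :=
  ∀ φ : 𝓢(ℝ, ℂ), (∀ x, (φ x).im = 0) → (F φ).im = 0

/-- For `F` in the (complex) Sobolev space of order `σ`, the square integrable function
`J^σ F`, where `J^σ` is the Fourier multiplier with symbol `(1 + |ξ|²)^(σ/2)`. -/
def besselL2 (σ : ℝ) (F : 𝓢'(ℝ, ℂ)) : Lp ℂ 2 (volume : Measure ℝ) :=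
  open Classical in if h : MemSobolev σ 2 F then h.choose else 0

theorem besselL2_spec {σ : ℝ} {F : 𝓢'(ℝ, ℂ)} (h : MemSobolev σ 2 F) :
    besselPotential ℝ ℂ σ F = Lp.toTemperedDistribution (besselL2 σ F) := by
  rw [besselL2, dif_pos h]
  exact h.choose_spec

theorem toTemperedDistribution_inj {f g : Lp ℂ 2 (volume : Measure ℝ)}
    (h : Lp.toTemperedDistribution f = Lp.toTemperedDistribution g) : f = g := by
  have hk := Lp.ker_toTemperedDistributionCLM_eq_bot (F := ℂ) (μ := (volume : Measure ℝ)) (p := 2)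
  have hi := LinearMap.ker_eq_bot.mp hk
  exact hi h

theorem besselL2_eq {σ : ℝ} {F : 𝓢'(ℝ, ℂ)} {f : Lp ℂ 2 (volume : Measure ℝ)}
    (h : besselPotential ℝ ℂ σ F = Lp.toTemperedDistribution f) : besselL2 σ F = f :=
  toTemperedDistribution_inj ((besselL2_spec ⟨f, h⟩).symm.trans h)

/-- The real-valued elements of the Sobolev space of order `σ`, as a real vector space. -/
def HsSubmodule (σ : ℝ) : Submodule ℝ 𝓢'(ℝ, ℂ) where
  carrier := {F | MemSobolev σ 2 F ∧ IsRealDist F}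
  zero_mem' := ⟨memSobolev_fun_zero ℝ ℂ σ 2, fun φ _ => by simp⟩
  add_mem' := fun {F G} hF hG => ⟨hF.1.add hG.1, fun φ hφ => by
    simp [hF.2 φ hφ, hG.2 φ hφ]⟩
  smul_mem' := fun c F hF => ⟨by simpa using hF.1.smul (c : ℂ), fun φ hφ => by
    simp [hF.2 φ hφ]⟩

/-- The Sobolev space `H^σ(ℝ)` of real-valued functions (distributions if `σ < 0`), for every
real `σ`. It is a type of its own, so that it carries the norm topology and not the topology
of pointwise convergence of distributions. -/
def Hs (σ : ℝ) : Type := HsSubmodule σ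

namespace Hs

instance (σ : ℝ) : AddCommGroup (Hs σ) := inferInstanceAs (AddCommGroup (HsSubmodule σ))
instance (σ : ℝ) : Module ℝ (Hs σ) := inferInstanceAs (Module ℝ (HsSubmodule σ))

/-- The underlying tempered distribution. -/
def toDist {σ : ℝ} : Hs σ →ₗ[ℝ] 𝓢'(ℝ, ℂ) := (HsSubmodule σ).subtype

theorem toDist_injective {σ : ℝ} : Function.Injective (toDist : Hs σ → 𝓢'(ℝ, ℂ)) :=
  Subtype.val_injective

theorem memSobolev {σ : ℝ} (F : Hs σ) : MemSobolev σ 2 F.toDist := F.2.1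

/-- `F ↦ J^σ F` as a linear map from `H^σ` to `L²`. -/
def toL2 (σ : ℝ) : Hs σ →ₗ[ℝ] Lp ℂ 2 (volume : Measure ℝ) where
  toFun F := besselL2 σ F.toDist
  map_add' F G := besselL2_eq (by
    rw [map_add, map_add, besselL2_spec F.memSobolev, besselL2_spec G.memSobolev]
    exact (map_add (Lp.toTemperedDistributionCLM ℂ (volume : Measure ℝ) 2) _ _).symm)
  map_smul' c F := besselL2_eq (by
    rw [map_smul, ContinuousLinearMap.map_smul_of_tower, besselL2_spec F.memSobolev]
    exact ((Lp.toTemperedDistributionCLM ℂ (volume : Measure ℝ) 2).map_smul_of_tower c _).symm)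

theorem toL2_injective (σ : ℝ) : Function.Injective (toL2 σ) := by
  intro F G h
  apply toDist_injective
  have h' : besselPotential ℝ ℂ σ F.toDist = besselPotential ℝ ℂ σ G.toDist := by
    rw [besselL2_spec F.memSobolev, besselL2_spec G.memSobolev]
    exact congrArg _ h
  have := (besselPotential_neg_apply_eq_iff (-σ) F.toDist
    (besselPotential ℝ ℂ σ F.toDist)).mp (by simp)
  rw [← this, h']
  simp

/-- The Sobolev norm `‖F‖_{H^σ} = ‖J^σ F‖_{L²}`. -/
instance (σ : ℝ) : NormedAddCommGroup (Hs σ) :=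
  NormedAddCommGroup.induced (Hs σ) (Lp ℂ 2 (volume : Measure ℝ)) (toL2 σ) (toL2_injective σ)

instance (σ : ℝ) : NormedSpace ℝ (Hs σ) :=
  NormedSpace.induced ℝ (Hs σ) (Lp ℂ 2 (volume : Measure ℝ)) (toL2 σ)

/-- The inclusion `H^σ ⊆ H^σ'` for `σ' ≤ σ`. -/
def incl {σ σ' : ℝ} (h : σ' ≤ σ) : Hs σ →ₗ[ℝ] Hs σ' :=
  Submodule.inclusion (p := HsSubmodule σ) (p' := HsSubmodule σ') fun _ hF => ⟨hF.1.mono h, hF.2⟩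

end Hs

/-! ### Functions, products and the operator `A_h` -/

/-- The distribution of a square integrable function (only used for such functions). -/
def ofL2 (f : ℝ → ℂ) : 𝓢'(ℝ, ℂ) :=
  open Classical in
  if hf : MemLp f 2 (volume : Measure ℝ) then Lp.toTemperedDistribution (hf.toLp f) else 0

/-- The distribution of a real square integrable function. -/
def ofReal (f : ℝ → ℝ) : 𝓢'(ℝ, ℂ) := ofL2 fun x => (f x : ℂ)

/-- The real, continuous, square integrable function that a distribution is given by. It exists
for the elements of `H^σ` with `σ > 1/2` and is unique; it is only used for these. -/
def fn (F : 𝓢'(ℝ, ℂ)) : ℝ → ℝ :=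
  open Classical in
  if h : ∃ f : ℝ → ℝ, Continuous f ∧ MemLp f 2 (volume : Measure ℝ) ∧ ofReal f = F
  then h.choose else 0

/-- The distributional derivative `∂ₓ`. -/
abbrev dx : 𝓢'(ℝ, ℂ) →L[ℂ] 𝓢'(ℝ, ℂ) := derivCLM ℂ

/-- The duality pairing between the (complex) spaces `H^σ` and `H^(-σ)` which extends
`(G, ψ) ↦ ∫ G ψ dx`. It is `∫ (J^σ G) (J^(-σ) ψ) dx`. -/
def pairing (σ : ℝ) (G ψ : 𝓢'(ℝ, ℂ)) : ℂ :=
  ∫ x, besselL2 σ G x * besselL2 (-σ) ψ x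

/-- `P` is the product `f · G` of a function `f` and an element `G` of `H^σ`, where `σ` may be
negative: `f φ` is in `H^(-σ)` for all test functions `φ`, and `⟨P, φ⟩ = ⟨G, f φ⟩`. -/
def IsProduct (σ : ℝ) (f : ℝ → ℝ) (G P : 𝓢'(ℝ, ℂ)) : Prop :=
  MemSobolev σ 2 G ∧ ∀ φ : 𝓢(ℝ, ℂ),
    MemLp (fun x => (f x : ℂ) * φ x) 2 (volume : Measure ℝ) ∧
    MemSobolev (-σ) 2 (ofL2 fun x => (f x : ℂ) * φ x) ∧
    P φ = pairing σ G (ofL2 fun x => (f x : ℂ) * φ x)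

/-- The height `h = 1 + η` of a perturbation `η` of the equilibrium. -/
def height {s : ℝ} (η : Hs s) : ℝ → ℝ := fun x => 1 + fn η.toDist x

/-- The state space `U^s` of positive heights `h` with `h - 1 ∈ H^s`, given through the
perturbation `η = h - 1`. -/
def Us (s : ℝ) : Set (Hs s) := {η | ∀ x, 0 < height η x}

/-- The operator `A_h w = 3 h w - ∂ₓ (h³ wₓ)`. -/
def opA (h : ℝ → ℝ) (w : 𝓢'(ℝ, ℂ)) : 𝓢'(ℝ, ℂ) :=
  (3 : ℂ) • ofReal (fun x => h x * fn w x) - dx (ofReal fun x => h x ^ 3 * fn (dx w) x)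

/-- `w = A_h⁻¹ (3 h hₓ + 2 ∂ₓ (h³ uₓ²))` for `A_h : H^(s+1) → H^(s-1)`, where `h = 1 + η` (so that
`hₓ = ηₓ`). -/
def IsNonlocalTerm {s : ℝ} (η : Hs s) (u w : Hs (s + 1)) : Prop :=
  ∃ P : 𝓢'(ℝ, ℂ), IsProduct (s - 1) (height η) (dx η.toDist) P ∧
    opA (height η) w.toDist =
      (3 : ℂ) • P + (2 : ℂ) • dx (ofReal fun x => height η x ^ 3 * fn (dx u.toDist) x ^ 2)

/-! ### Solutions -/

/-- The time derivative of `η` on `[0, T]`, in `H^(s-1)`. -/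
def heightDeriv {s : ℝ} (T : ℝ) (η : ℝ → Hs s) : ℝ → Hs (s - 1) :=
  derivWithin (fun t => Hs.incl (sub_le_self s zero_le_one) (η t)) (Icc 0 T)

/-- The time derivative of `u` on `[0, T]`, in `H^s`. -/
def velDeriv {s : ℝ} (T : ℝ) (u : ℝ → Hs (s + 1)) : ℝ → Hs s :=
  derivWithin (fun t => Hs.incl (le_add_of_nonneg_right zero_le_one) (u t)) (Icc 0 T)

/-- `(h, u) = (1 + η, u)` is a solution on `[0, T]` of the nonlocal form of the system with initial
value `(1 + η₀, u₀)`, of class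
`C([0,T]; U^s × H^(s+1)) ∩ C¹([0,T]; (1 + H^(s-1)) × H^s)`. -/
structure IsSolution (s T : ℝ) (η₀ : Hs s) (u₀ : Hs (s + 1))
    (η : ℝ → Hs s) (u : ℝ → Hs (s + 1)) : Prop where
  mem_Us : ∀ t ∈ Icc 0 T, η t ∈ Us s
  continuousOn_height : ContinuousOn η (Icc 0 T)
  continuousOn_vel : ContinuousOn u (Icc 0 T)
  contDiffOn_height :
    ContDiffOn ℝ 1 (fun t => Hs.incl (sub_le_self s zero_le_one) (η t)) (Icc 0 T)
  contDiffOn_vel :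
    ContDiffOn ℝ 1 (fun t => Hs.incl (le_add_of_nonneg_right (a := s) zero_le_one) (u t)) (Icc 0 T)
  /-- `u_t + u u_x = - A_h⁻¹ (3 h h_x + 2 ∂ₓ (h³ u_x²))` -/
  momentum : ∀ t ∈ Icc 0 T, ∃ w : Hs (s + 1), IsNonlocalTerm (η t) (u t) w ∧
    (velDeriv T u t).toDist +
      ofReal (fun x => fn (u t).toDist x * fn (dx (u t).toDist) x) = -w.toDist
  /-- `h_t + ∂ₓ (h u) = 0` -/
  mass : ∀ t ∈ Icc 0 T,
    (heightDeriv T η t).toDist + dx (ofReal fun x => height (η t) x * fn (u t).toDist x) = 0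
  initial_height : η 0 = η₀
  initial_vel : u 0 = u₀

end GreenNaghdi

end

/-! Existence rests on Lagrangian coordinates. Let `φ = id + ψ` be the flow of `u` and `v = u ∘ φ`.
The transport terms disappear, mass conservation becomes `h ∘ φ = h₀ / φ_y`, and what remains is
`ψ_t = v`, `v_t = -w ∘ φ` for the nonlocal term `w`. Since `h hₓ = ∂ₓ (h² - 1) / 2`, the elliptic
equation has a divergence form: the flux `k = h³ wₓ + 3/2 (h² - 1) + 2 h³ uₓ²` satisfies `kₓ = 3 h
w` (`isNonlocalTerm_iff`). For `W = w ∘ φ` and `K = k ∘ φ` this reads `K = h₀³ φ_y⁻⁴ W_y + flux`,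
`K_y = 3 h₀ W`, where the flux is algebraic in `h₀`, `ψ_y`, `v_y`.

This first-order system is an isomorphism from `H^(s+1) × H^(s+1)` to `H^s × H^s`: an energy
identity gives injectivity, Lax–Milgram in `H¹` and a bootstrap give surjectivity
(`exists_ellip_equiv`). Its coefficients involve only products and inverses in the algebra `1 +
H^s`, so `W` is a `C¹` function of `(h₀ - 1, ψ, v)` with values in `H^(s+1)`, without loss of
derivatives (`contDiffAt_lagField`). Picard–Lindelöf applies, with `h₀` carried along as a component
at rest, so that the flow is also continuous in `h₀`.

The return to Eulerian variables is composition with `φ⁻¹`, which is jointly continuous in the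
function and in `ψ` on `H^σ` for `0 ≤ σ ≤ s + 1` (`tendsto_comp`). Below order one this comes from
the Gagliardo seminorm and density of Schwartz functions, above from the chain rule. Time
derivatives are found pointwise and then upgraded through their continuity in the Sobolev norm; the
height, which need not be differentiable in `x`, is handled through its primitive.

Uniqueness must hold for arbitrary solutions and uses mass coordinates. The integrated equation of
mass makes `m = ∫ h dx` a coordinate whose inverse `X(t, m)` satisfies `X_t = u(t, X)` and `X_m = 1
/ h`. In these coordinates the flux satisfies `K_m = 3 W`, so a maximum principle bounds the
difference of two `W_m` by the differences of `X_m` and `v_m` in the supremum norm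
(`abs_le_of_elliptic`). A Gronwall argument in supremum norms finishes the proof
(`IsMassSolution.unique`).

The tools in `H^σ` are the embedding into continuous functions, the product estimate of orders `s >
1/2` and `0 ≤ σ ≤ s`, and division by functions bounded away from zero. Most are proved for Schwartz
functions and extended by density and lower semicontinuity. -/

set_option linter.unusedSectionVars false

open Set Filter Topology MeasureTheory TemperedDistribution
open scoped SchwartzMap

noncomputable section

namespace GreenNaghdi

open FourierTransform ENNReal

/-! ### Square integrable functions as distributions, and Fourier multipliers -/

/-- The space of complex square integrable functions on the line. -/
abbrev L2 := Lp ℂ 2 (volume : Measure ℝ)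

theorem ofL2_of_memLp {f : ℝ → ℂ} (hf : MemLp f 2 (volume : Measure ℝ)) :
    ofL2 f = Lp.toTemperedDistribution (hf.toLp f) := by
  simp [ofL2, hf]

theorem ofL2_apply {f : ℝ → ℂ} (hf : MemLp f 2 (volume : Measure ℝ)) (φ : 𝓢(ℝ, ℂ)) :
    ofL2 f φ = ∫ x, φ x * f x := by
  rw [ofL2_of_memLp hf, Lp.toTemperedDistribution_apply]
  refine integral_congr_ae ?_
  filter_upwards [hf.coeFn_toLp] with x hx
  simp [hx]

theorem ofL2_coe (u : L2) : ofL2 (u : ℝ → ℂ) = Lp.toTemperedDistribution u := by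
  rw [ofL2_of_memLp (Lp.memLp u)]
  simp

theorem ofL2_congr {f g : ℝ → ℂ} (h : f =ᵐ[volume] g) : ofL2 f = ofL2 g := by
  by_cases hf : MemLp f 2 (volume : Measure ℝ)
  · have hg : MemLp g 2 (volume : Measure ℝ) := (memLp_congr_ae h).mp hf
    rw [ofL2_of_memLp hf, ofL2_of_memLp hg]
    congr 1
    exact (MemLp.toLp_eq_toLp_iff hf hg).mpr h
  · have hg : ¬ MemLp g 2 (volume : Measure ℝ) := fun hg => hf ((memLp_congr_ae h).mpr hg)
    simp [ofL2, hf, hg]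

theorem ofL2_inj {f g : ℝ → ℂ} (hf : MemLp f 2 (volume : Measure ℝ))
    (hg : MemLp g 2 (volume : Measure ℝ)) (h : ofL2 f = ofL2 g) : f =ᵐ[volume] g := by
  rw [ofL2_of_memLp hf, ofL2_of_memLp hg] at h
  exact (MemLp.toLp_eq_toLp_iff hf hg).mp (toTemperedDistribution_inj h)

theorem ofL2_add {f g : ℝ → ℂ} (hf : MemLp f 2 (volume : Measure ℝ))
    (hg : MemLp g 2 (volume : Measure ℝ)) : ofL2 (f + g) = ofL2 f + ofL2 g := by
  rw [ofL2_of_memLp hf, ofL2_of_memLp hg, ofL2_of_memLp (hf.add hg), MemLp.toLp_add hf hg]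
  exact map_add (Lp.toTemperedDistributionCLM ℂ (volume : Measure ℝ) 2) _ _

theorem ofL2_smul {f : ℝ → ℂ} (c : ℂ) (hf : MemLp f 2 (volume : Measure ℝ)) :
    ofL2 (c • f) = c • ofL2 f := by
  rw [ofL2_of_memLp hf, ofL2_of_memLp (hf.const_smul c), MemLp.toLp_const_smul c hf]
  exact map_smul (Lp.toTemperedDistributionCLM ℂ (volume : Measure ℝ) 2) _ _

theorem ofL2_sub {f g : ℝ → ℂ} (hf : MemLp f 2 (volume : Measure ℝ))
    (hg : MemLp g 2 (volume : Measure ℝ)) : ofL2 (f - g) = ofL2 f - ofL2 g := by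
  rw [ofL2_of_memLp hf, ofL2_of_memLp hg, ofL2_of_memLp (hf.sub hg), MemLp.toLp_sub hf hg]
  exact map_sub (Lp.toTemperedDistributionCLM ℂ (volume : Measure ℝ) 2) _ _

theorem smulLeft_toTemperedDistribution_iff {m : ℝ → ℂ} (hm : m.HasTemperateGrowth) (a b : L2) :
    smulLeftCLM ℂ m (Lp.toTemperedDistribution a) = Lp.toTemperedDistribution b ↔
      (b : ℝ → ℂ) =ᵐ[volume] fun x => m x * a x := by
  constructor
  · intro h
    have hli : LocallyIntegrable (fun x => m x * a x) (volume : Measure ℝ) :=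
      ((Lp.memLp a).locallyIntegrable (by norm_num)).continuous_mul hm.1.continuous
    refine ae_eq_of_integral_contDiff_smul_eq
      ((Lp.memLp b).locallyIntegrable (by norm_num)) hli fun g gs gc => ?_
    have hg₁ : HasCompactSupport (Complex.ofRealCLM ∘ g) := gc.comp_left rfl
    have hg₂ : ContDiff ℝ ((⊤ : ℕ∞) : WithTop ℕ∞) (Complex.ofRealCLM ∘ g) := by fun_prop
    have := DFunLike.congr_fun h (hg₁.toSchwartzMap hg₂)
    simp only [smulLeftCLM_apply_apply, Lp.toTemperedDistribution_apply,
      SchwartzMap.smulLeftCLM_apply_apply hm] at this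
    simpa [mul_assoc, mul_left_comm] using this.symm
  · intro h
    ext φ
    simp only [smulLeftCLM_apply_apply, Lp.toTemperedDistribution_apply]
    refine integral_congr_ae ?_
    filter_upwards [h] with x hx
    simp [SchwartzMap.smulLeftCLM_apply_apply hm, hx]
    ring

/-- The Fourier transforms on `L²` and on distributions agree. Statements about Bessel potentials,
derivatives and translations thereby become pointwise identities between transforms. -/
theorem fourierMultiplier_toTemperedDistribution_iff {m : ℝ → ℂ} (hm : m.HasTemperateGrowth)
    (u w : L2) :
    fourierMultiplierCLM ℂ m (Lp.toTemperedDistribution u) = Lp.toTemperedDistribution w ↔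
      ((𝓕 w : L2) : ℝ → ℂ) =ᵐ[volume] fun x => m x * (𝓕 u : L2) x := by
  rw [← smulLeft_toTemperedDistribution_iff hm, fourierMultiplierCLM_apply,
    ← Lp.fourier_toTemperedDistribution_eq, ← Lp.fourier_toTemperedDistribution_eq]
  constructor
  · intro h
    rw [← h]
    simp
  · intro h
    rw [h]
    simp

theorem enorm_sq_eq_lintegral (u : L2) : ‖u‖ₑ ^ 2 = ∫⁻ x, ‖u x‖ₑ ^ 2 := by
  rw [Lp.enorm_def, eLpNorm_eq_lintegral_rpow_enorm_toReal (by norm_num) (by norm_num)]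
  rw [← ENNReal.rpow_natCast, ← ENNReal.rpow_mul]
  simp

theorem eLpNorm_sq_eq_lintegral (f : ℝ → ℂ) :
    eLpNorm f 2 (volume : Measure ℝ) ^ 2 = ∫⁻ x, ‖f x‖ₑ ^ 2 := by
  rw [eLpNorm_eq_lintegral_rpow_enorm_toReal (by norm_num) (by norm_num)]
  rw [← ENNReal.rpow_natCast, ← ENNReal.rpow_mul]
  simp

theorem memLp_two_of_lintegral_lt_top {f : ℝ → ℂ} (hf : AEStronglyMeasurable f volume)
    (h : ∫⁻ x, ‖f x‖ₑ ^ 2 < ⊤) : MemLp f 2 (volume : Measure ℝ) := by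
  refine ⟨hf, ?_⟩
  rw [← eLpNorm_sq_eq_lintegral] at h
  exact (ENNReal.pow_lt_top_iff.mp h).resolve_right (by norm_num)

theorem lintegral_lt_top_of_memLp_two {f : ℝ → ℂ} (hf : MemLp f 2 (volume : Measure ℝ)) :
    ∫⁻ x, ‖f x‖ₑ ^ 2 < ⊤ := by
  rw [← eLpNorm_sq_eq_lintegral]
  exact ENNReal.pow_lt_top hf.2

/-! ### Sobolev norms of functions -/

/-- The Fourier weight `(1 + ξ²)^σ`. -/
def wt (σ ξ : ℝ) : ℝ≥0∞ := ENNReal.ofReal ((1 + ξ ^ 2) ^ σ)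

theorem measurable_wt (σ : ℝ) : Measurable (wt σ) := by
  unfold wt
  fun_prop

theorem wt_zero (ξ : ℝ) : wt 0 ξ = 1 := by simp [wt]

theorem wt_ne_top (σ ξ : ℝ) : wt σ ξ ≠ ⊤ := ENNReal.ofReal_ne_top

theorem wt_add (σ τ ξ : ℝ) : wt (σ + τ) ξ = wt σ ξ * wt τ ξ := by
  rw [wt, wt, wt, ← ENNReal.ofReal_mul (by positivity), ← Real.rpow_add (by positivity)]

theorem wt_mono {σ τ : ℝ} (h : σ ≤ τ) (ξ : ℝ) : wt σ ξ ≤ wt τ ξ :=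
  ENNReal.ofReal_le_ofReal (Real.rpow_le_rpow_of_exponent_le (by nlinarith [sq_nonneg ξ]) h)

theorem wt_neg (σ ξ : ℝ) : wt σ ξ * wt (-σ) ξ = 1 := by
  rw [← wt_add, add_neg_cancel, wt_zero]

/-- The squared Sobolev norm of order `σ` of a square integrable function, with value `⊤` for
other functions. -/
def sob (σ : ℝ) (f : ℝ → ℂ) : ℝ≥0∞ :=
  open Classical in
  if h : MemLp f 2 (volume : Measure ℝ) then
    ∫⁻ ξ, wt σ ξ * ‖(𝓕 (h.toLp f) : L2) ξ‖ₑ ^ 2 else ⊤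

theorem sob_of_memLp (σ : ℝ) {f : ℝ → ℂ} (h : MemLp f 2 (volume : Measure ℝ)) :
    sob σ f = ∫⁻ ξ, wt σ ξ * ‖(𝓕 (h.toLp f) : L2) ξ‖ₑ ^ 2 := by
  simp [sob, h]

theorem memLp_of_sob_lt_top {σ : ℝ} {f : ℝ → ℂ} (h : sob σ f < ⊤) :
    MemLp f 2 (volume : Measure ℝ) := by
  by_contra hf
  simp [sob, hf] at h

theorem sob_congr (σ : ℝ) {f g : ℝ → ℂ} (h : f =ᵐ[volume] g) : sob σ f = sob σ g := by
  by_cases hf : MemLp f 2 (volume : Measure ℝ)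
  · have hg : MemLp g 2 (volume : Measure ℝ) := (memLp_congr_ae h).mp hf
    rw [sob_of_memLp σ hf, sob_of_memLp σ hg]
    rw [(MemLp.toLp_eq_toLp_iff hf hg).mpr h]
  · have hg : ¬ MemLp g 2 (volume : Measure ℝ) := fun hg => hf ((memLp_congr_ae h).mpr hg)
    simp [sob, hf, hg]

theorem sob_zero_eq {f : ℝ → ℂ} (h : MemLp f 2 (volume : Measure ℝ)) :
    sob 0 f = ∫⁻ x, ‖f x‖ₑ ^ 2 := by
  rw [sob_of_memLp 0 h]
  simp only [wt_zero, one_mul]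
  rw [← enorm_sq_eq_lintegral]
  have : ‖(𝓕 (h.toLp f) : L2)‖ₑ = ‖h.toLp f‖ₑ := by
    rw [← ofReal_norm, ← ofReal_norm, Lp.norm_fourier_eq]
  rw [this, enorm_sq_eq_lintegral]
  refine lintegral_congr_ae ?_
  filter_upwards [h.coeFn_toLp] with x hx
  rw [hx]

theorem sob_mono {σ τ : ℝ} (h : σ ≤ τ) (f : ℝ → ℂ) : sob σ f ≤ sob τ f := by
  by_cases hf : MemLp f 2 (volume : Measure ℝ)
  · rw [sob_of_memLp σ hf, sob_of_memLp τ hf]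
    gcongr with ξ
    exact wt_mono h ξ
  · simp [sob, hf]

theorem enorm_add_sq_le {E : Type*} [NormedAddCommGroup E] (a b : E) :
    ‖a + b‖ₑ ^ 2 ≤ 2 * ‖a‖ₑ ^ 2 + 2 * ‖b‖ₑ ^ 2 := by
  have h1 : ‖a + b‖ ^ 2 ≤ 2 * ‖a‖ ^ 2 + 2 * ‖b‖ ^ 2 := by
    nlinarith [norm_add_le a b, norm_nonneg (a + b), sq_nonneg (‖a‖ - ‖b‖)]
  have := ENNReal.ofReal_le_ofReal h1
  rw [ENNReal.ofReal_add (by positivity) (by positivity), ENNReal.ofReal_mul (by positivity),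
    ENNReal.ofReal_mul (by positivity), ENNReal.ofReal_pow (by positivity),
    ENNReal.ofReal_pow (by positivity), ENNReal.ofReal_pow (by positivity)] at this
  simpa [ofReal_norm] using this

theorem sob_add_le (σ : ℝ) (f g : ℝ → ℂ) : sob σ (f + g) ≤ 2 * sob σ f + 2 * sob σ g := by
  by_cases hf : MemLp f 2 (volume : Measure ℝ)
  swap
  · simp [sob, hf]
  by_cases hg : MemLp g 2 (volume : Measure ℝ)
  swap
  · simp [sob, hg]
  rw [sob_of_memLp σ hf, sob_of_memLp σ hg, sob_of_memLp σ (hf.add hg), MemLp.toLp_add hf hg,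
    FourierTransform.fourier_add]
  rw [← lintegral_const_mul' _ _ (by norm_num), ← lintegral_const_mul' _ _ (by norm_num),
    ← lintegral_add_left']
  · refine lintegral_mono_ae ?_
    filter_upwards [Lp.coeFn_add (𝓕 (hf.toLp f) : L2) (𝓕 (hg.toLp g) : L2)] with ξ hξ
    rw [hξ, Pi.add_apply]
    calc _ ≤ wt σ ξ * (2 * ‖(𝓕 (hf.toLp f) : L2) ξ‖ₑ ^ 2 + 2 * ‖(𝓕 (hg.toLp g) : L2) ξ‖ₑ ^ 2) := by
          gcongr; exact enorm_add_sq_le _ _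
      _ = _ := by ring
  · exact (((measurable_wt σ).aemeasurable.mul
      ((Lp.aestronglyMeasurable _).enorm.pow_const 2)).const_mul 2)

theorem sob_smul (σ : ℝ) {c : ℂ} {f : ℝ → ℂ} (hf : MemLp f 2 (volume : Measure ℝ)) :
    sob σ (c • f) = ‖c‖ₑ ^ 2 * sob σ f := by
  rw [sob_of_memLp σ hf, sob_of_memLp σ (hf.const_smul c), MemLp.toLp_const_smul c hf,
    FourierTransform.fourier_smul, ← lintegral_const_mul' _ _ (by simp)]
  refine lintegral_congr_ae ?_
  filter_upwards [Lp.coeFn_smul c (𝓕 (hf.toLp f) : L2)] with ξ hξ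
  rw [hξ, Pi.smul_apply, enorm_smul, mul_pow]
  ring

theorem sob_neg (σ : ℝ) (f : ℝ → ℂ) : sob σ (-f) = sob σ f := by
  by_cases hf : MemLp f 2 (volume : Measure ℝ)
  · have := sob_smul σ (c := -1) hf
    simpa using this
  · have : ¬ MemLp (-f) 2 (volume : Measure ℝ) := fun h => hf (by simpa using h.neg)
    simp [sob, hf, this]

theorem sob_sub_le (σ : ℝ) (f g : ℝ → ℂ) : sob σ (f - g) ≤ 2 * sob σ f + 2 * sob σ g := by
  rw [sub_eq_add_neg]
  simpa [sob_neg] using sob_add_le σ f (-g)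

theorem sob_zero_fun (σ : ℝ) : sob σ (0 : ℝ → ℂ) = 0 := by
  have := sob_smul σ (c := 0) (f := 0) (MemLp.zero)
  simpa using this

theorem sob_add_lt_top {σ : ℝ} {f g : ℝ → ℂ} (hf : sob σ f < ⊤) (hg : sob σ g < ⊤) :
    sob σ (f + g) < ⊤ :=
  (sob_add_le σ f g).trans_lt (by finiteness)

theorem sob_sub_lt_top {σ : ℝ} {f g : ℝ → ℂ} (hf : sob σ f < ⊤) (hg : sob σ g < ⊤) :
    sob σ (f - g) < ⊤ :=
  (sob_sub_le σ f g).trans_lt (by finiteness)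

theorem sob_smul_lt_top {σ : ℝ} {f : ℝ → ℂ} (c : ℂ) (hf : sob σ f < ⊤) :
    sob σ (c • f) < ⊤ := by
  rw [sob_smul σ (memLp_of_sob_lt_top hf)]
  finiteness

/-- The symbol of the Bessel potential. -/
theorem bessel_symbol_temperate (σ : ℝ) :
    (fun ξ : ℝ => (((1 + ‖ξ‖ ^ 2) ^ (σ / 2) : ℝ) : ℂ)).HasTemperateGrowth := by fun_prop

theorem enorm_symbol_mul_sq (σ ξ : ℝ) (z : ℂ) :
    ‖(((1 + ‖ξ‖ ^ 2) ^ (σ / 2) : ℝ) : ℂ) * z‖ₑ ^ 2 = wt σ ξ * ‖z‖ₑ ^ 2 := by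
  rw [enorm_mul, mul_pow]
  congr 1
  rw [← ofReal_norm, Complex.norm_real, Real.norm_of_nonneg (by positivity),
    ← ENNReal.ofReal_pow (by positivity), ← Real.rpow_natCast, ← Real.rpow_mul (by positivity), wt]
  simp

/-- The weighted transform is square integrable because `sob σ f` is finite; its inverse transform
is `J^σ f`, and Plancherel gives the norm. This is the bridge between `Hs` and estimates on
functions. -/
theorem memSobolev_and_enorm_besselL2 {σ : ℝ} {f : ℝ → ℂ} (h : sob σ f < ⊤) :
    MemSobolev σ 2 (ofL2 f) ∧ ‖besselL2 σ (ofL2 f)‖ₑ ^ 2 = sob σ f := by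
  have hf := memLp_of_sob_lt_top h
  rw [sob_of_memLp σ hf] at h
  have hmem : MemLp (fun ξ : ℝ => (((1 + ‖ξ‖ ^ 2) ^ (σ / 2) : ℝ) : ℂ) * (𝓕 (hf.toLp f) : L2) ξ) 2
      (volume : Measure ℝ) := by
    refine memLp_two_of_lintegral_lt_top ?_ ?_
    · exact ((bessel_symbol_temperate σ).1.continuous.aestronglyMeasurable).mul
        (Lp.aestronglyMeasurable _)
    · simpa only [enorm_symbol_mul_sq] using h
  set g : L2 := hmem.toLp _ with hg
  have key : besselPotential ℝ ℂ σ (ofL2 f) = Lp.toTemperedDistribution (𝓕⁻ g : L2) := by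
    rw [ofL2_of_memLp hf, besselPotential,
      fourierMultiplier_toTemperedDistribution_iff (bessel_symbol_temperate σ)]
    rw [fourier_fourierInv_eq]
    exact hmem.coeFn_toLp
  refine ⟨⟨_, key⟩, ?_⟩
  rw [besselL2_eq key, sob_of_memLp σ hf]
  have : ‖(𝓕⁻ g : L2)‖ₑ = ‖g‖ₑ := by
    rw [← ofReal_norm, ← ofReal_norm, ← Lp.norm_fourier_eq, fourier_fourierInv_eq]
  rw [this, enorm_sq_eq_lintegral]
  refine lintegral_congr_ae ?_
  filter_upwards [hmem.coeFn_toLp] with ξ hξ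
  rw [hξ, enorm_symbol_mul_sq]

theorem sob_lt_top_of_memSobolev {σ : ℝ} {f : ℝ → ℂ} (hf : MemLp f 2 (volume : Measure ℝ))
    (h : MemSobolev σ 2 (ofL2 f)) : sob σ f < ⊤ := by
  obtain ⟨w, hw⟩ := h
  rw [ofL2_of_memLp hf, besselPotential,
    fourierMultiplier_toTemperedDistribution_iff (bessel_symbol_temperate σ)] at hw
  rw [sob_of_memLp σ hf]
  have : ∫⁻ ξ, wt σ ξ * ‖(𝓕 (hf.toLp f) : L2) ξ‖ₑ ^ 2 = ∫⁻ ξ, ‖(𝓕 w : L2) ξ‖ₑ ^ 2 := by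
    refine lintegral_congr_ae ?_
    filter_upwards [hw] with ξ hξ
    rw [hξ, enorm_symbol_mul_sq]
  rw [this, ← enorm_sq_eq_lintegral]
  finiteness

theorem exists_ofL2_of_memSobolev {σ : ℝ} (hσ : 0 ≤ σ) {F : 𝓢'(ℝ, ℂ)} (h : MemSobolev σ 2 F) :
    ∃ f : ℝ → ℂ, MemLp f 2 (volume : Measure ℝ) ∧ ofL2 f = F := by
  obtain ⟨u, hu⟩ := memSobolev_zero_iff.mp (h.mono hσ)
  exact ⟨u, Lp.memLp u, by rw [ofL2_coe, hu]⟩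

/-! ### Weak derivatives -/

/-- `g` is the weak derivative of `f`, both square integrable. -/
structure HasWeakDeriv (f g : ℝ → ℂ) : Prop where
  left : MemLp f 2 (volume : Measure ℝ)
  right : MemLp g 2 (volume : Measure ℝ)
  eq : dx (ofL2 f) = ofL2 g

theorem dx_eq_lineDeriv (F : 𝓢'(ℝ, ℂ)) : dx F = LineDeriv.lineDerivOp (1 : ℝ) F := by
  ext φ
  rw [lineDerivOp_apply_apply, derivCLM_apply_apply]
  congr 2

theorem dx_eq_fourierMultiplier (F : 𝓢'(ℝ, ℂ)) :
    dx F = fourierMultiplierCLM ℂ (fun ξ : ℝ => 2 * Real.pi * Complex.I * ξ) F := by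
  rw [dx_eq_lineDeriv, lineDeriv_eq_fourierMultiplierCLM]
  have := fourierMultiplierCLM_smul (F := ℂ) (E := ℝ) (g := fun ξ : ℝ => (ξ : ℂ)) (by fun_prop)
    (2 * Real.pi * Complex.I)
  rw [show (fun ξ : ℝ => 2 * Real.pi * Complex.I * (ξ : ℂ)) =
    (2 * Real.pi * Complex.I) • fun ξ : ℝ => (ξ : ℂ) from rfl, this]
  simp

theorem deriv_symbol_temperate :
    (fun ξ : ℝ => 2 * Real.pi * Complex.I * (ξ : ℂ)).HasTemperateGrowth := by fun_prop

theorem hasWeakDeriv_iff {f g : ℝ → ℂ} (hf : MemLp f 2 (volume : Measure ℝ))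
    (hg : MemLp g 2 (volume : Measure ℝ)) :
    HasWeakDeriv f g ↔ ((𝓕 (hg.toLp g) : L2) : ℝ → ℂ) =ᵐ[volume]
      fun ξ => 2 * Real.pi * Complex.I * (ξ : ℂ) * (𝓕 (hf.toLp f) : L2) ξ := by
  rw [← fourierMultiplier_toTemperedDistribution_iff deriv_symbol_temperate,
    ← dx_eq_fourierMultiplier, ← ofL2_of_memLp hf, ← ofL2_of_memLp hg]
  exact ⟨fun h => h.eq, fun h => ⟨hf, hg, h⟩⟩

/-- The constant `(2π)²` that relates the weight and the symbol of the derivative. -/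
def fourPiSq : ℝ≥0∞ := ENNReal.ofReal (4 * Real.pi ^ 2)

theorem fourPiSq_ne_zero : fourPiSq ≠ 0 := by
  have hpi := Real.pi_pos
  rw [fourPiSq, Ne, ENNReal.ofReal_eq_zero, not_le]
  positivity

theorem fourPiSq_ne_top : fourPiSq ≠ ⊤ := ENNReal.ofReal_ne_top

theorem enorm_deriv_symbol_mul_sq (ξ : ℝ) (z : ℂ) :
    ‖2 * Real.pi * Complex.I * (ξ : ℂ) * z‖ₑ ^ 2 =
      fourPiSq * (ENNReal.ofReal (ξ ^ 2) * ‖z‖ₑ ^ 2) := by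
  have hpi := Real.pi_pos
  rw [enorm_mul, mul_pow, ← mul_assoc]
  congr 1
  rw [← ofReal_norm, ← ENNReal.ofReal_pow (by positivity), fourPiSq,
    ← ENNReal.ofReal_mul (by positivity)]
  congr 1
  simp only [norm_mul, Complex.norm_real, Complex.norm_I, Complex.norm_ofNat, mul_one, mul_pow,
    Real.norm_eq_abs, sq_abs]
  ring

theorem wt_succ (σ ξ : ℝ) : wt (σ + 1) ξ = wt σ ξ + wt σ ξ * ENNReal.ofReal (ξ ^ 2) := by
  rw [wt_add]
  have : wt 1 ξ = 1 + ENNReal.ofReal (ξ ^ 2) := by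
    rw [wt, Real.rpow_one, ENNReal.ofReal_add (by positivity) (by positivity), ENNReal.ofReal_one]
  rw [this]
  ring

/-- The Sobolev norm of order `σ + 1` in terms of the weak derivative. -/
theorem sob_succ_eq (σ : ℝ) {f g : ℝ → ℂ} (h : HasWeakDeriv f g) :
    sob (σ + 1) f = sob σ f + (fourPiSq)⁻¹ * sob σ g := by
  have h4 := fourPiSq_ne_zero
  have h4' := fourPiSq_ne_top
  rw [sob_of_memLp _ h.left, sob_of_memLp _ h.left, sob_of_memLp _ h.right,
    ← lintegral_const_mul' _ _ (by simp [h4]), ← lintegral_add_left']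
  · refine lintegral_congr_ae ?_
    filter_upwards [(hasWeakDeriv_iff h.left h.right).mp h] with ξ hξ
    rw [hξ, enorm_deriv_symbol_mul_sq, wt_succ]
    rw [mul_left_comm (wt σ ξ) fourPiSq, ← mul_assoc fourPiSq⁻¹,
      ENNReal.inv_mul_cancel h4 h4', one_mul]
    ring
  · exact ((measurable_wt σ).aemeasurable.mul ((Lp.aestronglyMeasurable _).enorm.pow_const 2))

theorem exists_hasWeakDeriv {f : ℝ → ℂ} (h : sob 1 f < ⊤) : ∃ g, HasWeakDeriv f g := by
  have hf := memLp_of_sob_lt_top h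
  have hpi := Real.pi_pos
  have hmem : MemLp (fun ξ : ℝ => 2 * Real.pi * Complex.I * (ξ : ℂ) * (𝓕 (hf.toLp f) : L2) ξ) 2
      (volume : Measure ℝ) := by
    refine memLp_two_of_lintegral_lt_top ?_ ?_
    · exact (deriv_symbol_temperate.1.continuous.aestronglyMeasurable).mul
        (Lp.aestronglyMeasurable _)
    · simp only [enorm_deriv_symbol_mul_sq]
      rw [lintegral_const_mul' _ _ fourPiSq_ne_top]
      refine ENNReal.mul_lt_top fourPiSq_ne_top.lt_top (lt_of_le_of_lt ?_ h)
      rw [sob_of_memLp 1 hf]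
      gcongr with ξ
      rw [wt, Real.rpow_one]
      exact ENNReal.ofReal_le_ofReal (by linarith)
  refine ⟨(𝓕⁻ (hmem.toLp _) : L2), ?_⟩
  rw [hasWeakDeriv_iff hf (Lp.memLp _), Lp.toLp_coeFn, fourier_fourierInv_eq]
  exact hmem.coeFn_toLp

theorem HasWeakDeriv.sub {f g f' g' : ℝ → ℂ} (hf : HasWeakDeriv f f') (hg : HasWeakDeriv g g') :
    HasWeakDeriv (f - g) (f' - g') :=
  ⟨hf.left.sub hg.left, hf.right.sub hg.right, by
    rw [ofL2_sub hf.left hg.left, map_sub, hf.eq, hg.eq, ofL2_sub hf.right hg.right]⟩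

theorem HasWeakDeriv.congr {f g f' g' : ℝ → ℂ} (hf : HasWeakDeriv f f') (h : f =ᵐ[volume] g)
    (h' : f' =ᵐ[volume] g') : HasWeakDeriv g g' :=
  ⟨(memLp_congr_ae h).mp hf.left, (memLp_congr_ae h').mp hf.right, by
    rw [← ofL2_congr h, ← ofL2_congr h', hf.eq]⟩

theorem HasWeakDeriv.unique {f g g' : ℝ → ℂ} (h : HasWeakDeriv f g) (h' : HasWeakDeriv f g') :
    g =ᵐ[volume] g' := ofL2_inj h.right h'.right (h.eq.symm.trans h'.eq)

theorem HasWeakDeriv.sob_lt_top {f g : ℝ → ℂ} (h : HasWeakDeriv f g) {σ : ℝ} (hf : sob σ f < ⊤)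
    (hg : sob σ g < ⊤) : sob (σ + 1) f < ⊤ := by
  have h4 := fourPiSq_ne_zero
  have h4' := fourPiSq_ne_top
  rw [sob_succ_eq σ h]
  finiteness

theorem HasWeakDeriv.sob_deriv_le {f g : ℝ → ℂ} (h : HasWeakDeriv f g) (σ : ℝ) :
    sob σ g ≤ fourPiSq * sob (σ + 1) f := by
  have h4 := fourPiSq_ne_zero
  have h4' := fourPiSq_ne_top
  rw [sob_succ_eq σ h, mul_add, ← mul_assoc, ENNReal.mul_inv_cancel h4 h4', one_mul]
  exact le_add_self

/-! ### Lower semicontinuity and density of Schwartz functions -/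

theorem lintegral_mul_sq_le {α : Type*} [MeasurableSpace α] {μ : Measure α} {f g : α → ℝ≥0∞}
    (hf : AEMeasurable f μ) (hg : AEMeasurable g μ) :
    (∫⁻ x, f x * g x ∂μ) ^ 2 ≤ (∫⁻ x, f x ^ 2 ∂μ) * ∫⁻ x, g x ^ 2 ∂μ := by
  have h := ENNReal.lintegral_mul_le_Lp_mul_Lq μ Real.HolderConjugate.two_two hf hg
  calc (∫⁻ x, f x * g x ∂μ) ^ 2
      ≤ ((∫⁻ x, f x ^ (2 : ℝ) ∂μ) ^ (1 / 2 : ℝ) * (∫⁻ x, g x ^ (2 : ℝ) ∂μ) ^ (1 / 2 : ℝ)) ^ 2 := by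
        gcongr
        exact h
    _ = _ := by
        rw [mul_pow, ← ENNReal.rpow_natCast, ← ENNReal.rpow_natCast, ← ENNReal.rpow_mul,
          ← ENNReal.rpow_mul]
        simp

theorem sob_zero_sub {f g : ℝ → ℂ} (hf : MemLp f 2 (volume : Measure ℝ))
    (hg : MemLp g 2 (volume : Measure ℝ)) :
    sob 0 (f - g) = eLpNorm (fun ξ => (𝓕 (hf.toLp f) : L2) ξ - (𝓕 (hg.toLp g) : L2) ξ) 2
      (volume : Measure ℝ) ^ 2 := by
  rw [eLpNorm_sq_eq_lintegral, sob_of_memLp 0 (hf.sub hg), MemLp.toLp_sub hf hg,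
    sub_eq_add_neg, FourierTransform.fourier_add, ← neg_one_smul ℂ (hg.toLp g),
    FourierTransform.fourier_smul, neg_one_smul, ← sub_eq_add_neg]
  refine lintegral_congr_ae ?_
  filter_upwards [Lp.coeFn_sub (𝓕 (hf.toLp f) : L2) (𝓕 (hg.toLp g) : L2)] with ξ hξ
  rw [hξ, wt_zero, one_mul, Pi.sub_apply]

theorem sob_zero_eq_eLpNorm {f : ℝ → ℂ} (hf : MemLp f 2 (volume : Measure ℝ)) :
    sob 0 f = eLpNorm f 2 (volume : Measure ℝ) ^ 2 := by
  rw [sob_zero_eq hf, eLpNorm_sq_eq_lintegral]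

theorem tendsto_of_tendsto_sq {ι : Type*} {l : Filter ι} {a : ι → ℝ≥0∞}
    (h : Tendsto (fun i => a i ^ 2) l (𝓝 0)) : Tendsto a l (𝓝 0) := by
  have := h.ennrpow_const (1 / 2 : ℝ)
  simp only [← ENNReal.rpow_natCast, ← ENNReal.rpow_mul] at this
  simpa using this

theorem exists_subseq_tendsto_ae {f : ℕ → ℝ → ℂ} {g : ℝ → ℂ}
    (hf : ∀ n, MemLp (f n) 2 (volume : Measure ℝ)) (hg : MemLp g 2 (volume : Measure ℝ))
    (h : Tendsto (fun n => sob 0 (f n - g)) atTop (𝓝 0)) :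
    ∃ ns : ℕ → ℕ, StrictMono ns ∧
      ∀ᵐ x, Tendsto (fun i => f (ns i) x) atTop (𝓝 (g x)) := by
  refine (tendstoInMeasure_of_tendsto_eLpNorm (p := 2) (by norm_num)
    (fun n => (hf n).1) hg.1 ?_).exists_seq_tendsto_ae
  refine tendsto_of_tendsto_sq (h.congr fun n => ?_)
  rw [sob_zero_eq_eLpNorm ((hf n).sub hg)]

/-- The Sobolev norms are lower semicontinuous with respect to convergence in `L²`. -/
theorem sob_le_of_tendsto {σ : ℝ} {f : ℕ → ℝ → ℂ} {g : ℝ → ℂ}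
    (hf : ∀ n, MemLp (f n) 2 (volume : Measure ℝ)) (hg : MemLp g 2 (volume : Measure ℝ))
    (h : Tendsto (fun n => sob 0 (f n - g)) atTop (𝓝 0)) {b : ℕ → ℝ≥0∞} {B : ℝ≥0∞}
    (hb : ∀ n, sob σ (f n) ≤ b n) (hB : Tendsto b atTop (𝓝 B)) : sob σ g ≤ B := by
  have h1 : Tendsto (fun n => eLpNorm
      ((fun ξ => (𝓕 ((hf n).toLp (f n)) : L2) ξ) - (fun ξ => (𝓕 (hg.toLp g) : L2) ξ)) 2
      (volume : Measure ℝ)) atTop (𝓝 0) := by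
    refine tendsto_of_tendsto_sq (h.congr fun n => ?_)
    rw [sob_zero_sub (hf n) hg]
    rfl
  -- By Plancherel the transforms converge in `L²`, hence almost everywhere along a subsequence;
  -- Fatou's lemma does the rest.
  obtain ⟨ns, hns, hae⟩ := (tendstoInMeasure_of_tendsto_eLpNorm (p := 2) (by norm_num)
    (fun n => Lp.aestronglyMeasurable _) (Lp.aestronglyMeasurable _) h1).exists_seq_tendsto_ae
  rw [sob_of_memLp σ hg]
  calc ∫⁻ ξ, wt σ ξ * ‖(𝓕 (hg.toLp g) : L2) ξ‖ₑ ^ 2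
      = ∫⁻ ξ, liminf (fun i => wt σ ξ * ‖(𝓕 ((hf (ns i)).toLp (f (ns i))) : L2) ξ‖ₑ ^ 2)
          atTop := by
        refine lintegral_congr_ae ?_
        filter_upwards [hae] with ξ hξ
        refine (Tendsto.liminf_eq ?_).symm
        exact ENNReal.Tendsto.const_mul ((ENNReal.continuous_pow 2).continuousAt.tendsto.comp
          (continuous_enorm.continuousAt.tendsto.comp hξ)) (Or.inr (wt_ne_top _ _))
    _ ≤ liminf (fun i => ∫⁻ ξ, wt σ ξ * ‖(𝓕 ((hf (ns i)).toLp (f (ns i))) : L2) ξ‖ₑ ^ 2)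
          atTop := by
        refine lintegral_liminf_le' fun i => ?_
        exact (measurable_wt σ).aemeasurable.mul ((Lp.aestronglyMeasurable _).enorm.pow_const 2)
    _ ≤ liminf (fun i => b (ns i)) atTop := by
        refine liminf_le_liminf (Eventually.of_forall fun i => ?_)
        rw [← sob_of_memLp σ (hf (ns i))]
        exact hb _
    _ = B := (hB.comp hns.tendsto_atTop).liminf_eq

theorem memLp_schwartz (φ : 𝓢(ℝ, ℂ)) : MemLp (φ : ℝ → ℂ) 2 (volume : Measure ℝ) := φ.memLp 2

theorem ofL2_schwartz (φ : 𝓢(ℝ, ℂ)) :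
    ofL2 (φ : ℝ → ℂ) = SchwartzMap.toTemperedDistributionCLM ℝ ℂ volume φ := by
  rw [← Lp.toTemperedDistribution_toLp_eq (p := 2), ofL2_of_memLp (memLp_schwartz φ)]
  rfl

theorem sob_schwartz_lt_top (σ : ℝ) (φ : 𝓢(ℝ, ℂ)) : sob σ φ < ⊤ := by
  refine sob_lt_top_of_memSobolev (memLp_schwartz φ) ?_
  rw [ofL2_schwartz]
  exact φ.memSobolev

theorem sob_schwartz_eq (σ : ℝ) (φ : 𝓢(ℝ, ℂ)) :
    sob σ φ = ∫⁻ ξ, wt σ ξ * ‖(𝓕 φ) ξ‖ₑ ^ 2 := by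
  rw [sob_of_memLp σ (memLp_schwartz φ)]
  have : (𝓕 ((memLp_schwartz φ).toLp φ) : L2) = (𝓕 φ).toLp 2 := SchwartzMap.toLp_fourier_eq φ
  rw [this]
  refine lintegral_congr_ae ?_
  filter_upwards [(𝓕 φ).coeFn_toLp 2 volume] with ξ hξ
  rw [hξ]

/-- Schwartz functions are dense in the Sobolev spaces. -/
theorem exists_schwartz_sob_sub_lt {σ : ℝ} {f : ℝ → ℂ} (hf : sob σ f < ⊤) {ε : ℝ≥0∞}
    (hε : ε ≠ 0) : ∃ φ : 𝓢(ℝ, ℂ), sob σ (f - φ) < ε := by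
  obtain ⟨δ, hδ, hδε⟩ : ∃ δ : ℝ, 0 < δ ∧ ENNReal.ofReal δ ^ 2 < ε := by
    have : Tendsto (fun δ : ℝ => ENNReal.ofReal δ ^ 2) (𝓝[>] 0) (𝓝 0) := by
      have h : Continuous fun δ : ℝ => ENNReal.ofReal δ ^ 2 :=
        (ENNReal.continuous_pow 2).comp ENNReal.continuous_ofReal
      simpa using (h.tendsto 0).mono_left nhdsWithin_le_nhds
    obtain ⟨δ, h1, h2⟩ := ((this.eventually_lt_const (pos_iff_ne_zero.mpr hε)).and
      self_mem_nhdsWithin).exists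
    exact ⟨δ, h2, h1⟩
  have hfm := memLp_of_sob_lt_top hf
  set u : L2 := besselL2 σ (ofL2 f) with hu
  have hbu := besselL2_spec (memSobolev_and_enorm_besselL2 hf).1
  obtain ⟨ψ, hψ⟩ := (SchwartzMap.denseRange_toLpCLM (E := ℝ) (F := ℂ) (p := 2)
    (μ := (volume : Measure ℝ)) (by norm_num)).exists_dist_lt u hδ
  -- `ψ` approximates `J^σ f` in `L²`, so `φ = J^(-σ) ψ` approximates `f` in order `σ`.
  set φ : 𝓢(ℝ, ℂ) := SchwartzMap.fourierMultiplierCLM ℂ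
    (fun ξ : ℝ => (((1 + ‖ξ‖ ^ 2) ^ (-σ / 2) : ℝ) : ℂ)) ψ with hφ
  have h1 : ofL2 (φ : ℝ → ℂ) = besselPotential ℝ ℂ (-σ) (Lp.toTemperedDistribution (ψ.toLp 2 volume)) := by
    rw [Lp.toTemperedDistribution_toLp_eq, besselPotential,
      fourierMultiplierCLM_toTemperedDistributionCLM_eq (bessel_symbol_temperate (-σ)),
      ofL2_schwartz]
  refine ⟨φ, ?_⟩
  have h2 : besselPotential ℝ ℂ σ (ofL2 (f - φ)) = Lp.toTemperedDistribution (u - ψ.toLp 2 volume) := by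
    rw [ofL2_sub hfm (memLp_schwartz φ), map_sub, hbu, h1]
    simp only [besselPotential_besselPotential_apply, neg_add_cancel, besselPotential_zero]
    exact (map_sub (Lp.toTemperedDistributionCLM ℂ (volume : Measure ℝ) 2) _ _).symm
  have h3 := memSobolev_and_enorm_besselL2 (sob_sub_lt_top hf (sob_schwartz_lt_top σ φ))
  rw [← h3.2, besselL2_eq h2]
  refine lt_of_le_of_lt ?_ hδε
  gcongr
  rw [← ofReal_norm, ← dist_eq_norm]
  exact ENNReal.ofReal_le_ofReal hψ.le

theorem exists_schwartz_tendsto {σ : ℝ} {f : ℝ → ℂ} (hf : sob σ f < ⊤) :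
    ∃ φ : ℕ → 𝓢(ℝ, ℂ), Tendsto (fun n => sob σ (φ n - f)) atTop (𝓝 0) := by
  have h : ∀ n : ℕ, ∃ φ : 𝓢(ℝ, ℂ), sob σ (f - φ) < (n + 1 : ℝ≥0∞)⁻¹ := fun n =>
    exists_schwartz_sob_sub_lt hf (by simp)
  choose φ hφ using h
  refine ⟨φ, tendsto_of_tendsto_of_tendsto_of_le_of_le tendsto_const_nhds ?_
    (fun n => zero_le) (fun n => ?_) (h := fun n : ℕ => ((n : ℝ≥0∞))⁻¹)⟩
  · exact ENNReal.tendsto_inv_nat_nhds_zero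
  · show sob σ (φ n - f) ≤ _
    rw [← neg_sub, sob_neg]
    exact (hφ n).le.trans (ENNReal.inv_le_inv.mpr le_self_add)

theorem sob_comm (σ : ℝ) (f g : ℝ → ℂ) : sob σ (f - g) = sob σ (g - f) := by
  rw [← neg_sub, sob_neg]

theorem tendsto_sob_mono {ι : Type*} {l : Filter ι} {σ τ : ℝ} (h : σ ≤ τ) {f : ι → ℝ → ℂ}
    (hf : Tendsto (fun i => sob τ (f i)) l (𝓝 0)) : Tendsto (fun i => sob σ (f i)) l (𝓝 0) :=
  tendsto_of_tendsto_of_tendsto_of_le_of_le tendsto_const_nhds hf (fun _ => zero_le)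
    (fun i => sob_mono h (f i))

theorem sob_le_of_sub (σ : ℝ) (f g : ℝ → ℂ) : sob σ f ≤ 2 * sob σ (f - g) + 2 * sob σ g := by
  simpa using sob_add_le σ (f - g) g

/-! ### The embedding into continuous functions vanishing at infinity -/

/-- The constant of the Sobolev embedding. -/
def wtInt (s : ℝ) : ℝ≥0∞ := ∫⁻ ξ, wt (-s) ξ

theorem wtInt_lt_top {s : ℝ} (hs : 1 / 2 < s) : wtInt s < ⊤ := by
  have h := integrable_rpow_neg_one_add_norm_sq (E := ℝ) (μ := volume) (r := 2 * s)
    (by simp; linarith)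
  have := h.lintegral_lt_top
  refine (lintegral_congr fun ξ => ?_).trans_lt this
  rw [wt]
  congr 2
  · simp
  · ring

theorem wt_half_sq (σ ξ : ℝ) : wt (σ / 2) ξ ^ 2 = wt σ ξ := by
  rw [sq, ← wt_add, add_halves]

/-- Cauchy–Schwarz for the factors `(1 + ξ²)^(-s/2)` and `(1 + ξ²)^(s/2) a`. -/
theorem sq_lintegral_le_wtInt (s : ℝ) {a : ℝ → ℝ≥0∞} (ha : AEMeasurable a volume) :
    (∫⁻ ξ, a ξ) ^ 2 ≤ wtInt s * ∫⁻ ξ, wt s ξ * a ξ ^ 2 := by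
  have h := lintegral_mul_sq_le (μ := volume) (f := fun ξ => wt (-s / 2) ξ)
    (g := fun ξ => wt (s / 2) ξ * a ξ) (measurable_wt _).aemeasurable
    ((measurable_wt _).aemeasurable.mul ha)
  simp only [wt_half_sq, mul_pow, ← mul_assoc, ← wt_add] at h
  simpa [← add_div, wt_zero, wtInt] using h

theorem schwartz_sup_le (s : ℝ) (φ : 𝓢(ℝ, ℂ)) (x : ℝ) : ‖φ x‖ₑ ^ 2 ≤ wtInt s * sob s φ := by
  have h1 : ‖φ x‖ₑ ≤ ∫⁻ ξ, ‖(𝓕 φ) ξ‖ₑ := by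
    have h0 : φ x = 𝓕 (⇑(𝓕 φ : 𝓢(ℝ, ℂ)) : ℝ → ℂ) (-x) := by
      conv_lhs => rw [← fourierInv_fourier_eq (F := 𝓢(ℝ, ℂ)) φ]
      rw [SchwartzMap.fourierInv_coe, Real.fourierInv_eq_fourier_neg]
    rw [h0, Real.fourier_eq]
    refine (enorm_integral_le_lintegral_enorm _).trans_eq ?_
    refine lintegral_congr fun ξ => ?_
    rw [← ofReal_norm, ← ofReal_norm, Circle.norm_smul]
  calc ‖φ x‖ₑ ^ 2 ≤ (∫⁻ ξ, ‖(𝓕 φ) ξ‖ₑ) ^ 2 := by gcongr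
    _ ≤ _ := by
      rw [sob_schwartz_eq]
      exact sq_lintegral_le_wtInt s (𝓕 φ).continuous.enorm.measurable.aemeasurable

open scoped ZeroAtInfty

theorem norm_le_of_enorm_sq_le {E : Type*} [NormedAddCommGroup E] {a : E} {b : ℝ} (hb : 0 ≤ b)
    (h : ‖a‖ₑ ^ 2 ≤ ENNReal.ofReal (b ^ 2)) : ‖a‖ ≤ b := by
  rw [← ofReal_norm, ← ENNReal.ofReal_pow (by positivity),
    ENNReal.ofReal_le_ofReal_iff (by positivity)] at h
  exact abs_le_of_sq_le_sq' h hb |>.2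

/-- Functions of Sobolev order `s > 1/2` have a representative that is continuous and vanishes at
infinity, and the supremum norm is controlled by the Sobolev norm. -/
theorem exists_continuous_rep {s : ℝ} (hs : 1 / 2 < s) {f : ℝ → ℂ} (hf : sob s f < ⊤) :
    ∃ g : C₀(ℝ, ℂ), f =ᵐ[volume] g ∧ ∀ x, ‖g x‖ₑ ^ 2 ≤ 2 * wtInt s * sob s f := by
  obtain ⟨φ, hφ⟩ := exists_schwartz_tendsto hf
  have hs0 : (0 : ℝ) ≤ s := by linarith
  have hcau : CauchySeq fun n => (φ n).toZeroAtInfty := by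
    rw [Metric.cauchySeq_iff']
    intro ε hε
    have hlim : Tendsto (fun n => 2 * wtInt s * sob s (φ n - f)) atTop (𝓝 0) := by
      have := ENNReal.Tendsto.const_mul (a := 2 * wtInt s) hφ
        (Or.inr (by have := wtInt_lt_top hs; finiteness))
      simpa using this
    -- Each of the two errors takes half of `(ε / 2)²`; the spare `ε / 2` makes the final inequality
    -- strict.
    have hpos : (0 : ℝ≥0∞) < ENNReal.ofReal ((ε / 2) ^ 2 / 2) := by
      rw [ENNReal.ofReal_pos]; positivity
    obtain ⟨N, hN⟩ := eventually_atTop.mp (hlim.eventually_lt_const hpos)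
    refine ⟨N, fun n hn => ?_⟩
    have hle : ∀ x, ‖φ n x - φ N x‖ ≤ ε / 2 := by
      intro x
      refine norm_le_of_enorm_sq_le (by positivity) ?_
      calc ‖φ n x - φ N x‖ₑ ^ 2 ≤ wtInt s * sob s ((φ n - φ N : 𝓢(ℝ, ℂ)) : ℝ → ℂ) :=
            schwartz_sup_le s (φ n - φ N) x
        _ ≤ wtInt s * (2 * sob s (φ n - f) + 2 * sob s (φ N - f)) := by
            gcongr
            have := sob_sub_le s (φ n - f) (φ N - f)
            rwa [sub_sub_sub_cancel_right] at this
        _ = 2 * wtInt s * sob s (φ n - f) + 2 * wtInt s * sob s (φ N - f) := by ring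
        _ ≤ ENNReal.ofReal ((ε / 2) ^ 2 / 2) + ENNReal.ofReal ((ε / 2) ^ 2 / 2) :=
            add_le_add (hN n hn).le (hN N le_rfl).le
        _ = _ := by
            rw [← ENNReal.ofReal_add (by positivity) (by positivity), add_halves]
    rw [← ZeroAtInftyContinuousMap.dist_toBCF_eq_dist]
    refine lt_of_le_of_lt ((BoundedContinuousFunction.dist_le (by positivity)).mpr fun x => ?_)
      (half_lt_self hε)
    rw [dist_eq_norm]
    exact hle x
  obtain ⟨g, hg⟩ := cauchySeq_tendsto_of_complete hcau
  have hpt : ∀ x, Tendsto (fun n => φ n x) atTop (𝓝 (g x)) := by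
    intro x
    rw [tendsto_iff_dist_tendsto_zero] at hg ⊢
    refine squeeze_zero (fun _ => dist_nonneg) (fun n => ?_) hg
    rw [← ZeroAtInftyContinuousMap.dist_toBCF_eq_dist]
    exact BoundedContinuousFunction.dist_coe_le_dist (f := (φ n).toZeroAtInfty.toBCF)
      (g := g.toBCF) x
  refine ⟨g, ?_, fun x => ?_⟩
  · obtain ⟨ns, hns, hae⟩ := exists_subseq_tendsto_ae (fun n => memLp_schwartz (φ n))
      (memLp_of_sob_lt_top hf) (tendsto_sob_mono hs0 hφ)
    filter_upwards [hae] with x hx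
    exact tendsto_nhds_unique hx ((hpt x).comp hns.tendsto_atTop)
  · have h1 : Tendsto (fun n => ‖φ n x‖ₑ ^ 2) atTop (𝓝 (‖g x‖ₑ ^ 2)) :=
      (ENNReal.continuous_pow 2).continuousAt.tendsto.comp
        (continuous_enorm.continuousAt.tendsto.comp (hpt x))
    have hfin := wtInt_lt_top hs
    have h2 : Tendsto (fun n => wtInt s * (2 * sob s (φ n - f) + 2 * sob s f)) atTop
        (𝓝 (wtInt s * (2 * 0 + 2 * sob s f))) := by
      refine ENNReal.Tendsto.const_mul ?_ (Or.inr hfin.ne)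
      exact (ENNReal.Tendsto.const_mul hφ (Or.inr (by norm_num))).add tendsto_const_nhds
    refine (le_of_tendsto_of_tendsto' h1 h2 fun n =>
      (schwartz_sup_le s (φ n) x).trans ?_).trans_eq (by ring)
    gcongr
    exact sob_le_of_sub s (φ n) f

theorem ae_enorm_sq_le {s : ℝ} (hs : 1 / 2 < s) {f : ℝ → ℂ} (hf : sob s f < ⊤) :
    ∀ᵐ x, ‖f x‖ₑ ^ 2 ≤ 2 * wtInt s * sob s f := by
  obtain ⟨g, hg, hb⟩ := exists_continuous_rep hs hf
  filter_upwards [hg] with x hx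
  rw [hx]
  exact hb x

theorem ae_eq_imp_eq {E : Type*} [TopologicalSpace E] [T2Space E] {f g : ℝ → E}
    (hf : Continuous f) (hg : Continuous g) (h : f =ᵐ[volume] g) : f = g :=
  Continuous.ae_eq_iff_eq volume hf hg |>.mp h

theorem enorm_sq_le {s : ℝ} (hs : 1 / 2 < s) {f : ℝ → ℂ} (hf : sob s f < ⊤) (hc : Continuous f)
    (x : ℝ) : ‖f x‖ₑ ^ 2 ≤ 2 * wtInt s * sob s f := by
  obtain ⟨g, hg, hb⟩ := exists_continuous_rep hs hf
  rw [congrFun (ae_eq_imp_eq hc g.continuous hg) x]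
  exact hb x

/-! ### Products -/

theorem memLp_mul_of_bound {f g : ℝ → ℂ} (hf : AEStronglyMeasurable f volume) {B : ℝ≥0∞}
    (hB : B ≠ ⊤) (hb : ∀ᵐ x, ‖f x‖ₑ ^ 2 ≤ B) (hg : MemLp g 2 (volume : Measure ℝ)) :
    MemLp (f * g) 2 (volume : Measure ℝ) ∧ sob 0 (f * g) ≤ B * sob 0 g := by
  have h : ∫⁻ x, ‖(f * g) x‖ₑ ^ 2 ≤ B * ∫⁻ x, ‖g x‖ₑ ^ 2 := by
    rw [← lintegral_const_mul' _ _ hB]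
    refine lintegral_mono_ae ?_
    filter_upwards [hb] with x hx
    rw [Pi.mul_apply, enorm_mul, mul_pow]
    gcongr
  have hm : MemLp (f * g) 2 (volume : Measure ℝ) :=
    memLp_two_of_lintegral_lt_top (hf.mul hg.1)
      (h.trans_lt (ENNReal.mul_lt_top hB.lt_top (lintegral_lt_top_of_memLp_two hg)))
  exact ⟨hm, by rwa [sob_zero_eq hm, sob_zero_eq hg]⟩

/-- If `a² ≤ b²` then `1 + (a + b)² ≤ 4 (1 + b²)`, so the larger of the two weights dominates. -/
theorem wt_le_add {σ : ℝ} (hσ : 0 ≤ σ) (x y : ℝ) :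
    wt σ (x + y) ≤ ENNReal.ofReal (4 ^ σ) * (wt σ x + wt σ y) := by
  have key : ∀ a b : ℝ, 1 + a ^ 2 ≤ 1 + b ^ 2 → wt σ (a + b) ≤ ENNReal.ofReal (4 ^ σ) * wt σ b := by
    intro a b hab
    rw [wt, wt, ← ENNReal.ofReal_mul (by positivity), ← Real.mul_rpow (by positivity)
      (by positivity)]
    refine ENNReal.ofReal_le_ofReal (Real.rpow_le_rpow (by positivity) ?_ hσ)
    nlinarith [sq_nonneg (a - b)]
  rcases le_total (1 + x ^ 2) (1 + y ^ 2) with h | h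
  · exact (key x y h).trans (by gcongr; exact le_add_self)
  · rw [add_comm x y]
    exact (key y x h).trans (by gcongr; exact le_self_add)

/-- Both exponents are nonpositive and add up to `-s`; evaluating both weights at the point nearer
to the origin only increases the product. -/
theorem wt_mul_wt_le {s σ : ℝ} (hσ : 0 ≤ σ) (hσs : σ ≤ s) (x y : ℝ) :
    wt (σ - s) x * wt (-σ) y ≤ wt (-s) x + wt (-s) y := by
  have mono : ∀ τ : ℝ, τ ≤ 0 → ∀ a b : ℝ, 1 + a ^ 2 ≤ 1 + b ^ 2 → wt τ b ≤ wt τ a :=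
    fun τ hτ a b hab => ENNReal.ofReal_le_ofReal
      (Real.rpow_le_rpow_of_nonpos (by positivity) hab hτ)
  rcases le_total (1 + x ^ 2) (1 + y ^ 2) with h | h
  · calc wt (σ - s) x * wt (-σ) y ≤ wt (σ - s) x * wt (-σ) x := by
          gcongr; exact mono _ (by linarith) _ _ h
      _ = wt (-s) x := by rw [← wt_add]; congr 1; ring
      _ ≤ _ := le_self_add
  · calc wt (σ - s) x * wt (-σ) y ≤ wt (σ - s) y * wt (-σ) y := by
          gcongr; exact mono _ (by linarith) _ _ h
      _ = wt (-s) y := by rw [← wt_add]; congr 1; ring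
      _ ≤ _ := le_add_self

/-- The constant in the product estimate for Schwartz functions. -/
def prodConst (s σ : ℝ) : ℝ≥0∞ := 3 * (ENNReal.ofReal (4 ^ σ) * wtInt s)

theorem prodConst_lt_top {s : ℝ} (hs : 1 / 2 < s) (σ : ℝ) : prodConst s σ < ⊤ := by
  have := wtInt_lt_top hs
  unfold prodConst
  finiteness

/-- This is the kernel that Cauchy–Schwarz leaves over in the convolution estimate. Distributing `(1
+ ξ²)^σ` over `η` and `ξ - η` leaves three translated or reflected copies of the integrable weight
`wt (-s)`, whence the `3` in `prodConst`. -/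
theorem wt_kernel_le {s σ : ℝ} (hσ : 0 ≤ σ) (hσs : σ ≤ s) (ξ : ℝ) :
    wt σ ξ * ∫⁻ η, wt (-s) η * wt (-σ) (ξ - η) ≤ prodConst s σ := by
  have hpt : ∀ η, wt σ ξ * (wt (-s) η * wt (-σ) (ξ - η)) ≤
      ENNReal.ofReal (4 ^ σ) * (2 * wt (-s) η + wt (-s) (ξ - η)) := by
    intro η
    have h1 := wt_le_add hσ η (ξ - η)
    rw [add_sub_cancel] at h1
    calc wt σ ξ * (wt (-s) η * wt (-σ) (ξ - η))
        ≤ ENNReal.ofReal (4 ^ σ) * (wt σ η + wt σ (ξ - η)) * (wt (-s) η * wt (-σ) (ξ - η)) := by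
          gcongr
      _ = ENNReal.ofReal (4 ^ σ) * ((wt σ η * wt (-s) η) * wt (-σ) (ξ - η) +
            wt (-s) η * (wt σ (ξ - η) * wt (-σ) (ξ - η))) := by ring
      _ = ENNReal.ofReal (4 ^ σ) * (wt (σ - s) η * wt (-σ) (ξ - η) + wt (-s) η) := by
          rw [← wt_add, wt_neg, mul_one, ← sub_eq_add_neg σ s]
      _ ≤ ENNReal.ofReal (4 ^ σ) * ((wt (-s) η + wt (-s) (ξ - η)) + wt (-s) η) := by
          gcongr
          exact wt_mul_wt_le hσ hσs _ _
      _ = _ := by ring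
  rw [← lintegral_const_mul' _ _ (wt_ne_top _ _)]
  refine (lintegral_mono hpt).trans_eq ?_
  rw [lintegral_const_mul' _ _ (by simp), lintegral_add_left ((measurable_wt _).const_mul 2),
    lintegral_const_mul' _ _ (by norm_num), lintegral_sub_left_eq_self (fun η => wt (-s) η) ξ]
  rw [prodConst, wtInt]
  ring

theorem wt_even (σ ξ : ℝ) : wt σ (-ξ) = wt σ ξ := by simp [wt]

/-- Young's inequality in weighted `L²` spaces. -/
theorem wt_convolution_le {s σ : ℝ} (hσ : 0 ≤ σ) (hσs : σ ≤ s) {a b : ℝ → ℝ≥0∞}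
    (ha : Measurable a) (hb : Measurable b) :
    ∫⁻ ξ, wt σ ξ * (∫⁻ η, a η * b (ξ - η)) ^ 2 ≤
      prodConst s σ * ((∫⁻ ξ, wt s ξ * a ξ ^ 2) * ∫⁻ ξ, wt σ ξ * b ξ ^ 2) := by
  have hw := measurable_wt
  have h1 : ∀ ξ, wt σ ξ * (∫⁻ η, a η * b (ξ - η)) ^ 2 ≤
      prodConst s σ * ∫⁻ η, (wt s η * a η ^ 2) * (wt σ (ξ - η) * b (ξ - η) ^ 2) := by
    intro ξ
    -- Cauchy–Schwarz in `η` after inserting the weights of `a` and `b` together with their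
    -- inverses.
    have hcs := lintegral_mul_sq_le (μ := volume)
      (f := fun η => wt (-s / 2) η * wt (-σ / 2) (ξ - η))
      (g := fun η => (wt (s / 2) η * a η) * (wt (σ / 2) (ξ - η) * b (ξ - η)))
      (by have := hw (-s / 2); have := hw (-σ / 2); fun_prop)
      (by have := hw (s / 2); have := hw (σ / 2); fun_prop)
    have e1 : ∀ η, wt (-s / 2) η * wt (-σ / 2) (ξ - η) *
        ((wt (s / 2) η * a η) * (wt (σ / 2) (ξ - η) * b (ξ - η))) = a η * b (ξ - η) := by
      intro η
      have i1 : wt (-s / 2) η * wt (s / 2) η = 1 := by rw [← wt_add, ← add_div]; simp [wt_zero]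
      have i2 : wt (-σ / 2) (ξ - η) * wt (σ / 2) (ξ - η) = 1 := by
        rw [← wt_add, ← add_div]; simp [wt_zero]
      calc _ = (wt (-s / 2) η * wt (s / 2) η) * (wt (-σ / 2) (ξ - η) * wt (σ / 2) (ξ - η)) *
            (a η * b (ξ - η)) := by ring
        _ = _ := by rw [i1, i2]; ring
    simp only [e1, mul_pow, wt_half_sq] at hcs
    calc wt σ ξ * (∫⁻ η, a η * b (ξ - η)) ^ 2 ≤ wt σ ξ * _ := mul_le_mul' le_rfl hcs
      _ = (wt σ ξ * ∫⁻ η, wt (-s) η * wt (-σ) (ξ - η)) *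
          ∫⁻ η, (wt s η * a η ^ 2) * (wt σ (ξ - η) * b (ξ - η) ^ 2) := by
        rw [mul_assoc]
      _ ≤ _ := by
        gcongr
        exact wt_kernel_le hσ hσs ξ
  refine (lintegral_mono h1).trans ?_
  have hm1 := hw s
  have hm2 := hw σ
  have hP : Measurable fun ξ => ∫⁻ η, (wt s η * a η ^ 2) * (wt σ (ξ - η) * b (ξ - η) ^ 2) := by
    apply Measurable.lintegral_prod_right'
      (f := fun p : ℝ × ℝ => (wt s p.2 * a p.2 ^ 2) * (wt σ (p.1 - p.2) * b (p.1 - p.2) ^ 2))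
    fun_prop
  rw [lintegral_const_mul _ hP]
  gcongr
  -- After Tonelli, translation invariance in `ξ` decouples the two integrals.
  rw [lintegral_lintegral_swap]
  · refine le_of_eq ?_
    have : ∀ η, ∫⁻ ξ, (wt s η * a η ^ 2) * (wt σ (ξ - η) * b (ξ - η) ^ 2) =
        (wt s η * a η ^ 2) * ∫⁻ ξ, wt σ ξ * b ξ ^ 2 := by
      intro η
      rw [lintegral_const_mul _ (by fun_prop),
        lintegral_sub_right_eq_self (fun ξ => wt σ ξ * b ξ ^ 2) η]
    simp only [this]
    rw [lintegral_mul_const _ (by fun_prop)]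
  · refine Measurable.aemeasurable ?_
    fun_prop

/-- The product of two Schwartz functions. -/
def schwartzMul (φ γ : 𝓢(ℝ, ℂ)) : 𝓢(ℝ, ℂ) := SchwartzMap.pairing (ContinuousLinearMap.mul ℂ ℂ) φ γ

theorem schwartzMul_coe (φ γ : 𝓢(ℝ, ℂ)) : (schwartzMul φ γ : ℝ → ℂ) = φ * γ := by
  ext x
  simp [schwartzMul]

theorem fourierInv_schwartzMul (φ γ : 𝓢(ℝ, ℂ)) (ξ : ℝ) :
    (𝓕⁻ (schwartzMul φ γ)) ξ = ∫ η, (𝓕⁻ φ) η * (𝓕⁻ γ) (ξ - η) := by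
  have h := SchwartzMap.fourier_convolution (ContinuousLinearMap.mul ℂ ℂ) (𝓕⁻ φ) (𝓕⁻ γ)
  rw [fourier_fourierInv_eq, fourier_fourierInv_eq] at h
  rw [schwartzMul, ← h, fourierInv_fourier_eq, SchwartzMap.convolution_apply, convolution_def]
  simp

/-- The weight is even, so the inverse transform serves equally well; it turns products of Schwartz
functions into convolutions. -/
theorem sob_schwartz_eq_inv (σ : ℝ) (φ : 𝓢(ℝ, ℂ)) :
    sob σ φ = ∫⁻ ξ, wt σ ξ * ‖(𝓕⁻ φ) ξ‖ₑ ^ 2 := by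
  rw [sob_schwartz_eq, ← lintegral_neg_eq_self]
  refine lintegral_congr fun ξ => ?_
  rw [wt_even, SchwartzMap.fourierInv_coe, Real.fourierInv_eq_fourier_neg, SchwartzMap.fourier_coe]

theorem sob_schwartz_mul_le {s σ : ℝ} (hσ : 0 ≤ σ) (hσs : σ ≤ s) (φ γ : 𝓢(ℝ, ℂ)) :
    sob σ ((φ : ℝ → ℂ) * γ) ≤ prodConst s σ * (sob s φ * sob σ γ) := by
  rw [← schwartzMul_coe, sob_schwartz_eq_inv, sob_schwartz_eq_inv, sob_schwartz_eq_inv]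
  refine le_trans ?_ (wt_convolution_le hσ hσs (𝓕⁻ φ).continuous.enorm.measurable
    (𝓕⁻ γ).continuous.enorm.measurable)
  gcongr with ξ
  rw [fourierInv_schwartzMul]
  refine (enorm_integral_le_lintegral_enorm _).trans_eq ?_
  simp [enorm_mul]

/-- The product of functions of Sobolev orders `s > 1/2` and `σ ∈ [0, s]` is of order `σ`. -/
theorem sob_mul_le {s σ : ℝ} (hs : 1 / 2 < s) (hσ : 0 ≤ σ) (hσs : σ ≤ s) {f g : ℝ → ℂ}
    (hf : sob s f < ⊤) (hg : sob σ g < ⊤) :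
    sob σ (f * g) ≤ 4 * prodConst s σ * (sob s f * sob σ g) := by
  have hs0 : (0 : ℝ) ≤ s := by linarith
  obtain ⟨φ, hφ⟩ := exists_schwartz_tendsto hf
  obtain ⟨γ, hγ⟩ := exists_schwartz_tendsto hg
  have hfm := memLp_of_sob_lt_top hf
  have hgm := memLp_of_sob_lt_top hg
  have hW := wtInt_lt_top hs
  have hC := prodConst_lt_top hs σ
  have hfg := memLp_mul_of_bound hfm.1 (B := 2 * wtInt s * sob s f) (by finiteness)
    (ae_enorm_sq_le hs hf) hgm
  have ha : Tendsto (fun n => 2 * sob s (φ n - f) + 2 * sob s f) atTop (𝓝 (2 * 0 + 2 * sob s f)) :=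
    (ENNReal.Tendsto.const_mul hφ (Or.inr (by norm_num))).add tendsto_const_nhds
  have hb : Tendsto (fun n => 2 * sob σ (γ n - g) + 2 * sob σ g) atTop (𝓝 (2 * 0 + 2 * sob σ g)) :=
    (ENNReal.Tendsto.const_mul hγ (Or.inr (by norm_num))).add tendsto_const_nhds
  -- Lower semicontinuity passes the Schwartz estimate to the limit and asks for convergence of the
  -- products in `L²` only. The two factors `2` produce the `4` of the statement.
  refine (sob_le_of_tendsto (σ := σ) (f := fun n => (φ n : ℝ → ℂ) * γ n)
    (b := fun n => prodConst s σ * ((2 * sob s (φ n - f) + 2 * sob s f) *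
      (2 * sob σ (γ n - g) + 2 * sob σ g))) ?_ hfg.1 ?_ ?_ ?_).trans_eq
      (b := prodConst s σ * ((2 * 0 + 2 * sob s f) * (2 * 0 + 2 * sob σ g))) ?_
  · intro n
    rw [← schwartzMul_coe]
    exact memLp_schwartz _
  · have hlim : Tendsto (fun n => 2 * ((wtInt s * (2 * sob s (φ n - f) + 2 * sob s f)) *
        sob 0 (γ n - g)) + 2 * (2 * wtInt s * sob s (φ n - f) * sob 0 g)) atTop
        (𝓝 (2 * ((wtInt s * (2 * 0 + 2 * sob s f)) * 0) + 2 * (2 * wtInt s * 0 * sob 0 g))) := by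
      have g0 : sob 0 g < ⊤ := (sob_mono hσ g).trans_lt hg
      refine Tendsto.add (ENNReal.Tendsto.const_mul ?_ (Or.inr (by norm_num)))
        (ENNReal.Tendsto.const_mul ?_ (Or.inr (by norm_num)))
      · refine ENNReal.Tendsto.mul (ENNReal.Tendsto.const_mul ha (Or.inr hW.ne)) (Or.inr (by simp))
          (tendsto_sob_mono hσ hγ) (Or.inr (by finiteness))
      · refine ENNReal.Tendsto.mul_const (ENNReal.Tendsto.const_mul hφ (Or.inr (by finiteness)))
          (Or.inr g0.ne)
    simp only [mul_zero, zero_mul, add_zero] at hlim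
    refine tendsto_of_tendsto_of_tendsto_of_le_of_le' tendsto_const_nhds hlim
      (Eventually.of_forall fun _ => zero_le) ?_
    filter_upwards [hφ.eventually_lt_const (zero_lt_one), hγ.eventually_lt_const (zero_lt_one)]
      with n hn hn'
    -- In each term the factor of order `s` is bounded in the supremum norm and the other factor
    -- lies in `L²`.
    have e : (φ n : ℝ → ℂ) * γ n - f * g = (φ n : ℝ → ℂ) * (γ n - g) + (φ n - f) * g := by ring
    rw [e]
    refine (sob_add_le _ _ _).trans ?_
    have hsn := sob_schwartz_lt_top s (φ n)
    have b1 := (memLp_mul_of_bound (memLp_schwartz (φ n)).1 (B := wtInt s * sob s (φ n))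
      (by finiteness) (Eventually.of_forall fun x => schwartz_sup_le s (φ n) x)
      ((memLp_schwartz (γ n)).sub hgm)).2
    have hd : sob s (φ n - f) < ⊤ := hn.trans (by simp)
    have b2 := (memLp_mul_of_bound ((memLp_schwartz (φ n)).sub hfm).1
      (B := 2 * wtInt s * sob s (φ n - f))
      (ENNReal.mul_ne_top (by finiteness) hd.ne) (ae_enorm_sq_le hs hd) hgm).2
    refine add_le_add ?_ ?_
    · gcongr
      refine b1.trans ?_
      gcongr
      exact sob_le_of_sub _ _ _
    · gcongr
  · intro n
    refine (sob_schwartz_mul_le hσ hσs (φ n) (γ n)).trans ?_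
    gcongr
    · exact sob_le_of_sub _ _ _
    · exact sob_le_of_sub _ _ _
  · refine ENNReal.Tendsto.const_mul ?_ (Or.inr hC.ne)
    refine ENNReal.Tendsto.mul ha (Or.inr (by finiteness)) hb (Or.inr (by finiteness))
  · ring

theorem sob_mul_lt_top {s σ : ℝ} (hs : 1 / 2 < s) (hσ : 0 ≤ σ) (hσs : σ ≤ s) {f g : ℝ → ℂ}
    (hf : sob s f < ⊤) (hg : sob σ g < ⊤) : sob σ (f * g) < ⊤ := by
  have := prodConst_lt_top hs σ
  exact (sob_mul_le hs hσ hσs hf hg).trans_lt (by finiteness)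

/-! ### Calculus of weak derivatives -/

theorem tendsto_sob_mul {ι : Type*} {l : Filter ι} {s σ : ℝ} (hs : 1 / 2 < s) (hσ : 0 ≤ σ)
    (hσs : σ ≤ s) {f : ι → ℝ → ℂ} {g : ι → ℝ → ℂ} {f₀ g₀ : ℝ → ℂ} (hf₀ : sob s f₀ < ⊤)
    (hg₀ : sob σ g₀ < ⊤) (hf : Tendsto (fun i => sob s (f i - f₀)) l (𝓝 0))
    (hg : Tendsto (fun i => sob σ (g i - g₀)) l (𝓝 0)) :
    Tendsto (fun i => sob σ (f i * g i - f₀ * g₀)) l (𝓝 0) := by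
  set C := 4 * prodConst s σ with hC
  have hCt : C ≠ ⊤ := by have := prodConst_lt_top hs σ; finiteness
  have hlim : Tendsto (fun i => 2 * (C * (sob s (f i - f₀) * sob σ (g i - g₀))) +
      2 * (2 * (C * (sob s (f i - f₀) * sob σ g₀)) + 2 * (C * (sob s f₀ * sob σ (g i - g₀)))))
      l (𝓝 (2 * (C * (0 * 0)) + 2 * (2 * (C * (0 * sob σ g₀)) + 2 * (C * (sob s f₀ * 0))))) := by
    have h2 : (2 : ℝ≥0∞) ≠ ⊤ := by norm_num
    refine (ENNReal.Tendsto.const_mul (ENNReal.Tendsto.const_mul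
      (ENNReal.Tendsto.mul hf (Or.inr (by simp)) hg (Or.inr (by simp))) (Or.inr hCt))
      (Or.inr h2)).add (ENNReal.Tendsto.const_mul ((ENNReal.Tendsto.const_mul
      (ENNReal.Tendsto.const_mul (ENNReal.Tendsto.mul_const hf (Or.inr hg₀.ne)) (Or.inr hCt))
      (Or.inr h2)).add (ENNReal.Tendsto.const_mul (ENNReal.Tendsto.const_mul
      (ENNReal.Tendsto.const_mul hg (Or.inr hf₀.ne)) (Or.inr hCt)) (Or.inr h2))) (Or.inr h2))
  simp only [mul_zero, zero_mul, add_zero] at hlim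
  refine tendsto_of_tendsto_of_tendsto_of_le_of_le' tendsto_const_nhds hlim
    (Eventually.of_forall fun _ => zero_le) ?_
  filter_upwards [hf.eventually_lt_const zero_lt_one, hg.eventually_lt_const zero_lt_one]
    with i hi hi'
  have a1 : sob s (f i - f₀) < ⊤ := hi.trans (by simp)
  have a2 : sob σ (g i - g₀) < ⊤ := hi'.trans (by simp)
  have e : f i * g i - f₀ * g₀ =
      (f i - f₀) * (g i - g₀) + ((f i - f₀) * g₀ + f₀ * (g i - g₀)) := by ring
  rw [e]
  refine (sob_add_le _ _ _).trans ?_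
  gcongr
  · exact sob_mul_le hs hσ hσs a1 a2
  · refine (sob_add_le _ _ _).trans ?_
    gcongr
    · exact sob_mul_le hs hσ hσs a1 hg₀
    · exact sob_mul_le hs hσ hσs hf₀ a2

theorem two_mul_add_lt_top {a b : ℝ≥0∞} (ha : a < ⊤) (hb : b < ⊤) : 2 * a + 2 * b < ⊤ := by
  finiteness

theorem sob_lt_top_of_tendsto {ι : Type*} {l : Filter ι} {σ : ℝ} {f : ι → ℝ → ℂ} {g : ℝ → ℂ}
    (h : Tendsto (fun i => sob σ (f i - g)) l (𝓝 0)) (hg : sob σ g < ⊤) :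
    ∀ᶠ i in l, sob σ (f i) < ⊤ := by
  filter_upwards [h.eventually_lt_const zero_lt_one] with i hi
  exact (sob_le_of_sub σ (f i) g).trans_lt (two_mul_add_lt_top (hi.trans one_lt_top) hg)

theorem tendsto_ofL2_apply {ι : Type*} {l : Filter ι} {f : ι → ℝ → ℂ} {g : ℝ → ℂ}
    (hf : ∀ᶠ i in l, MemLp (f i) 2 (volume : Measure ℝ)) (hg : MemLp g 2 (volume : Measure ℝ))
    (h : Tendsto (fun i => sob 0 (f i - g)) l (𝓝 0)) (φ : 𝓢(ℝ, ℂ)) :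
    Tendsto (fun i => ofL2 (f i) φ) l (𝓝 (ofL2 g φ)) := by
  classical
  set F : ι → L2 := fun i => if hi : MemLp (f i) 2 (volume : Measure ℝ) then hi.toLp _ else 0
  have hF : Tendsto F l (𝓝 (hg.toLp g)) := by
    rw [Lp.tendsto_Lp_iff_tendsto_eLpNorm']
    refine tendsto_of_tendsto_sq (h.congr' ?_)
    filter_upwards [hf] with i hi
    have : F i = hi.toLp _ := dif_pos hi
    rw [sob_zero_eq_eLpNorm (hi.sub hg), this]
    congr 1
    refine eLpNorm_congr_ae ?_
    filter_upwards [hi.coeFn_toLp, hg.coeFn_toLp] with x h1 h2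
    simp [h1, h2]
  have hc : Continuous fun u : L2 => Lp.toTemperedDistribution u φ :=
    (PointwiseConvergenceCLM.evalCLM (RingHom.id ℂ) ℂ φ).continuous.comp
      (Lp.toTemperedDistributionCLM ℂ (volume : Measure ℝ) 2).continuous
  have := (hc.tendsto (hg.toLp g)).comp hF
  rw [ofL2_of_memLp hg]
  refine this.congr' ?_
  filter_upwards [hf] with i hi
  rw [ofL2_of_memLp hi, Function.comp_apply]
  simp [F, hi]

/-- The weak derivative is a closed operator on `L²`: the tested identity passes to the limit. The
quotient rule and the chain rule below follow from their classical versions in this way. -/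
theorem HasWeakDeriv.of_tendsto {ι : Type*} {l : Filter ι} [l.NeBot] {f g : ι → ℝ → ℂ}
    {f₀ g₀ : ℝ → ℂ} (h : ∀ᶠ i in l, HasWeakDeriv (f i) (g i))
    (hf₀ : MemLp f₀ 2 (volume : Measure ℝ)) (hg₀ : MemLp g₀ 2 (volume : Measure ℝ))
    (hf : Tendsto (fun i => sob 0 (f i - f₀)) l (𝓝 0))
    (hg : Tendsto (fun i => sob 0 (g i - g₀)) l (𝓝 0)) : HasWeakDeriv f₀ g₀ := by
  refine ⟨hf₀, hg₀, ?_⟩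
  ext φ
  rw [derivCLM_apply_apply]
  refine tendsto_nhds_unique (tendsto_ofL2_apply (h.mono fun _ h => h.left) hf₀ hf _) ?_
  refine (tendsto_ofL2_apply (h.mono fun _ h => h.right) hg₀ hg φ).congr' ?_
  filter_upwards [h] with i hi
  rw [← hi.eq, derivCLM_apply_apply]

/-- A classical derivative is a weak derivative. -/
theorem hasWeakDeriv_of_hasDerivAt {f g : ℝ → ℂ} (hf : MemLp f 2 (volume : Measure ℝ))
    (hg : MemLp g 2 (volume : Measure ℝ)) (h : ∀ x, HasDerivAt f (g x) x) : HasWeakDeriv f g := by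
  refine ⟨hf, hg, ?_⟩
  ext φ
  rw [derivCLM_apply_apply, ofL2_apply hf, ofL2_apply hg]
  have hφ : ∀ x, HasDerivAt (φ : ℝ → ℂ) (SchwartzMap.derivCLM ℂ ℂ φ x) x := fun x => by
    simpa using (φ.differentiableAt (x := x)).hasDerivAt
  have := integral_mul_deriv_eq_deriv_mul_of_integrable (fun x _ => hφ x) (fun x _ => h x)
    ((memLp_schwartz φ).integrable_mul hg)
    ((memLp_schwartz (SchwartzMap.derivCLM ℂ ℂ φ)).integrable_mul hf)
    ((memLp_schwartz φ).integrable_mul hf)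
  rw [this, ← integral_neg]
  refine integral_congr_ae (Eventually.of_forall fun x => ?_)
  simp

/-- The derivative of a Schwartz function. -/
abbrev schwartzDeriv (φ : 𝓢(ℝ, ℂ)) : 𝓢(ℝ, ℂ) := SchwartzMap.derivCLM ℂ ℂ φ

theorem schwartz_hasDerivAt (φ : 𝓢(ℝ, ℂ)) (x : ℝ) :
    HasDerivAt (φ : ℝ → ℂ) (schwartzDeriv φ x) x := by
  simpa using (φ.differentiableAt (x := x)).hasDerivAt

theorem schwartz_hasWeakDeriv (φ : 𝓢(ℝ, ℂ)) : HasWeakDeriv φ (schwartzDeriv φ) :=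
  hasWeakDeriv_of_hasDerivAt (memLp_schwartz _) (memLp_schwartz _) (schwartz_hasDerivAt φ)

theorem sob_zero_lt_top {f : ℝ → ℂ} (h : MemLp f 2 (volume : Measure ℝ)) : sob 0 f < ⊤ := by
  rw [sob_zero_eq h]
  exact lintegral_lt_top_of_memLp_two h

theorem HasWeakDeriv.sob_one_lt_top {f g : ℝ → ℂ} (h : HasWeakDeriv f g) : sob 1 f < ⊤ := by
  have := h.sob_lt_top (σ := 0) (sob_zero_lt_top h.left) (sob_zero_lt_top h.right)
  simpa using this

theorem HasWeakDeriv.exists_schwartz {f g : ℝ → ℂ} (h : HasWeakDeriv f g) :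
    ∃ φ : ℕ → 𝓢(ℝ, ℂ), Tendsto (fun n => sob 1 (φ n - f)) atTop (𝓝 0) ∧
      Tendsto (fun n => sob 0 (schwartzDeriv (φ n) - g)) atTop (𝓝 0) := by
  obtain ⟨φ, hφ⟩ := exists_schwartz_tendsto h.sob_one_lt_top
  refine ⟨φ, hφ, ?_⟩
  have hlim := ENNReal.Tendsto.const_mul (a := fourPiSq) hφ (Or.inr fourPiSq_ne_top)
  rw [mul_zero] at hlim
  refine tendsto_of_tendsto_of_tendsto_of_le_of_le tendsto_const_nhds hlim (fun _ => zero_le)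
    fun n => ?_
  have := ((schwartz_hasWeakDeriv (φ n)).sub h).sob_deriv_le 0
  simpa using this

theorem tendsto_of_tendsto_sob {s : ℝ} (hs : 1 / 2 < s) {ι : Type*} {l : Filter ι}
    {f : ι → ℝ → ℂ} {g : ℝ → ℂ} (hf : ∀ i, Continuous (f i)) (hg : Continuous g)
    (h : Tendsto (fun i => sob s (f i - g)) l (𝓝 0)) : TendstoUniformly f g l := by
  have hW := wtInt_lt_top hs
  rw [Metric.tendstoUniformly_iff]
  intro ε hε
  have hlim : Tendsto (fun n => 2 * wtInt s * sob s (f n - g)) l (𝓝 0) := by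
    have := ENNReal.Tendsto.const_mul (a := 2 * wtInt s) h (Or.inr (by finiteness))
    simpa using this
  have hpos : (0 : ℝ≥0∞) < ENNReal.ofReal ((ε / 2) ^ 2) := by
    rw [ENNReal.ofReal_pos]; positivity
  filter_upwards [hlim.eventually_lt_const hpos, h.eventually_lt_const zero_lt_one] with i hi hi'
    x
  rw [dist_comm, dist_eq_norm]
  refine lt_of_le_of_lt (norm_le_of_enorm_sq_le (by positivity) ?_) (half_lt_self hε)
  exact (enorm_sq_le hs (hi'.trans one_lt_top) ((hf i).sub hg) x).trans hi.le

/-- The fundamental theorem of calculus for weak derivatives. -/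
theorem HasWeakDeriv.integral_eq_sub {f g : ℝ → ℂ} (h : HasWeakDeriv f g) (hf : Continuous f)
    (a b : ℝ) : ∫ x in a..b, g x = f b - f a := by
  obtain ⟨φ, h1, h2⟩ := h.exists_schwartz
  have hu := tendsto_of_tendsto_sob (by norm_num) (fun n => (φ n).continuous) hf h1
  have hloc : ∀ {v : ℝ → ℂ}, MemLp v 2 (volume : Measure ℝ) → IntervalIntegrable v volume a b :=
    fun hv => ((hv.locallyIntegrable (by norm_num)).integrableOn_isCompact
      isCompact_uIcc).intervalIntegrable
  -- Cauchy–Schwarz on the interval, whose measure is finite.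
  have hl : Tendsto (fun n => ∫ x in a..b, schwartzDeriv (φ n) x) atTop (𝓝 (∫ x in a..b, g x)) := by
    rw [tendsto_iff_edist_tendsto_0]
    refine tendsto_of_tendsto_sq ?_
    have hv : volume (uIoc a b) ≠ ⊤ := by
      rw [uIoc, Real.volume_Ioc]; exact ENNReal.ofReal_ne_top
    have hlim := ENNReal.Tendsto.const_mul (a := volume (uIoc a b)) h2 (Or.inr hv)
    rw [mul_zero] at hlim
    refine tendsto_of_tendsto_of_tendsto_of_le_of_le tendsto_const_nhds hlim (fun _ => zero_le)
      fun n => ?_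
    show edist (∫ x in a..b, schwartzDeriv (φ n) x) (∫ x in a..b, g x) ^ 2 ≤ _
    rw [edist_eq_enorm_sub, ← intervalIntegral.integral_sub (hloc (memLp_schwartz _))
      (hloc h.right)]
    have hm : MemLp (fun x => schwartzDeriv (φ n) x - g x) 2 (volume : Measure ℝ) :=
      (memLp_schwartz _).sub h.right
    have e1 : ‖∫ x in a..b, (schwartzDeriv (φ n) x - g x)‖ₑ ≤
        ∫⁻ x in uIoc a b, 1 * ‖schwartzDeriv (φ n) x - g x‖ₑ := by
      simp only [one_mul]
      refine le_trans (le_of_eq ?_) (enorm_integral_le_lintegral_enorm _)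
      rw [← ofReal_norm, ← ofReal_norm, intervalIntegral.norm_intervalIntegral_eq]
    calc _ ≤ (∫⁻ x in uIoc a b, 1 * ‖schwartzDeriv (φ n) x - g x‖ₑ) ^ 2 := by gcongr
      _ ≤ (∫⁻ x in uIoc a b, 1 ^ 2) * ∫⁻ x in uIoc a b, ‖schwartzDeriv (φ n) x - g x‖ₑ ^ 2 :=
        lintegral_mul_sq_le aemeasurable_const hm.1.enorm.restrict
      _ ≤ volume (uIoc a b) * ∫⁻ x, ‖schwartzDeriv (φ n) x - g x‖ₑ ^ 2 := by
        gcongr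
        · simp
        · exact Measure.restrict_le_self
      _ = _ := by
        rw [sob_zero_eq ((memLp_schwartz _).sub h.right)]
        rfl
  refine tendsto_nhds_unique hl ?_
  have hr : Tendsto (fun n => φ n b - φ n a) atTop (𝓝 (f b - f a)) :=
    (hu.tendsto_at b).sub (hu.tendsto_at a)
  refine hr.congr fun n => ?_
  rw [intervalIntegral.integral_eq_sub_of_hasDerivAt (fun x _ => schwartz_hasDerivAt (φ n) x)
    (hloc (memLp_schwartz _))]

theorem HasWeakDeriv.hasDerivAt {f g : ℝ → ℂ} (h : HasWeakDeriv f g) (hf : Continuous f)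
    (hg : Continuous g) (x : ℝ) : HasDerivAt f (g x) x := by
  have e : f = fun y => f 0 + ∫ t in (0 : ℝ)..y, g t := by
    ext y
    rw [h.integral_eq_sub hf]
    ring
  rw [e]
  exact (intervalIntegral.integral_hasDerivAt_right (hg.intervalIntegrable _ _)
    (hg.stronglyMeasurableAtFilter _ _) hg.continuousAt).const_add _

/-- For Schwartz `g` this is the definition of the weak derivative of `f`; the general case follows
by density. It supplies the energy identity behind the uniqueness of the elliptic system. -/
theorem HasWeakDeriv.integral_mul {f g f' g' : ℝ → ℂ} (hf : HasWeakDeriv f f')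
    (hg : HasWeakDeriv g g') : ∫ x, f x * g' x = -∫ x, f' x * g x := by
  obtain ⟨γ, h3, h4⟩ := hg.exists_schwartz
  have key : ∀ n, ∫ x, f x * schwartzDeriv (γ n) x = -∫ x, f' x * γ n x := by
    intro n
    have := DFunLike.congr_fun hf.eq (γ n)
    rw [derivCLM_apply_apply, map_neg, ofL2_apply hf.left, ofL2_apply hf.right] at this
    rw [neg_eq_iff_eq_neg] at this
    simpa [mul_comm] using this
  have lim : ∀ {u v : ℝ → ℂ} {w : ℕ → 𝓢(ℝ, ℂ)}, MemLp u 2 (volume : Measure ℝ) →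
      MemLp v 2 (volume : Measure ℝ) → Tendsto (fun n => sob 0 (w n - v)) atTop (𝓝 0) →
      Tendsto (fun n => ∫ x, u x * w n x) atTop (𝓝 (∫ x, u x * v x)) := by
    intro u v w hu hv hw
    rw [tendsto_iff_edist_tendsto_0]
    refine tendsto_of_tendsto_sq ?_
    have hlim := ENNReal.Tendsto.const_mul (a := ∫⁻ x, ‖u x‖ₑ ^ 2) hw
      (Or.inr (lintegral_lt_top_of_memLp_two hu).ne)
    rw [mul_zero] at hlim
    refine tendsto_of_tendsto_of_tendsto_of_le_of_le tendsto_const_nhds hlim (fun _ => zero_le)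
      fun n => ?_
    show edist (∫ x, u x * w n x) (∫ x, u x * v x) ^ 2 ≤ _
    rw [edist_eq_enorm_sub, ← integral_sub (f := fun x => u x * w n x) (g := fun x => u x * v x)
      (hu.integrable_mul (memLp_schwartz _)) (hu.integrable_mul hv), sob_zero_eq ((memLp_schwartz _).sub hv)]
    refine le_trans ?_ (lintegral_mul_sq_le hu.1.enorm ((memLp_schwartz (w n)).sub hv).1.enorm)
    gcongr
    refine (enorm_integral_le_lintegral_enorm _).trans_eq ?_
    refine lintegral_congr fun x => ?_
    rw [← mul_sub, enorm_mul]
    rfl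
  have l1 := lim hf.left hg.right h4
  have l2 := lim hf.right hg.left (tendsto_sob_mono zero_le_one h3)
  exact tendsto_nhds_unique l1 (by simpa only [key] using l2.neg)

/-! ### The Gagliardo seminorm -/

/-- The symbol of the translation by `y`. -/
def transSymbol (y ξ : ℝ) : ℂ := Complex.exp ((2 * Real.pi * y * Complex.I : ℂ) * (ξ : ℂ))

theorem iteratedDeriv_cexp_mul (c : ℂ) (n : ℕ) :
    iteratedDeriv n (fun x : ℝ => Complex.exp (c * (x : ℂ))) =
      fun x : ℝ => c ^ n * Complex.exp (c * (x : ℂ)) := by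
  induction n with
  | zero => simp
  | succ n ih =>
    rw [iteratedDeriv_succ, ih]
    ext x
    have h : HasDerivAt (fun x : ℝ => Complex.exp (c * (x : ℂ))) (Complex.exp (c * (x : ℂ)) * c)
        x := by
      have h1 : HasDerivAt (fun x : ℝ => c * (x : ℂ)) c x := by
        simpa using (Complex.ofRealCLM.hasDerivAt (x := x)).const_mul c
      exact h1.cexp
    rw [(h.const_mul (c ^ n)).deriv]
    ring

theorem norm_transSymbol (y ξ : ℝ) : ‖transSymbol y ξ‖ = 1 := by
  rw [transSymbol, show (2 * Real.pi * y * Complex.I : ℂ) * (ξ : ℂ) =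
    ((2 * Real.pi * y * ξ : ℝ) : ℂ) * Complex.I by push_cast; ring]
  exact Complex.norm_exp_ofReal_mul_I _

theorem transSymbol_temperate (y : ℝ) : (transSymbol y).HasTemperateGrowth := by
  constructor
  · have : ContDiff ℝ ((⊤ : ℕ∞) : WithTop ℕ∞) fun x : ℝ => (x : ℂ) := Complex.ofRealCLM.contDiff
    unfold transSymbol
    fun_prop
  · intro n
    refine ⟨0, ‖(2 * Real.pi * y * Complex.I : ℂ) ^ n‖, fun x => ?_⟩
    rw [norm_iteratedFDeriv_eq_norm_iteratedDeriv]
    have := congrFun (iteratedDeriv_cexp_mul (2 * Real.pi * y * Complex.I) n) x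
    show ‖iteratedDeriv n (fun x : ℝ => Complex.exp ((2 * Real.pi * y * Complex.I) * (x : ℂ))) x‖ ≤ _
    rw [this, norm_mul]
    have h1 : ‖Complex.exp ((2 * Real.pi * y * Complex.I : ℂ) * (x : ℂ))‖ = 1 :=
      norm_transSymbol y x
    rw [h1]
    simp

theorem memLp_translate {f : ℝ → ℂ} (hf : MemLp f 2 (volume : Measure ℝ)) (y : ℝ) :
    MemLp (fun x => f (x + y)) 2 (volume : Measure ℝ) :=
  hf.comp_measurePreserving (measurePreserving_add_right volume y)

theorem fourierMultiplier_transSymbol {f : ℝ → ℂ} (hf : MemLp f 2 (volume : Measure ℝ)) (y : ℝ) :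
    fourierMultiplierCLM ℂ (transSymbol y) (ofL2 f) = ofL2 fun x => f (x + y) := by
  ext φ
  rw [fourierMultiplierCLM_apply_apply, ofL2_apply hf, ofL2_apply (memLp_translate hf y)]
  have h : ∀ x, (𝓕 (SchwartzMap.smulLeftCLM ℂ (transSymbol y) (𝓕⁻ φ))) x = φ (x - y) := by
    intro x
    have h1 : φ (x - y) = (𝓕 (𝓕⁻ φ)) (x - y) := by rw [fourier_fourierInv_eq]
    rw [h1, SchwartzMap.fourier_coe, SchwartzMap.fourier_coe, Real.fourier_eq', Real.fourier_eq']
    refine integral_congr_ae (Eventually.of_forall fun v => ?_)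
    simp only [SchwartzMap.smulLeftCLM_apply_apply (transSymbol_temperate y), smul_eq_mul,
      ← mul_assoc, transSymbol]
    rw [← Complex.exp_add]
    congr 2
    simp
    ring
  simp only [h]
  rw [← integral_add_right_eq_self (fun x => φ (x - y) * f x) y]
  simp

theorem sob_zero_translate_sub {f : ℝ → ℂ} (hf : MemLp f 2 (volume : Measure ℝ)) (y : ℝ) :
    ∫⁻ x, ‖f (x + y) - f x‖ₑ ^ 2 =
      ∫⁻ ξ, ‖transSymbol y ξ - 1‖ₑ ^ 2 * ‖(𝓕 (hf.toLp f) : L2) ξ‖ₑ ^ 2 := by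
  have hm := memLp_translate hf y
  have h := fourierMultiplier_transSymbol hf y
  rw [ofL2_of_memLp hf, ofL2_of_memLp hm,
    fourierMultiplier_toTemperedDistribution_iff (transSymbol_temperate y)] at h
  have e := sob_zero_sub hm hf
  rw [sob_zero_eq (hm.sub hf), eLpNorm_sq_eq_lintegral] at e
  refine e.trans (lintegral_congr_ae ?_)
  filter_upwards [h] with ξ hξ
  rw [hξ, ← sub_one_mul, enorm_mul, mul_pow]

/-- The weight in the Gagliardo seminorm. -/
def gagWt (σ t : ℝ) : ℝ≥0∞ := ENNReal.ofReal (|t| ^ (-1 - 2 * σ))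

theorem measurable_gagWt (σ : ℝ) : Measurable (gagWt σ) := by
  unfold gagWt
  fun_prop

/-- The square of the Gagliardo seminorm of order `σ`. -/
def gag (σ : ℝ) (f : ℝ → ℂ) : ℝ≥0∞ := ∫⁻ x, ∫⁻ z, gagWt σ (z - x) * ‖f z - f x‖ₑ ^ 2

theorem gag_eq_translate (σ : ℝ) {f : ℝ → ℂ} (hf : Measurable f) :
    gag σ f = ∫⁻ y, gagWt σ y * ∫⁻ x, ‖f (x + y) - f x‖ₑ ^ 2 := by
  have hw := measurable_gagWt σ
  have h1 : gag σ f = ∫⁻ x, ∫⁻ y, gagWt σ y * ‖f (x + y) - f x‖ₑ ^ 2 := by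
    refine lintegral_congr fun x => ?_
    rw [← lintegral_add_left_eq_self _ x]
    simp
  rw [h1, lintegral_lintegral_swap]
  · refine lintegral_congr fun y => ?_
    rw [lintegral_const_mul _ (by fun_prop)]
  · refine Measurable.aemeasurable ?_
    fun_prop

/-- The constant relating the Gagliardo seminorm to the Fourier transform. -/
def gagConst (σ : ℝ) : ℝ≥0∞ := ∫⁻ t, gagWt σ t * ‖transSymbol t 1 - 1‖ₑ ^ 2

theorem measurable_transSymbol_sub (ξ : ℝ) : Measurable fun y => ‖transSymbol y ξ - 1‖ₑ ^ 2 := by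
  unfold transSymbol
  fun_prop

/-- Substitute `t = ξ y`: the weight contributes `|ξ|^(1 + 2σ)` and the measure `|ξ|⁻¹`. -/
theorem gagConst_scale (σ : ℝ) {ξ : ℝ} (hξ : ξ ≠ 0) :
    ∫⁻ y, gagWt σ y * ‖transSymbol y ξ - 1‖ₑ ^ 2 =
      ENNReal.ofReal (|ξ| ^ (2 * σ)) * gagConst σ := by
  have hpos : 0 < |ξ| := abs_pos.mpr hξ
  have e : ∀ y, gagWt σ y * ‖transSymbol y ξ - 1‖ₑ ^ 2 =
      ENNReal.ofReal (|ξ| ^ (1 + 2 * σ)) * (fun t => gagWt σ t * ‖transSymbol t 1 - 1‖ₑ ^ 2)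
        (ξ * y) := by
    intro y
    have e1 : transSymbol (ξ * y) 1 = transSymbol y ξ := by
      simp only [transSymbol]; congr 1; push_cast; ring
    have e2 : gagWt σ y = ENNReal.ofReal (|ξ| ^ (1 + 2 * σ)) * gagWt σ (ξ * y) := by
      rw [gagWt, gagWt, ← ENNReal.ofReal_mul (by positivity), abs_mul,
        Real.mul_rpow (by positivity) (by positivity), ← mul_assoc, ← Real.rpow_add hpos]
      simp
    simp only [e1]
    rw [e2, mul_assoc]
  have hm : Measurable fun t => gagWt σ t * ‖transSymbol t 1 - 1‖ₑ ^ 2 :=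
    (measurable_gagWt σ).mul (measurable_transSymbol_sub 1)
  simp only [e]
  rw [lintegral_const_mul' _ _ (by simp), ← lintegral_map hm (measurable_const_mul ξ),
    Real.map_volume_mul_left hξ, lintegral_smul_measure, smul_eq_mul, ← mul_assoc,
    ← ENNReal.ofReal_mul (by positivity), gagConst]
  congr 2
  rw [abs_inv, ← Real.rpow_neg_one, ← Real.rpow_add hpos]
  congr 1
  ring

/-- On `(0, 1)` the weight is positive and `exp (2πit) ≠ 1`. -/
theorem gagConst_ne_zero (σ : ℝ) : gagConst σ ≠ 0 := by
  intro h
  have hm : Measurable fun t => gagWt σ t * ‖transSymbol t 1 - 1‖ₑ ^ 2 :=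
    (measurable_gagWt σ).mul (measurable_transSymbol_sub 1)
  rw [gagConst, lintegral_eq_zero_iff hm] at h
  have h0 : volume (Ioo (0 : ℝ) 1) = 0 := by
    refine measure_mono_null (fun t ht => ?_) h
    simp only [mem_compl_iff, mem_ofPred_eq, Pi.zero_apply, mul_eq_zero, not_or]
    refine ⟨?_, ?_⟩
    · rw [gagWt, ENNReal.ofReal_eq_zero, not_le]
      have := abs_pos.mpr ht.1.ne'
      positivity
    · rw [pow_eq_zero_iff (by norm_num), enorm_eq_zero, sub_eq_zero, transSymbol,
        Complex.exp_eq_one_iff]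
      rintro ⟨n, hn⟩
      have : (t : ℂ) = n := by
        have hp : (2 * Real.pi * Complex.I : ℂ) ≠ 0 := by
          simp [Real.pi_ne_zero]
        have : (t : ℂ) * (2 * Real.pi * Complex.I) = n * (2 * Real.pi * Complex.I) := by
          rw [← hn]; push_cast; ring
        exact mul_right_cancel₀ hp this
      have ht' : t = n := by exact_mod_cast this
      have h1 := ht.1
      have h2 := ht.2
      rw [ht'] at h1 h2
      have : (0 : ℤ) < n := by exact_mod_cast h1
      have : n < 1 := by exact_mod_cast h2
      omega
  simp at h0

theorem lintegral_even {F : ℝ → ℝ≥0∞} (h : ∀ t, F (-t) = F t) :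
    ∫⁻ t, F t ≤ 2 * ∫⁻ t in Ioi 0, F t := by
  have h1 : ∫⁻ t in Iio 0, F t = ∫⁻ t in Ioi 0, F t := by
    rw [← lintegral_indicator measurableSet_Iio, ← lintegral_indicator measurableSet_Ioi,
      ← lintegral_neg_eq_self]
    refine lintegral_congr fun t => ?_
    by_cases ht : 0 < t
    · rw [indicator_of_mem (by simpa using ht), indicator_of_mem (by simpa using ht), h]
    · rw [indicator_of_notMem (by simpa using ht), indicator_of_notMem (by simpa using ht)]
  have h2 : ∫⁻ t, F t = ∫⁻ t in Iio 0 ∪ Ioi 0, F t := by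
    rw [← setLIntegral_univ]
    refine setLIntegral_congr ?_
    rw [Iio_union_Ioi]
    exact (ae_eq_univ.mpr (by simp)).symm
  rw [h2, two_mul]
  exact (lintegral_union_le _ _ _).trans_eq (by rw [h1])

/-- Near zero `|exp (2πit) - 1| ≤ 2πt` leaves `t^(1 - 2σ)`, integrable because `σ < 1`; far out the
bound `2` leaves `t^(-1 - 2σ)`, integrable because `0 < σ`. -/
theorem gagConst_lt_top {σ : ℝ} (h0 : 0 < σ) (h1 : σ < 1) : gagConst σ < ⊤ := by
  have heven : ∀ t, gagWt σ (-t) * ‖transSymbol (-t) 1 - 1‖ₑ ^ 2 =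
      gagWt σ t * ‖transSymbol t 1 - 1‖ₑ ^ 2 := by
    intro t
    have e1 : transSymbol (-t) 1 - 1 = transSymbol (-t) 1 * (1 - transSymbol t 1) := by
      rw [mul_sub, mul_one]
      congr 1
      rw [transSymbol, transSymbol, ← Complex.exp_add]
      simp
    have e2 : ‖transSymbol (-t) 1 - 1‖ₑ = ‖transSymbol t 1 - 1‖ₑ := by
      rw [e1, enorm_mul, ← ofReal_norm (transSymbol (-t) 1), norm_transSymbol, ENNReal.ofReal_one,
        one_mul, ← enorm_neg, neg_sub]
    rw [e2, gagWt, gagWt, abs_neg]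
  refine (lintegral_even heven).trans_lt (ENNReal.mul_lt_top (by norm_num) ?_)
  have hsplit : Ioi (0 : ℝ) = Ioc 0 1 ∪ Ioi 1 := (Ioc_union_Ioi_eq_Ioi zero_le_one).symm
  rw [hsplit]
  refine (lintegral_union_le _ _ _).trans_lt (ENNReal.add_lt_top.mpr ⟨?_, ?_⟩)
  · have hint : IntegrableOn (fun t : ℝ => (2 * Real.pi) ^ 2 * t ^ (1 - 2 * σ)) (Ioc 0 1) := by
      have := intervalIntegral.intervalIntegrable_rpow' (a := 0) (b := 1) (r := 1 - 2 * σ)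
        (by linarith)
      rw [intervalIntegrable_iff_integrableOn_Ioc_of_le zero_le_one] at this
      exact this.const_mul _
    refine lt_of_le_of_lt (setLIntegral_mono' measurableSet_Ioc fun t ht => ?_)
      hint.lintegral_lt_top
    rw [gagWt, ← ofReal_norm, ← ENNReal.ofReal_pow (by positivity),
      ← ENNReal.ofReal_mul (by positivity), abs_of_pos ht.1]
    refine ENNReal.ofReal_le_ofReal ?_
    have hb : ‖transSymbol t 1 - 1‖ ≤ 2 * Real.pi * t := by
      have := Real.norm_exp_I_mul_ofReal_sub_one_le (x := 2 * Real.pi * t)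
      rw [Real.norm_of_nonneg (by have := ht.1; positivity)] at this
      refine le_trans (le_of_eq ?_) this
      rw [transSymbol]
      congr 3
      push_cast
      ring
    have ht0 := ht.1
    calc t ^ (-1 - 2 * σ) * ‖transSymbol t 1 - 1‖ ^ 2
        ≤ t ^ (-1 - 2 * σ) * (2 * Real.pi * t) ^ 2 := by gcongr
      _ = (2 * Real.pi) ^ 2 * (t ^ (-1 - 2 * σ) * t ^ (2 : ℝ)) := by
          rw [Real.rpow_two]; ring
      _ = _ := by rw [← Real.rpow_add ht0]; congr 2; ring
  · have hint : IntegrableOn (fun t : ℝ => 4 * t ^ (-1 - 2 * σ)) (Ioi 1) :=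
      (integrableOn_Ioi_rpow_of_lt (by linarith) zero_lt_one).const_mul _
    refine lt_of_le_of_lt (setLIntegral_mono' measurableSet_Ioi fun t ht => ?_)
      hint.lintegral_lt_top
    have ht0 : 0 < t := zero_lt_one.trans ht
    rw [gagWt, ← ofReal_norm, ← ENNReal.ofReal_pow (by positivity),
      ← ENNReal.ofReal_mul (by positivity), abs_of_pos ht0]
    refine ENNReal.ofReal_le_ofReal ?_
    have hb : ‖transSymbol t 1 - 1‖ ≤ 2 := by
      refine (norm_sub_le _ _).trans ?_
      rw [norm_transSymbol, norm_one]
      norm_num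
    calc t ^ (-1 - 2 * σ) * ‖transSymbol t 1 - 1‖ ^ 2 ≤ t ^ (-1 - 2 * σ) * 2 ^ 2 := by gcongr
      _ = _ := by ring

/-- Plancherel in `x` for each fixed translation `y`, then Tonelli and the scaling of the
`y`-integral. -/
theorem gag_eq_fourier (σ : ℝ) {f : ℝ → ℂ} (hf : MemLp f 2 (volume : Measure ℝ))
    (hfm : Measurable f) :
    gag σ f = gagConst σ *
      ∫⁻ ξ, ENNReal.ofReal (|ξ| ^ (2 * σ)) * ‖(𝓕 (hf.toLp f) : L2) ξ‖ₑ ^ 2 := by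
  set u : L2 := 𝓕 (hf.toLp f) with hu
  have hum : Measurable (u : ℝ → ℂ) := (Lp.stronglyMeasurable u).measurable
  have hts : Measurable fun p : ℝ × ℝ => ‖transSymbol p.1 p.2 - 1‖ₑ ^ 2 := by
    unfold transSymbol; fun_prop
  have hw := measurable_gagWt σ
  rw [gag_eq_translate σ hfm]
  have h1 : ∀ y, gagWt σ y * ∫⁻ x, ‖f (x + y) - f x‖ₑ ^ 2 =
      ∫⁻ ξ, gagWt σ y * (‖transSymbol y ξ - 1‖ₑ ^ 2 * ‖u ξ‖ₑ ^ 2) := by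
    intro y
    rw [sob_zero_translate_sub hf, lintegral_const_mul']
    exact ENNReal.ofReal_ne_top
  simp only [h1]
  rw [lintegral_lintegral_swap]
  · have hm : Measurable fun ξ : ℝ => ENNReal.ofReal (|ξ| ^ (2 * σ)) * ‖u ξ‖ₑ ^ 2 := by fun_prop
    rw [← lintegral_const_mul _ hm]
    have h0 : ∀ᵐ ξ : ℝ, ξ ≠ 0 := by simp [ae_iff]
    refine lintegral_congr_ae ?_
    filter_upwards [h0] with ξ hξ
    simp only [← mul_assoc]
    have hmm : Measurable fun y => gagWt σ y * ‖transSymbol y ξ - 1‖ₑ ^ 2 :=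
      hw.mul (measurable_transSymbol_sub ξ)
    rw [lintegral_mul_const _ hmm, gagConst_scale σ hξ]
    ring
  · refine Measurable.aemeasurable ?_
    exact (hw.comp measurable_fst).mul (hts.mul (by fun_prop))

/-- The Gagliardo seminorm sees only differences of values. It therefore passes through Lipschitz
functions of the values and bi-Lipschitz changes of variable; this comparison and the converse one
below carry such bounds over to `sob`. -/
theorem gag_le_sob {σ : ℝ} (h0 : 0 < σ) {f : ℝ → ℂ} (hf : MemLp f 2 (volume : Measure ℝ))
    (hfm : Measurable f) : gag σ f ≤ gagConst σ * sob σ f := by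
  rw [gag_eq_fourier σ hf hfm, sob_of_memLp σ hf]
  gcongr with ξ
  rw [wt]
  refine ENNReal.ofReal_le_ofReal ?_
  calc |ξ| ^ (2 * σ) = (ξ ^ 2) ^ σ := by
        rw [← sq_abs, ← Real.rpow_natCast, ← Real.rpow_mul (abs_nonneg _)]
        norm_num
    _ ≤ _ := Real.rpow_le_rpow (by positivity) (by linarith) h0.le

/-- Subadditivity of `t ↦ t^σ` for `σ ≤ 1` gives `(1 + ξ²)^σ ≤ 1 + |ξ|^(2σ)`. -/
theorem sob_le_gag {σ : ℝ} (h0 : 0 < σ) (h1 : σ < 1) {f : ℝ → ℂ}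
    (hf : MemLp f 2 (volume : Measure ℝ)) (hfm : Measurable f) :
    sob σ f ≤ sob 0 f + (gagConst σ)⁻¹ * gag σ f := by
  have hmm : AEMeasurable (fun ξ => wt 0 ξ * ‖(𝓕 (hf.toLp f) : L2) ξ‖ₑ ^ 2) volume :=
    (measurable_wt 0).aemeasurable.mul ((Lp.aestronglyMeasurable _).enorm.pow_const 2)
  rw [gag_eq_fourier σ hf hfm, ← mul_assoc, ENNReal.inv_mul_cancel (gagConst_ne_zero σ)
    (gagConst_lt_top h0 h1).ne, one_mul, sob_of_memLp σ hf, sob_of_memLp 0 hf,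
    ← lintegral_add_left' hmm]
  refine lintegral_mono fun ξ => ?_
  show _ ≤ wt 0 ξ * _ + ENNReal.ofReal (|ξ| ^ (2 * σ)) * _
  rw [← add_mul]
  gcongr
  rw [wt_zero, wt, ← ENNReal.ofReal_one, ← ENNReal.ofReal_add zero_le_one (by positivity)]
  refine ENNReal.ofReal_le_ofReal ?_
  have e : |ξ| ^ (2 * σ) = (ξ ^ 2) ^ σ := by
    rw [← sq_abs, ← Real.rpow_natCast, ← Real.rpow_mul (abs_nonneg _)]
    norm_num
  rw [e]
  have := NNReal.coe_le_coe.mpr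
    (NNReal.rpow_add_le_add_rpow 1 (Real.toNNReal (ξ ^ 2)) h0.le h1.le)
  simpa [Real.coe_toNNReal _ (sq_nonneg ξ)] using this

/-! ### Division by functions that are bounded below -/

/-- The function `η / (1 + η)`. -/
def quot (η : ℝ → ℂ) : ℝ → ℂ := fun x => η x / (1 + η x)

theorem quot_sub {a b : ℂ} (ha : 1 + a ≠ 0) (hb : 1 + b ≠ 0) :
    a / (1 + a) - b / (1 + b) = (a - b) / ((1 + a) * (1 + b)) := by
  field_simp
  ring

theorem enorm_sq_le_mul {a b : ℂ} {C : ℝ} (h : ‖a‖ ≤ C * ‖b‖) :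
    ‖a‖ₑ ^ 2 ≤ ENNReal.ofReal (C ^ 2) * ‖b‖ₑ ^ 2 := by
  rw [← ofReal_norm, ← ofReal_norm, ← ENNReal.ofReal_pow (by positivity),
    ← ENNReal.ofReal_pow (by positivity), ← ENNReal.ofReal_mul (by positivity), ← mul_pow]
  exact ENNReal.ofReal_le_ofReal (by gcongr)

theorem memLp_of_norm_le {f g : ℝ → ℂ} (hf : AEStronglyMeasurable f volume)
    (hg : MemLp g 2 (volume : Measure ℝ)) {C : ℝ} (h : ∀ x, ‖f x‖ ≤ C * ‖g x‖) :
    MemLp f 2 (volume : Measure ℝ) ∧ sob 0 f ≤ ENNReal.ofReal (C ^ 2) * sob 0 g := by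
  have hm : MemLp f 2 (volume : Measure ℝ) :=
    hg.of_le_mul hf (Eventually.of_forall h)
  refine ⟨hm, ?_⟩
  rw [sob_zero_eq hm, sob_zero_eq hg, ← lintegral_const_mul' _ _ (by simp)]
  exact lintegral_mono fun x => enorm_sq_le_mul (h x)

section quotient

variable {η : ℝ → ℂ} {c : ℝ}

theorem norm_quot_le (hc : 0 < c) (hη : ∀ x, c ≤ ‖1 + η x‖) (x : ℝ) :
    ‖quot η x‖ ≤ c⁻¹ * ‖η x‖ := by
  rw [quot, norm_div, div_eq_inv_mul]
  gcongr
  exact hη x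

/-- The map `z ↦ z / (1 + z)` is Lipschitz with constant `c⁻²` on `|1 + z| ≥ c`, so the Gagliardo
seminorm grows by a factor only. -/
theorem sob_quot_of_lt_one {σ : ℝ} (h0 : 0 < σ) (h1 : σ < 1) (hm : Measurable η) (hc : 0 < c)
    (hη : ∀ x, c ≤ ‖1 + η x‖) (h : sob σ η < ⊤) : sob σ (quot η) < ⊤ := by
  have hL := memLp_of_sob_lt_top h
  have hqm : Measurable (quot η) := by unfold quot; fun_prop
  have hq := memLp_of_norm_le hqm.aestronglyMeasurable hL (norm_quot_le hc hη)
  refine (sob_le_gag h0 h1 hq.1 hqm).trans_lt (ENNReal.add_lt_top.mpr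
    ⟨sob_zero_lt_top hq.1, ENNReal.mul_lt_top (by simp [gagConst_ne_zero, pos_iff_ne_zero]) ?_⟩)
  have hle : gag σ (quot η) ≤ ENNReal.ofReal (((c * c)⁻¹) ^ 2) * gag σ η := by
    unfold gag
    rw [← lintegral_const_mul' _ _ (by simp)]
    refine lintegral_mono fun x => ?_
    rw [← lintegral_const_mul' _ _ (by simp)]
    refine lintegral_mono fun z => ?_
    rw [mul_left_comm]
    gcongr
    refine enorm_sq_le_mul ?_
    have hx : 1 + η x ≠ 0 := norm_pos_iff.mp (hc.trans_le (hη x))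
    have hz : 1 + η z ≠ 0 := norm_pos_iff.mp (hc.trans_le (hη z))
    rw [quot, quot, quot_sub hz hx, norm_div, norm_mul, div_eq_inv_mul]
    gcongr
    · exact hη z
    · exact hη x
  refine hle.trans_lt (ENNReal.mul_lt_top (by simp) ((gag_le_sob h0 hL hm).trans_lt ?_))
  exact ENNReal.mul_lt_top (gagConst_lt_top h0 h1) h

/-- The factor `(1 + η)⁻²` is written as `(1 - quot η)²`: the derivative is then polynomial in `quot
η` and linear in `η'`, so that regularity already known for `quot η` can be fed back. -/
theorem hasWeakDeriv_quot {η' : ℝ → ℂ} (hη' : HasWeakDeriv η η') (hcont : Continuous η)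
    (hc : 0 < c) (hη : ∀ x, c ≤ ‖1 + η x‖) :
    HasWeakDeriv (quot η) (fun x => η' x * (1 - quot η x) ^ 2) := by
  obtain ⟨φ, h1, h2⟩ := hη'.exists_schwartz
  have hu := tendsto_of_tendsto_sob (by norm_num) (fun n => (φ n).continuous) hcont h1
  have h1' := tendsto_sob_mono zero_le_one h1
  have hne : ∀ x, 1 + η x ≠ 0 := fun x => norm_pos_iff.mp (hc.trans_le (hη x))
  have hq : ∀ x, 1 - quot η x = (1 + η x)⁻¹ := fun x => by
    have := hne x
    rw [quot]
    field_simp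
    ring
  simp only [hq]
  have hqm : Continuous (quot η) := hcont.div (continuous_const.add hcont) hne
  have hinv : Continuous fun x => (1 + η x)⁻¹ := (continuous_const.add hcont).inv₀ hne
  -- Uniform convergence keeps the denominators of the approximations away from zero, with half the
  -- constant.
  have hev : ∀ᶠ n in atTop, ∀ x, c / 2 ≤ ‖1 + φ n x‖ := by
    rw [Metric.tendstoUniformly_iff] at hu
    filter_upwards [hu (c / 2) (by positivity)] with n hn x
    have h3 := hn x
    rw [dist_eq_norm] at h3
    have h4 := norm_sub_norm_le (1 + η x) (1 + φ n x)
    have h5 : 1 + η x - (1 + φ n x) = η x - φ n x := by ring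
    rw [h5] at h4
    have := hη x
    linarith
  have hd1 : ∀ x, ‖η' x * ((1 + η x)⁻¹) ^ 2‖ ≤ (c⁻¹) ^ 2 * ‖η' x‖ := by
    intro x
    rw [norm_mul, norm_pow, norm_inv, mul_comm]
    gcongr
    exact hη x
  have hcm : Continuous fun x => ((1 + η x)⁻¹) ^ 2 := hinv.pow 2
  refine HasWeakDeriv.of_tendsto (l := atTop) (f := fun n => quot (φ n))
    (g := fun n x => schwartzDeriv (φ n) x * ((1 + φ n x)⁻¹) ^ 2) ?_
    (memLp_of_norm_le hqm.aestronglyMeasurable hη'.left (norm_quot_le hc hη)).1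
    (memLp_of_norm_le (hη'.right.1.mul hcm.aestronglyMeasurable) hη'.right hd1).1 ?_ ?_
  · filter_upwards [hev] with n hn
    have hc2 : 0 < c / 2 := by positivity
    have hne' : ∀ x, 1 + φ n x ≠ 0 := fun x => norm_pos_iff.mp (hc2.trans_le (hn x))
    have hinv' : Continuous fun x => (1 + φ n x)⁻¹ :=
      (continuous_const.add (φ n).continuous).inv₀ hne'
    have hqm' : Continuous (quot (φ n)) :=
      (φ n).continuous.div (continuous_const.add (φ n).continuous) hne'
    refine hasWeakDeriv_of_hasDerivAt
      (memLp_of_norm_le hqm'.aestronglyMeasurable (memLp_schwartz (φ n)) (norm_quot_le hc2 hn)).1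
      (memLp_of_norm_le (C := ((c / 2)⁻¹) ^ 2)
        ((schwartzDeriv (φ n)).continuous.mul (hinv'.pow 2)).aestronglyMeasurable
        (memLp_schwartz (schwartzDeriv (φ n))) fun x => ?_).1 fun x => ?_
    · show ‖schwartzDeriv (φ n) x * ((1 + φ n x)⁻¹) ^ 2‖ ≤ _
      rw [norm_mul, norm_pow, norm_inv, mul_comm]
      gcongr
      exact hn x
    · have hx := hne' x
      have := (schwartz_hasDerivAt (φ n) x).div ((schwartz_hasDerivAt (φ n) x).const_add 1) hx
      refine this.congr_deriv ?_
      field_simp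
      ring
  · have hlim := ENNReal.Tendsto.const_mul (a := ENNReal.ofReal (((c / 2 * c)⁻¹) ^ 2)) h1'
      (Or.inr (by simp))
    rw [mul_zero] at hlim
    refine tendsto_of_tendsto_of_tendsto_of_le_of_le' tendsto_const_nhds hlim
      (Eventually.of_forall fun _ => zero_le) ?_
    filter_upwards [hev] with n hn
    have hc2 : 0 < c / 2 := by positivity
    have hne' : ∀ x, 1 + φ n x ≠ 0 := fun x => norm_pos_iff.mp (hc2.trans_le (hn x))
    have hqm' : Continuous (quot (φ n)) :=
      (φ n).continuous.div (continuous_const.add (φ n).continuous) hne'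
    refine (memLp_of_norm_le (hqm'.sub hqm).aestronglyMeasurable
      ((memLp_schwartz (φ n)).sub hη'.left) fun x => ?_).2
    rw [Pi.sub_apply, Pi.sub_apply, quot, quot, quot_sub (hne' x) (hne x), norm_div, norm_mul,
      div_eq_inv_mul]
    gcongr
    · exact hn x
    · exact hη x
  -- The error splits into the error of the derivatives times a bounded factor and `η'` times a
  -- factor tending to zero uniformly.
  · have l1 := ENNReal.Tendsto.const_mul (a := 2 * ENNReal.ofReal ((((c / 2)⁻¹) ^ 2) ^ 2)) h2
      (Or.inr (by finiteness))
    have l2 : Tendsto (fun n => 2 * sob 0 (fun x => η' x *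
        (((1 + φ n x)⁻¹) ^ 2 - ((1 + η x)⁻¹) ^ 2))) atTop (𝓝 (2 * 0)) := by
      refine ENNReal.Tendsto.const_mul ?_ (Or.inr (by norm_num))
      have hunif : ∀ ε > 0, ∀ᶠ n in atTop, sob 0 (fun x => η' x *
          (((1 + φ n x)⁻¹) ^ 2 - ((1 + η x)⁻¹) ^ 2)) ≤ ENNReal.ofReal (ε ^ 2) * sob 0 η' := by
        intro ε hε
        rw [Metric.tendstoUniformly_iff] at hu
        -- Chosen so that the inverse squares differ by at most `δ (c/2)⁻² · 2 (c/2)⁻¹ = ε`.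
        have hδ : 0 < ε * (c / 2) ^ 3 / 2 := by positivity
        filter_upwards [hev, hu _ hδ] with n hn hn'
        have hc2 : 0 < c / 2 := by positivity
        have hne' : ∀ x, 1 + φ n x ≠ 0 := fun x => norm_pos_iff.mp (hc2.trans_le (hn x))
        have hinv' : Continuous fun x => (1 + φ n x)⁻¹ :=
          (continuous_const.add (φ n).continuous).inv₀ hne'
        refine (memLp_of_norm_le (hη'.right.1.mul
          ((hinv'.pow 2).sub hcm).aestronglyMeasurable) hη'.right fun x => ?_).2
        show ‖η' x * (((1 + φ n x)⁻¹) ^ 2 - ((1 + η x)⁻¹) ^ 2)‖ ≤ _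
        rw [norm_mul, mul_comm]
        gcongr
        have ea : ((1 + φ n x)⁻¹) ^ 2 - ((1 + η x)⁻¹) ^ 2 = (η x - φ n x) *
            ((1 + φ n x)⁻¹ * (1 + η x)⁻¹) * ((1 + φ n x)⁻¹ + (1 + η x)⁻¹) := by
          have := hne x
          have := hne' x
          field_simp
          ring
        have b1 : ‖(1 + φ n x)⁻¹‖ ≤ (c / 2)⁻¹ := by
          rw [norm_inv]; gcongr; exact hn x
        have b2 : ‖(1 + η x)⁻¹‖ ≤ (c / 2)⁻¹ := by
          rw [norm_inv]; gcongr; exact (half_le_self hc.le).trans (hη x)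
        have b3 : ‖η x - φ n x‖ ≤ ε * (c / 2) ^ 3 / 2 := by
          rw [← dist_eq_norm]; exact (hn' x).le
        rw [ea, norm_mul, norm_mul, norm_mul]
        calc _ ≤ ε * (c / 2) ^ 3 / 2 * ((c / 2)⁻¹ * (c / 2)⁻¹) * ((c / 2)⁻¹ + (c / 2)⁻¹) := by
              gcongr
              exact (norm_add_le _ _).trans (add_le_add b1 b2)
          _ = ε := by field_simp; norm_num
      rw [ENNReal.tendsto_nhds_zero]
      intro ε hε
      have hfin := sob_zero_lt_top hη'.right
      have hcn : Tendsto (fun δ : ℝ => ENNReal.ofReal (δ ^ 2) * sob 0 η') (𝓝[>] 0) (𝓝 0) := by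
        have h : Continuous fun δ : ℝ => ENNReal.ofReal (δ ^ 2) :=
          ENNReal.continuous_ofReal.comp (continuous_pow 2)
        have h' := ENNReal.Tendsto.mul_const (b := sob 0 η')
          ((h.tendsto 0).mono_left (nhdsWithin_le_nhds (s := Ioi 0))) (Or.inr hfin.ne)
        simpa using h'
      obtain ⟨δ, hδ1, hδ2⟩ := ((hcn.eventually_lt_const hε).and self_mem_nhdsWithin).exists
      filter_upwards [hunif δ hδ2] with n hn
      exact hn.trans hδ1.le
    have hlim := l1.add l2
    simp only [mul_zero, add_zero] at hlim
    refine tendsto_of_tendsto_of_tendsto_of_le_of_le' tendsto_const_nhds hlim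
      (Eventually.of_forall fun _ => zero_le) ?_
    filter_upwards [hev] with n hn
    have hc2 : 0 < c / 2 := by positivity
    have hne' : ∀ x, 1 + φ n x ≠ 0 := fun x => norm_pos_iff.mp (hc2.trans_le (hn x))
    have hinv' : Continuous fun x => (1 + φ n x)⁻¹ :=
      (continuous_const.add (φ n).continuous).inv₀ hne'
    have e : (fun x => schwartzDeriv (φ n) x * ((1 + φ n x)⁻¹) ^ 2) -
        (fun x => η' x * ((1 + η x)⁻¹) ^ 2) =
        (fun x => ((schwartzDeriv (φ n) : ℝ → ℂ) - η') x * ((1 + φ n x)⁻¹) ^ 2) +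
        fun x => η' x * (((1 + φ n x)⁻¹) ^ 2 - ((1 + η x)⁻¹) ^ 2) := by
      ext x
      simp only [Pi.sub_apply, Pi.add_apply]
      ring
    rw [e]
    refine (sob_add_le _ _ _).trans ?_
    rw [mul_assoc]
    gcongr
    have hdm : MemLp ((schwartzDeriv (φ n) : ℝ → ℂ) - η') 2 (volume : Measure ℝ) :=
      (memLp_schwartz _).sub hη'.right
    refine (memLp_of_norm_le (hdm.1.mul (hinv'.pow 2).aestronglyMeasurable) hdm fun x => ?_).2
    show ‖((schwartzDeriv (φ n) : ℝ → ℂ) - η') x * ((1 + φ n x)⁻¹) ^ 2‖ ≤ _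
    rw [norm_mul, norm_pow, norm_inv, mul_comm]
    gcongr
    exact hn x

/-- If `η` is of Sobolev order `s > 1/2` and `1 + η` is bounded below, then `η / (1 + η)` is of
order `s`. -/
theorem sob_quot_lt_top {s : ℝ} (hs : 1 / 2 < s) (hcont : Continuous η) (hc : 0 < c)
    (hη : ∀ x, c ≤ ‖1 + η x‖) (h : sob s η < ⊤) : sob s (quot η) < ⊤ := by
  rcases lt_or_ge s 1 with hs1 | hs1
  · exact sob_quot_of_lt_one (by linarith) hs1 hcont.measurable hc hη h
  obtain ⟨η', hη'⟩ := exists_hasWeakDeriv ((sob_mono hs1 η).trans_lt h)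
  have hd : sob (s - 1) η' < ⊤ := by
    refine (hη'.sob_deriv_le (s - 1)).trans_lt ?_
    rw [sub_add_cancel]
    exact ENNReal.mul_lt_top fourPiSq_ne_top.lt_top h
  have hwd := hasWeakDeriv_quot hη' hcont hc hη
  -- Bootstrap from order `3/4`, which lies above `1/2` for the product estimate and below `1` for
  -- the Gagliardo argument. Each use of the derivative formula gains one order, up to `s`.
  have step : ∀ n : ℕ, sob (min (3 / 4 + n) s) (quot η) < ⊤ := by
    intro n
    induction n with
    | zero =>
      refine (sob_mono (min_le_left _ _) _).trans_lt ?_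
      simp only [Nat.cast_zero, add_zero]
      refine sob_quot_of_lt_one (by norm_num) (by norm_num) hcont.measurable hc hη ?_
      exact (sob_mono (by linarith) η).trans_lt h
    | succ n ih =>
      set τ := min (3 / 4 + (n : ℝ)) s with hτ
      set ρ := min τ (s - 1) with hρ
      have hn : (0 : ℝ) ≤ n := Nat.cast_nonneg n
      have hτ' : 1 / 2 < τ := lt_min (by linarith) hs
      have hρ0 : 0 ≤ ρ := le_min (by linarith) (by linarith)
      have hρτ : ρ ≤ τ := min_le_left _ _
      have hdρ : sob ρ η' < ⊤ := (sob_mono (min_le_right _ _) _).trans_lt hd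
      have p1 := sob_mul_lt_top hτ' hρ0 hρτ ih hdρ
      have p2 := sob_mul_lt_top hτ' hρ0 hρτ ih p1
      have hdq : sob ρ (fun x => η' x * (1 - quot η x) ^ 2) < ⊤ := by
        have e : (fun x => η' x * (1 - quot η x) ^ 2) =
            η' - (2 : ℂ) • (quot η * η') + quot η * (quot η * η') := by
          ext x
          simp only [Pi.add_apply, Pi.sub_apply, Pi.smul_apply, Pi.mul_apply, smul_eq_mul]
          ring
        rw [e]
        exact sob_add_lt_top (sob_sub_lt_top hdρ (sob_smul_lt_top 2 p1)) p2
      refine (sob_mono ?_ _).trans_lt (hwd.sob_lt_top ((sob_mono hρτ _).trans_lt ih) hdq)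
      rw [hρ, hτ, ← min_add_add_right, sub_add_cancel, ← min_add_add_right]
      refine le_min (le_min ?_ ?_) (min_le_right _ _)
      · refine (min_le_left _ _).trans (le_of_eq ?_)
        push_cast
        ring
      · exact (min_le_right _ _).trans (by linarith)
  obtain ⟨n, hn⟩ := exists_nat_ge s
  refine (sob_mono ?_ _).trans_lt (step n)
  exact le_min (by linarith) le_rfl

end quotient

/-! ### Reality of distributions -/

/-- The real part of a Schwartz function. -/
def schwartzRe : 𝓢(ℝ, ℂ) →L[ℝ] 𝓢(ℝ, ℂ) :=
  SchwartzMap.postcompCLM (Complex.ofRealCLM.comp Complex.reCLM)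

/-- The imaginary part of a Schwartz function. -/
def schwartzIm : 𝓢(ℝ, ℂ) →L[ℝ] 𝓢(ℝ, ℂ) :=
  SchwartzMap.postcompCLM (Complex.ofRealCLM.comp Complex.imCLM)

@[simp] theorem schwartzRe_apply (φ : 𝓢(ℝ, ℂ)) (x : ℝ) : schwartzRe φ x = ((φ x).re : ℂ) := rfl

@[simp] theorem schwartzIm_apply (φ : 𝓢(ℝ, ℂ)) (x : ℝ) : schwartzIm φ x = ((φ x).im : ℂ) := rfl

theorem schwartz_re_add_im (φ : 𝓢(ℝ, ℂ)) : schwartzRe φ + Complex.I • schwartzIm φ = φ := by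
  ext x
  simp only [_root_.add_apply, _root_.smul_apply, schwartzRe_apply, schwartzIm_apply,
    smul_eq_mul]
  rw [mul_comm, Complex.re_add_im]

theorem dist_ext_real {F G : 𝓢'(ℝ, ℂ)}
    (h : ∀ φ : 𝓢(ℝ, ℂ), (∀ x, (φ x).im = 0) → F φ = G φ) : F = G := by
  ext φ
  rw [← schwartz_re_add_im φ, map_add, map_add, map_smul, map_smul,
    h (schwartzRe φ) (by simp), h (schwartzIm φ) (by simp)]

theorem integrable_schwartz_mul {g : ℝ → ℂ} (hg : MemLp g 2 (volume : Measure ℝ)) (φ : 𝓢(ℝ, ℂ)) :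
    Integrable (fun x => φ x * g x) (volume : Measure ℝ) :=
  (memLp_schwartz φ).integrable_mul hg

theorem memLp_cplx {f : ℝ → ℝ} (hf : MemLp f 2 (volume : Measure ℝ)) :
    MemLp (fun x => (f x : ℂ)) 2 (volume : Measure ℝ) := hf.ofReal

theorem memLp_of_cplx {f : ℝ → ℝ} (hf : MemLp (fun x => (f x : ℂ)) 2 (volume : Measure ℝ)) :
    MemLp f 2 (volume : Measure ℝ) := by simpa using hf.re

theorem ofReal_apply_real {f : ℝ → ℝ} (hf : MemLp f 2 (volume : Measure ℝ)) {φ : 𝓢(ℝ, ℂ)}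
    (hφ : ∀ x, (φ x).im = 0) : ofReal f φ = ((∫ x, (φ x).re * f x : ℝ) : ℂ) := by
  rw [ofReal, ofL2_apply (memLp_cplx hf), ← integral_complex_ofReal]
  refine integral_congr_ae (Eventually.of_forall fun x => ?_)
  have : φ x = ((φ x).re : ℂ) := by
    apply Complex.ext <;> simp [hφ x]
  show φ x * (f x : ℂ) = (((φ x).re * f x : ℝ) : ℂ)
  rw [this]
  simp

theorem isRealDist_ofReal (f : ℝ → ℝ) : IsRealDist (ofReal f) := by
  intro φ hφ
  by_cases hf : MemLp f 2 (volume : Measure ℝ)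
  · rw [ofReal_apply_real hf hφ, Complex.ofReal_im]
  · have : ¬ MemLp (fun x => (f x : ℂ)) 2 (volume : Measure ℝ) := fun h => hf (memLp_of_cplx h)
    rw [ofReal, ofL2, dif_neg this]
    simp

theorem IsRealDist.ofL2_eq {g : ℝ → ℂ} (hg : MemLp g 2 (volume : Measure ℝ))
    (h : IsRealDist (ofL2 g)) : ofReal (fun x => (g x).re) = ofL2 g := by
  refine dist_ext_real fun φ hφ => ?_
  have hre : MemLp (fun x => (g x).re) 2 (volume : Measure ℝ) := hg.re
  rw [ofReal_apply_real hre hφ]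
  apply Complex.ext
  · rw [Complex.ofReal_re, ofL2_apply hg]
    have h1 := (Complex.reCLM.integral_comp_comm (integrable_schwartz_mul hg φ))
    simp only [Complex.reCLM_apply] at h1
    rw [← h1]
    refine integral_congr_ae (Eventually.of_forall fun x => ?_)
    simp [Complex.mul_re, hφ x]
  · rw [Complex.ofReal_im, h φ hφ]

theorem isRealDist_dx {F : 𝓢'(ℝ, ℂ)} (h : IsRealDist F) : IsRealDist (dx F) := by
  intro φ hφ
  have e : dx F φ = -F (schwartzDeriv φ) := by
    rw [derivCLM_apply_apply]
    exact map_neg F (schwartzDeriv φ)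
  rw [e, Complex.neg_im, h, neg_zero]
  intro x
  have h1 := schwartz_hasDerivAt φ x
  have h2 := (Complex.imCLM.hasFDerivAt.comp_hasDerivAt x h1)
  have h3 : (Complex.imCLM ∘ φ) = fun _ => (0 : ℝ) := by
    ext y; simp [hφ y]
  rw [h3] at h2
  simpa using h2.unique (hasDerivAt_const x (0 : ℝ))

/-! ### The Banach spaces `H^σ`, continuous representatives and the algebra `H^s`. -/

namespace Hs

variable {σ τ s : ℝ}

theorem isRealDist (F : Hs σ) : IsRealDist F.toDist := F.2.2

/-- The element of `H^σ` with a given underlying distribution. -/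
def ofDist (F : 𝓢'(ℝ, ℂ)) (h : MemSobolev σ 2 F) (hr : IsRealDist F) : Hs σ := ⟨F, h, hr⟩

@[simp] theorem toDist_ofDist (F : 𝓢'(ℝ, ℂ)) (h : MemSobolev σ 2 F) (hr : IsRealDist F) :
    (ofDist F h hr).toDist = F := rfl

theorem incl_eq (h : τ ≤ σ) (F : Hs σ) :
    incl h F = ofDist F.toDist (F.memSobolev.mono h) F.isRealDist := rfl

@[simp] theorem toDist_incl (h : τ ≤ σ) (F : Hs σ) : (incl h F).toDist = F.toDist := by
  rw [incl_eq, toDist_ofDist]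

/-- `F ↦ J^σ F` as an isometry. -/
def toL2Isometry (σ : ℝ) : Hs σ →ₗᵢ[ℝ] L2 := ⟨toL2 σ, fun _ => rfl⟩

theorem toDist_eq (F : Hs σ) : F.toDist =
    besselPotential ℝ ℂ (-σ) (Lp.toTemperedDistributionCLM ℂ volume 2 (toL2Isometry σ F)) := by
  have h : besselPotential ℝ ℂ σ F.toDist =
    Lp.toTemperedDistributionCLM ℂ volume 2 (toL2Isometry σ F) := besselL2_spec F.memSobolev
  rw [← h]
  simp

theorem continuous_toDist : Continuous (toDist : Hs σ → 𝓢'(ℝ, ℂ)) := by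
  have h : (toDist : Hs σ → 𝓢'(ℝ, ℂ)) = fun F =>
    besselPotential ℝ ℂ (-σ) (Lp.toTemperedDistributionCLM ℂ volume 2 (toL2Isometry σ F)) :=
    funext toDist_eq
  rw [h]
  exact (besselPotential ℝ ℂ (-σ)).continuous.comp
    ((Lp.toTemperedDistributionCLM ℂ volume 2).continuous.comp (toL2Isometry σ).continuous)

theorem continuous_apply (φ : 𝓢(ℝ, ℂ)) : Continuous fun F : 𝓢'(ℝ, ℂ) => F φ :=
  (PointwiseConvergenceCLM.evalCLM (RingHom.id ℂ) ℂ φ).continuous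

/-- `J^σ` maps `H^σ` isometrically onto those `g ∈ L²` for which `J^(-σ) g` is real, a closed
condition. -/
instance completeSpace (σ : ℝ) : CompleteSpace (Hs σ) := by
  refine (toL2Isometry σ).isometry.isUniformInducing.completeSpace (IsClosed.isComplete ?_)
  have h : range (toL2Isometry σ) = ⋂ φ : {φ : 𝓢(ℝ, ℂ) // ∀ x, (φ x).im = 0},
      {g : L2 | (besselPotential ℝ ℂ (-σ) (Lp.toTemperedDistributionCLM ℂ volume 2 g) φ.1).im
        = 0} := by
    ext g
    simp only [mem_range, mem_iInter, mem_ofPred_eq, Subtype.forall]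
    constructor
    · rintro ⟨F, rfl⟩ φ hφ
      rw [← toDist_eq]
      exact F.isRealDist φ hφ
    · intro h
      have hb : besselPotential ℝ ℂ σ
          (besselPotential ℝ ℂ (-σ) (Lp.toTemperedDistributionCLM ℂ volume 2 g)) =
          Lp.toTemperedDistribution g := by
        rw [besselPotential_besselPotential_apply]
        simp
      exact ⟨ofDist _ ⟨g, hb⟩ h, besselL2_eq hb⟩
  rw [h]
  refine isClosed_iInter fun φ => isClosed_eq ?_ continuous_const
  exact Complex.continuous_im.comp ((continuous_apply φ.1).comp
    ((besselPotential ℝ ℂ (-σ)).continuous.comp (Lp.toTemperedDistributionCLM ℂ volume 2).continuous))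

/-- A linear map between Sobolev spaces that is compatible with a continuous linear map between
spaces of distributions is continuous. -/
theorem continuous_of_toDist (L : 𝓢'(ℝ, ℂ) → 𝓢'(ℝ, ℂ)) (hL : Continuous L)
    (f : Hs σ →ₗ[ℝ] Hs τ) (h : ∀ F, (f F).toDist = L F.toDist) : Continuous f := by
  -- Closed graph theorem: both limits are also limits of distributions, where they are unique.
  refine f.continuous_of_seq_closed_graph fun u F G hu hfu => ?_
  apply toDist_injective
  have h1 := ((continuous_toDist (σ := τ)).tendsto G).comp hfu
  have h2 := (hL.tendsto _).comp (((continuous_toDist (σ := σ)).tendsto F).comp hu)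
  rw [h]
  refine tendsto_nhds_unique h1 (h2.congr fun n => ?_)
  simp [h]

/-- The inclusion as a continuous linear map. -/
def inclL (h : τ ≤ σ) : Hs σ →L[ℝ] Hs τ :=
  ⟨incl h, continuous_of_toDist id continuous_id _ fun F => toDist_incl h F⟩

theorem inclL_eq (h : τ ≤ σ) (F : Hs σ) : inclL h F = incl h F := rfl

@[simp] theorem toDist_inclL (h : τ ≤ σ) (F : Hs σ) : (inclL h F).toDist = F.toDist := by
  rw [inclL_eq, toDist_incl]

theorem memSobolev_dx {F : 𝓢'(ℝ, ℂ)} (h : MemSobolev σ 2 F) : MemSobolev (σ - 1) 2 (dx F) := by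
  rw [dx_eq_lineDeriv]
  exact h.lineDerivOp

/-- The derivative as a continuous linear map. -/
def dL (h : τ ≤ σ - 1) : Hs σ →L[ℝ] Hs τ :=
  ⟨{ toFun := fun F => ofDist (dx F.toDist) ((memSobolev_dx F.memSobolev).mono h)
      (isRealDist_dx F.isRealDist)
     map_add' := fun F G => toDist_injective (by simp)
     map_smul' := fun c F => toDist_injective (by
      simp) },
    continuous_of_toDist dx dx.continuous _ fun _ => rfl⟩

@[simp] theorem toDist_dL (h : τ ≤ σ - 1) (F : Hs σ) : (dL h F).toDist = dx F.toDist := rfl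

/-- The element of `H^σ` given by a real function. -/
def ofFun (f : ℝ → ℝ) (h : sob σ (fun x => (f x : ℂ)) < ⊤) : Hs σ :=
  ofDist (ofReal f) (memSobolev_and_enorm_besselL2 h).1 (isRealDist_ofReal f)

theorem enorm_sq_eq_sob {F : Hs σ} {f : ℝ → ℂ} (hf : MemLp f 2 (volume : Measure ℝ))
    (h : ofL2 f = F.toDist) : ‖F‖ₑ ^ 2 = sob σ f := by
  have hs : sob σ f < ⊤ := sob_lt_top_of_memSobolev hf (h ▸ F.memSobolev)
  rw [← (memSobolev_and_enorm_besselL2 hs).2, h]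
  rfl

theorem sob_lt_top {F : Hs σ} {f : ℝ → ℂ} (hf : MemLp f 2 (volume : Measure ℝ))
    (h : ofL2 f = F.toDist) : sob σ f < ⊤ :=
  sob_lt_top_of_memSobolev hf (h ▸ F.memSobolev)

/-- The continuous representative. -/
def rep (F : Hs s) : ℝ → ℝ := fn F.toDist

/-- The continuous representative as a complex-valued function. -/
abbrev crep (F : Hs s) : ℝ → ℂ := fun x => (rep F x : ℂ)

instance [h : Fact (1 / 2 < s)] : Fact (1 / 2 < s + 1) := ⟨by linarith [h.out]⟩

instance : Fact ((1 : ℝ) / 2 < 1) := ⟨by norm_num⟩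

section

variable [hs : Fact (1 / 2 < s)]

theorem exists_rep (F : Hs s) : ∃ f : ℝ → ℝ, (Continuous f ∧ MemLp f 2 (volume : Measure ℝ) ∧
    ofReal f = F.toDist) ∧ Tendsto f (cocompact ℝ) (𝓝 0) := by
  obtain ⟨g, hg, hgF⟩ := exists_ofL2_of_memSobolev (by linarith [hs.out]) F.memSobolev
  obtain ⟨g', hgg', -⟩ := exists_continuous_rep hs.out (sob_lt_top hg hgF)
  have hg' : MemLp (g' : ℝ → ℂ) 2 (volume : Measure ℝ) := hg.ae_eq hgg'
  have hF : ofL2 g' = F.toDist := by rw [← hgF, ofL2_congr hgg']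
  refine ⟨fun x => (g' x).re, ⟨Complex.continuous_re.comp g'.continuous, hg'.re, ?_⟩, ?_⟩
  · rw [← hF]
    exact IsRealDist.ofL2_eq hg' (hF ▸ F.isRealDist)
  · have : Tendsto (Complex.re ∘ g') (cocompact ℝ) (𝓝 (Complex.re 0)) :=
      (Complex.continuous_re.tendsto 0).comp g'.zero_at_infty'
    exact this

theorem fn_spec (F : Hs s) : Continuous (rep F) ∧ MemLp (rep F) 2 (volume : Measure ℝ) ∧
    ofReal (rep F) = F.toDist := by
  have h : ∃ f : ℝ → ℝ, Continuous f ∧ MemLp f 2 (volume : Measure ℝ) ∧ ofReal f = F.toDist :=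
    let ⟨f, h, _⟩ := exists_rep F
    ⟨f, h⟩
  rw [rep, fn, dif_pos h]
  exact h.choose_spec

theorem continuous_rep (F : Hs s) : Continuous (rep F) := (fn_spec F).1

theorem memLp_rep (F : Hs s) : MemLp (rep F) 2 (volume : Measure ℝ) := (fn_spec F).2.1

theorem memLp_crep (F : Hs s) : MemLp (crep F) 2 (volume : Measure ℝ) := memLp_cplx (memLp_rep F)

theorem continuous_crep (F : Hs s) : Continuous (crep F) :=
  Complex.continuous_ofReal.comp (continuous_rep F)

theorem ofReal_rep (F : Hs s) : ofReal (rep F) = F.toDist := (fn_spec F).2.2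

theorem ofL2_crep (F : Hs s) : ofL2 (crep F) = F.toDist := (fn_spec F).2.2

end

theorem eq_of_ofReal_eq {f g : ℝ → ℝ} (hf : Continuous f) (hg : Continuous g)
    (hf2 : MemLp f 2 (volume : Measure ℝ)) (hg2 : MemLp g 2 (volume : Measure ℝ))
    (h : ofReal f = ofReal g) : f = g := by
  have h1 := ofL2_inj (memLp_cplx hf2) (memLp_cplx hg2) h
  have h2 := ae_eq_imp_eq (Complex.continuous_ofReal.comp hf) (Complex.continuous_ofReal.comp hg) h1
  ext x
  exact Complex.ofReal_injective (congrFun h2 x)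

theorem fn_ofReal {f : ℝ → ℝ} (hf : Continuous f) (hf2 : MemLp f 2 (volume : Measure ℝ)) :
    fn (ofReal f) = f := by
  have h : ∃ g : ℝ → ℝ, Continuous g ∧ MemLp g 2 (volume : Measure ℝ) ∧ ofReal g = ofReal f :=
    ⟨f, hf, hf2, rfl⟩
  rw [fn, dif_pos h]
  exact eq_of_ofReal_eq h.choose_spec.1 hf h.choose_spec.2.1 hf2 h.choose_spec.2.2

theorem rep_eq {F : Hs s} {f : ℝ → ℝ} (hf : Continuous f) (hf2 : MemLp f 2 (volume : Measure ℝ))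
    (h : ofReal f = F.toDist) : rep F = f := by
  rw [rep, ← h, fn_ofReal hf hf2]

theorem rep_ofFun {f : ℝ → ℝ} (hf : Continuous f) (h : sob s (fun x => (f x : ℂ)) < ⊤) :
    rep (ofFun f h) = f :=
  rep_eq hf (memLp_of_cplx (memLp_of_sob_lt_top h)) rfl

section

variable [hs : Fact (1 / 2 < s)]

theorem tendsto_rep (F : Hs s) : Tendsto (rep F) (cocompact ℝ) (𝓝 0) := by
  obtain ⟨f, ⟨h1, h2, h3⟩, h4⟩ := exists_rep F
  rwa [rep_eq h1 h2 h3]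

/-- Identities in `H^s` reduce through this to pointwise algebra. -/
theorem rep_injective : Function.Injective (rep : Hs s → ℝ → ℝ) := by
  intro F G h
  apply toDist_injective
  rw [← ofReal_rep, ← ofReal_rep G, h]

theorem sob_crep (F : Hs s) : sob s (crep F) = ‖F‖ₑ ^ 2 :=
  (enorm_sq_eq_sob (memLp_crep F) (ofL2_crep F)).symm

theorem sob_crep_lt_top (F : Hs s) : sob s (crep F) < ⊤ := sob_lt_top (memLp_crep F) (ofL2_crep F)

theorem ofReal_add {f g : ℝ → ℝ} (hf : MemLp f 2 (volume : Measure ℝ))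
    (hg : MemLp g 2 (volume : Measure ℝ)) : ofReal (fun x => f x + g x) = ofReal f + ofReal g := by
  rw [ofReal, ofReal, ofReal, ← ofL2_add (memLp_cplx hf) (memLp_cplx hg)]
  congr 1
  ext x
  simp

theorem ofReal_smul {f : ℝ → ℝ} (c : ℝ) (hf : MemLp f 2 (volume : Measure ℝ)) :
    ofReal (fun x => c * f x) = c • ofReal f := by
  have : c • ofReal f = (c : ℂ) • ofReal f := by
    ext φ; simp
  rw [this, ofReal, ofReal, ← ofL2_smul (c : ℂ) (memLp_cplx hf)]
  congr 1
  ext x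
  simp

theorem rep_add (F G : Hs s) (x : ℝ) : rep (F + G) x = rep F x + rep G x := by
  have := rep_eq (F := F + G) ((continuous_rep F).add (continuous_rep G))
    ((memLp_rep F).add (memLp_rep G)) (by
      rw [map_add, ← ofReal_rep, ← ofReal_rep G, ← ofReal_add (memLp_rep F) (memLp_rep G)]
      rfl)
  rw [this]
  rfl

theorem rep_smul (c : ℝ) (F : Hs s) (x : ℝ) : rep (c • F) x = c * rep F x := by
  have := rep_eq (F := c • F) ((continuous_rep F).const_smul c)
    ((memLp_rep F).const_smul c) (by
      rw [map_smul, ← ofReal_rep, ← ofReal_smul c (memLp_rep F)]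
      rfl)
  rw [this]
  rfl

theorem rep_neg (F : Hs s) (x : ℝ) : rep (-F) x = -rep F x := by
  rw [← neg_one_smul ℝ, rep_smul, neg_one_mul]

theorem rep_sub (F G : Hs s) (x : ℝ) : rep (F - G) x = rep F x - rep G x := by
  rw [sub_eq_add_neg, rep_add, rep_neg, sub_eq_add_neg]

theorem rep_zero (x : ℝ) : rep (0 : Hs s) x = 0 := by
  rw [← zero_smul ℝ (0 : Hs s), rep_smul, zero_mul]

theorem crep_sub (F G : Hs s) : crep (F - G) = crep F - crep G := by
  ext x
  simp only [crep, Pi.sub_apply]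
  rw [rep_sub]
  simp

/-- The constant of the embedding into bounded continuous functions. -/
def supConst (s : ℝ) : ℝ := Real.sqrt (2 * wtInt s).toReal

theorem abs_rep_le (F : Hs s) (x : ℝ) : |rep F x| ≤ supConst s * ‖F‖ := by
  have h := enorm_sq_le hs.out (sob_crep_lt_top F) (continuous_crep F) x
  rw [sob_crep] at h
  have hw : 2 * wtInt s ≠ ⊤ := ENNReal.mul_ne_top (by norm_num) (wtInt_lt_top hs.out).ne
  have h2 : ‖crep F x‖ ≤ supConst s * ‖F‖ := by
    refine (pow_le_pow_iff_left₀ (norm_nonneg _) (by unfold supConst; positivity) two_ne_zero).1 ?_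
    rw [mul_pow, supConst, Real.sq_sqrt ENNReal.toReal_nonneg]
    have := ENNReal.toReal_mono (ENNReal.mul_ne_top hw (by simp)) h
    simpa using this
  simpa using h2

/-- The product in `H^s` for `s > 1/2`. -/
def mul : Hs s →L[ℝ] Hs s →L[ℝ] Hs s :=
  have hmul : ∀ F G : Hs s, sob s (fun x => ((rep F x * rep G x : ℝ) : ℂ)) ≤
      4 * prodConst s s * (sob s (crep F) * sob s (crep G)) := fun F G => by
    have := sob_mul_le hs.out (by linarith [hs.out]) le_rfl (sob_crep_lt_top F) (sob_crep_lt_top G)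
    refine le_trans (le_of_eq ?_) this
    congr 1
    ext x
    simp
  have hlt : ∀ F G : Hs s, sob s (fun x => ((rep F x * rep G x : ℝ) : ℂ)) < ⊤ := fun F G =>
    (hmul F G).trans_lt (ENNReal.mul_lt_top (ENNReal.mul_lt_top (by norm_num)
      (prodConst_lt_top hs.out s)) (ENNReal.mul_lt_top (sob_crep_lt_top F) (sob_crep_lt_top G)))
  have hrep : ∀ F G : Hs s, ∀ x, rep (ofFun _ (hlt F G)) x = rep F x * rep G x := fun F G x =>
    congrFun (rep_ofFun (f := fun x => rep F x * rep G x)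
      ((continuous_rep F).mul (continuous_rep G)) _) x
  LinearMap.mkContinuous₂ (LinearMap.mk₂ ℝ (fun F G : Hs s => ofFun _ (hlt F G))
    (fun F F' G => rep_injective (by ext x; rw [hrep, rep_add, rep_add, hrep, hrep]; ring))
    (fun c F G => rep_injective (by ext x; rw [hrep, rep_smul, rep_smul, hrep]; ring))
    (fun F G G' => rep_injective (by ext x; rw [hrep, rep_add, rep_add, hrep, hrep]; ring))
    (fun c F G => rep_injective (by ext x; rw [hrep, rep_smul, rep_smul, hrep]; ring)))
    (Real.sqrt (4 * prodConst s s).toReal) (fun F G => by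
      rw [LinearMap.mk₂_apply]
      refine (pow_le_pow_iff_left₀ (norm_nonneg _) (by positivity) two_ne_zero).1 ?_
      rw [mul_assoc, mul_pow, mul_pow, Real.sq_sqrt ENNReal.toReal_nonneg]
      have h := hmul F G
      rw [sob_crep, sob_crep, ← enorm_sq_eq_sob (memLp_of_sob_lt_top (hlt F G))
        (F := ofFun _ (hlt F G)) rfl] at h
      have := ENNReal.toReal_mono (ENNReal.mul_ne_top (ENNReal.mul_ne_top (by norm_num)
        (prodConst_lt_top hs.out s).ne) (ENNReal.mul_ne_top (by simp) (by simp))) h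
      simpa using this)

theorem rep_mul (F G : Hs s) (x : ℝ) : rep (mul F G) x = rep F x * rep G x := by
  have h := rep_ofFun (s := s) (f := fun x => rep F x * rep G x)
    ((continuous_rep F).mul (continuous_rep G)) (by
      have := sob_mul_lt_top hs.out (by linarith [hs.out]) le_rfl (sob_crep_lt_top F)
        (sob_crep_lt_top G)
      refine lt_of_le_of_lt (le_of_eq ?_) this
      congr 1
      ext x
      simp)
  exact congrFun h x

theorem rep_inclL {σ s : ℝ} (h : s ≤ σ) (F : Hs σ) : rep (inclL h F) = rep F := by
  rw [rep, toDist_inclL, rep]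

theorem hasWeakDeriv_rep {σ : ℝ} [Fact (1 / 2 < σ)] (h : s ≤ σ - 1) (F : Hs σ) :
    HasWeakDeriv (crep F) (crep (dL h F)) :=
  ⟨memLp_crep F, memLp_crep _, by rw [ofL2_crep, ofL2_crep, toDist_dL]⟩

theorem hasDerivAt_rep {σ : ℝ} [Fact (1 / 2 < σ)] (h : s ≤ σ - 1) (F : Hs σ) (x : ℝ) :
    HasDerivAt (rep F) (rep (dL h F) x) x := by
  have h1 := (hasWeakDeriv_rep h F).hasDerivAt (continuous_crep F) (continuous_crep _) x
  exact Complex.reCLM.hasFDerivAt.comp_hasDerivAt x h1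

end

end Hs

/-! ### Weak solutions of the elliptic equation -/

/-- A real function as a complex-valued function. -/
abbrev cplx (f : ℝ → ℝ) : ℝ → ℂ := fun x => (f x : ℂ)

/-- The multiplication by a bounded continuous function on `L²`. -/
def mulL2 (a : ℝ → ℝ) : L2 →L[ℝ] L2 :=
  open Classical in
  if h : MemLp (cplx a) ⊤ (volume : Measure ℝ) then
    (ContinuousLinearMap.mul ℝ ℂ).holderL volume ⊤ 2 2 (h.toLp _) else 0

theorem memLp_top_of_continuous {a : ℝ → ℝ} (ha : Continuous a) {B : ℝ} (hB : ∀ x, |a x| ≤ B) :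
    MemLp (cplx a) ⊤ (volume : Measure ℝ) :=
  memLp_top_of_bound (Complex.continuous_ofReal.comp ha).aestronglyMeasurable B
    (Eventually.of_forall fun x => by simpa using hB x)

theorem mulL2_ae {a : ℝ → ℝ} (ha : Continuous a) {B : ℝ} (hB : ∀ x, |a x| ≤ B) (u : L2) :
    mulL2 a u =ᵐ[volume] fun x => (a x : ℂ) * u x := by
  have h := memLp_top_of_continuous ha hB
  rw [mulL2, dif_pos h]
  have h1 := ContinuousLinearMap.coeFn_holder (r := 2) (ContinuousLinearMap.mul ℝ ℂ) (h.toLp _) u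
  filter_upwards [h1, h.coeFn_toLp] with x hx hx'
  refine hx.trans ?_
  rw [hx']
  rfl

theorem inner_L2_eq {u v : L2} {r q : ℝ → ℝ} (hu : u =ᵐ[volume] cplx r)
    (hv : v =ᵐ[volume] cplx q) : inner ℝ u v = ∫ x, r x * q x := by
  rw [MeasureTheory.L2.inner_def]
  refine integral_congr_ae ?_
  filter_upwards [hu, hv] with x hx hy
  rw [hx, hy, cplx, cplx]
  simp [Complex.inner, mul_comm]

namespace Hs

variable {σ : ℝ}

theorem exists_real (hσ : 0 ≤ σ) (F : Hs σ) : ∃ r : ℝ → ℝ, MemLp r 2 (volume : Measure ℝ) ∧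
    ofReal r = F.toDist := by
  obtain ⟨g, hg, hgF⟩ := exists_ofL2_of_memSobolev hσ F.memSobolev
  exact ⟨fun x => (g x).re, hg.re, by
    rw [← hgF]; exact IsRealDist.ofL2_eq hg (hgF ▸ F.isRealDist)⟩

theorem toL2_zero_ae {F : Hs 0} {r : ℝ → ℝ} (hr : MemLp r 2 (volume : Measure ℝ))
    (h : ofReal r = F.toDist) : toL2 0 F =ᵐ[volume] cplx r := by
  have h1 : besselL2 0 F.toDist = (memLp_cplx hr).toLp _ := by
    refine besselL2_eq ?_
    rw [besselPotential_zero, ContinuousLinearMap.id_apply, ← h, ofReal,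
      ofL2_of_memLp (memLp_cplx hr)]
  show besselL2 0 F.toDist =ᵐ[volume] cplx r
  rw [h1]
  exact MemLp.coeFn_toLp _

/-- The Hilbert structure pulled back along `J^σ`; Lax–Milgram in `H¹` uses it. -/
instance : InnerProductSpace ℝ (Hs σ) where
  inner F G := inner ℝ (toL2Isometry σ F) (toL2Isometry σ G)
  norm_sq_eq_re_inner F := by
    rw [← (toL2Isometry σ).norm_map F]
    exact norm_sq_eq_re_inner (𝕜 := ℝ) (toL2Isometry σ F)
  conj_inner_symm F G := inner_conj_symm _ _
  add_left F G H := by rw [map_add, inner_add_left]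
  smul_left F G c := by rw [map_smul, inner_smul_left]

/-- `H¹ → L²`, the inclusion. -/
def toL2One : Hs 1 →L[ℝ] L2 :=
  (toL2Isometry 0).toContinuousLinearMap ∘L inclL zero_le_one

/-- `H¹ → L²`, the derivative. -/
def derivL2One : Hs 1 →L[ℝ] L2 :=
  (toL2Isometry 0).toContinuousLinearMap ∘L dL (by norm_num)

theorem toL2One_ae (W : Hs 1) : toL2One W =ᵐ[volume] crep W :=
  toL2_zero_ae (F := inclL zero_le_one W) (memLp_rep W) (by rw [ofReal_rep, toDist_inclL])

theorem exists_derivL2One (W : Hs 1) : ∃ w' : ℝ → ℝ, HasWeakDeriv (crep W) (cplx w') ∧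
    derivL2One W =ᵐ[volume] cplx w' := by
  obtain ⟨r, hr, hr'⟩ := exists_real (σ := 0) le_rfl (dL (by norm_num) W)
  refine ⟨r, ⟨memLp_crep W, memLp_cplx hr, ?_⟩, toL2_zero_ae hr hr'⟩
  rw [ofL2_crep]
  exact hr'.symm

/-- The derivative enters the weight with the factor `(2π)⁻² ≤ 1`. This is what coercivity of the
energy form needs. -/
theorem norm_sq_le_one (W : Hs 1) : ‖W‖ ^ 2 ≤ ‖toL2One W‖ ^ 2 + ‖derivL2One W‖ ^ 2 := by
  obtain ⟨w', h1, h2⟩ := exists_derivL2One W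
  have e : ∀ {u : L2} {f : ℝ → ℂ} (_ : MemLp f 2 (volume : Measure ℝ)), u =ᵐ[volume] f →
      sob 0 f = ‖u‖ₑ ^ 2 := by
    intro u f hf hu
    rw [sob_zero_eq hf, enorm_sq_eq_lintegral]
    refine lintegral_congr_ae ?_
    filter_upwards [hu] with x hx
    rw [hx]
  have h3 := sob_succ_eq 0 h1
  rw [zero_add, sob_crep, e (memLp_crep W) (toL2One_ae W), e h1.right h2] at h3
  have h4 : ‖W‖ₑ ^ 2 ≤ ‖toL2One W‖ₑ ^ 2 + ‖derivL2One W‖ₑ ^ 2 := by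
    rw [h3]
    gcongr
    refine mul_le_of_le_one_left zero_le ?_
    rw [ENNReal.inv_le_one, fourPiSq, ← ENNReal.ofReal_one]
    refine ENNReal.ofReal_le_ofReal ?_
    nlinarith [Real.pi_gt_three]
  have := ENNReal.toReal_mono (by simp) h4
  rw [ENNReal.toReal_add (by simp) (by simp)] at this
  simpa using this

end Hs

theorem le_inner_mulL2 {a : ℝ → ℝ} (ha : Continuous a) {B α : ℝ} (hB : ∀ x, |a x| ≤ B)
    (hα : ∀ x, α ≤ a x) {u : L2} {r : ℝ → ℝ} (hu : u =ᵐ[volume] cplx r) :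
    α * ‖u‖ ^ 2 ≤ inner ℝ (mulL2 a u) u := by
  have hr : MemLp r 2 (volume : Measure ℝ) := memLp_of_cplx ((memLp_congr_ae hu).mp (Lp.memLp u))
  have hau : mulL2 a u =ᵐ[volume] cplx fun x => a x * r x := by
    filter_upwards [mulL2_ae ha hB u, hu] with x hx hx'
    rw [hx, hx']
    simp
  have har : MemLp (fun x => a x * r x) 2 (volume : Measure ℝ) :=
    memLp_of_cplx ((memLp_congr_ae hau).mp (Lp.memLp _))
  rw [inner_L2_eq hau hu, ← real_inner_self_eq_norm_sq, inner_L2_eq hu hu, ← integral_const_mul]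
  refine integral_mono ((hr.integrable_mul hr).const_mul α) (har.integrable_mul hr) fun x => ?_
  show α * (r x * r x) ≤ a x * r x * r x
  rw [mul_assoc]
  exact mul_le_mul_of_nonneg_right (hα x) (mul_self_nonneg _)

theorem ofReal_apply_eq_inner {r q : ℝ → ℝ} (hr : MemLp r 2 (volume : Measure ℝ)) {φ : 𝓢(ℝ, ℂ)}
    (hφ : ∀ x, (φ x).im = 0) (hq : ∀ x, q x = (φ x).re) :
    ofReal r φ = ((∫ x, r x * q x : ℝ) : ℂ) := by
  rw [ofReal_apply_real hr hφ]
  simp only [hq, mul_comm]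

/-- The first-order form of the equation `c w - ∂(a w') = -(∂ f) - g`. -/
theorem exists_weak_solution {a c f g : ℝ → ℝ} (ha : Continuous a) (hc : Continuous c) {B α : ℝ}
    (hα : 0 < α) (haB : ∀ x, |a x| ≤ B) (hcB : ∀ x, |c x| ≤ B) (haα : ∀ x, α ≤ a x)
    (hcα : ∀ x, α ≤ c x) (hf : MemLp f 2 (volume : Measure ℝ))
    (hg : MemLp g 2 (volume : Measure ℝ)) :
    ∃ w w' : ℝ → ℝ, HasWeakDeriv (cplx w) (cplx w') ∧
      HasWeakDeriv (cplx fun x => a x * w' x - f x) (cplx fun x => c x * w x + g x) := by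
  let F : L2 := (memLp_cplx hf).toLp _
  let G : L2 := (memLp_cplx hg).toLp _
  have hF : F =ᵐ[volume] cplx f := MemLp.coeFn_toLp _
  have hG : G =ᵐ[volume] cplx g := MemLp.coeFn_toLp _
  -- The energy form `∫ a W' Z' + c W Z`, coercive with the common lower bound `α`.
  let B₂ : Hs 1 →L[ℝ] Hs 1 →L[ℝ] ℝ :=
    (innerSL ℝ).bilinearComp (mulL2 a ∘L Hs.derivL2One) Hs.derivL2One +
      (innerSL ℝ).bilinearComp (mulL2 c ∘L Hs.toL2One) Hs.toL2One
  have hB₂ : ∀ W Z, B₂ W Z = inner ℝ (mulL2 a (Hs.derivL2One W)) (Hs.derivL2One Z) +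
      inner ℝ (mulL2 c (Hs.toL2One W)) (Hs.toL2One Z) := fun W Z => rfl
  have hco : IsCoercive B₂ := by
    refine ⟨α, hα, fun W => ?_⟩
    obtain ⟨w', -, h2⟩ := Hs.exists_derivL2One W
    have h3 := le_inner_mulL2 ha haB haα h2
    have h4 := le_inner_mulL2 hc hcB hcα (Hs.toL2One_ae W)
    rw [hB₂]
    have h5 := mul_le_mul_of_nonneg_left (Hs.norm_sq_le_one W) hα.le
    nlinarith
  -- The functional `Z ↦ ∫ f Z' - g Z`, represented by a vector of `H¹` for Lax–Milgram.
  let ℓ : StrongDual ℝ (Hs 1) := (innerSL ℝ F) ∘L Hs.derivL2One - (innerSL ℝ G) ∘L Hs.toL2One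
  let v : Hs 1 := (InnerProductSpace.toDual ℝ (Hs 1)).symm ℓ
  let W : Hs 1 := hco.continuousLinearEquivOfBilin.symm v
  have hW : ∀ Z, B₂ W Z = inner ℝ F (Hs.derivL2One Z) - inner ℝ G (Hs.toL2One Z) := by
    intro Z
    rw [← hco.continuousLinearEquivOfBilin_apply W Z]
    show inner ℝ (hco.continuousLinearEquivOfBilin (hco.continuousLinearEquivOfBilin.symm v)) Z = _
    rw [ContinuousLinearEquiv.apply_symm_apply, InnerProductSpace.toDual_symm_apply]
    rfl
  obtain ⟨w', h1, h2⟩ := Hs.exists_derivL2One W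
  have hw' : MemLp w' 2 (volume : Measure ℝ) := memLp_of_cplx h1.right
  have hau : mulL2 a (Hs.derivL2One W) =ᵐ[volume] cplx fun x => a x * w' x := by
    filter_upwards [mulL2_ae ha haB (Hs.derivL2One W), h2] with x hx hx'
    rw [hx, hx']
    simp
  have hcu : mulL2 c (Hs.toL2One W) =ᵐ[volume] cplx fun x => c x * Hs.rep W x := by
    filter_upwards [mulL2_ae hc hcB (Hs.toL2One W), Hs.toL2One_ae W] with x hx hx'
    rw [hx, hx']
    simp
  have maw : MemLp (fun x => a x * w' x) 2 (volume : Measure ℝ) :=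
    memLp_of_cplx ((memLp_congr_ae hau).mp (Lp.memLp _))
  have mcw : MemLp (fun x => c x * Hs.rep W x) 2 (volume : Measure ℝ) :=
    memLp_of_cplx ((memLp_congr_ae hcu).mp (Lp.memLp _))
  refine ⟨Hs.rep W, w', h1, memLp_cplx (maw.sub hf), memLp_cplx (mcw.add hg), ?_⟩
  -- Real test functions belong to `H¹`; tested with them, the variational identity says that `c w +
  -- g` is the weak derivative of `a w' - f`.
  refine dist_ext_real fun φ hφ => ?_
  have hφr : ∀ x, φ x = ((φ x).re : ℂ) := fun x => by
    apply Complex.ext <;> simp [hφ x]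
  have hφs : sob 1 (cplx fun x => (φ x).re) < ⊤ := by
    have := sob_schwartz_lt_top 1 φ
    rwa [show (φ : ℝ → ℂ) = cplx fun x => (φ x).re from funext hφr] at this
  have hφc : Continuous fun x => (φ x).re := Complex.continuous_re.comp φ.continuous
  let Z : Hs 1 := Hs.ofFun _ hφs
  have hcZ : Hs.crep Z = cplx fun x => (φ x).re :=
    funext fun x => congrArg _ (congrFun (Hs.rep_ofFun hφc hφs) x)
  have hZ : Hs.toL2One Z =ᵐ[volume] cplx fun x => (φ x).re := hcZ ▸ Hs.toL2One_ae Z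
  have hdφ : ∀ x, (schwartzDeriv φ x).im = 0 := by
    intro x
    have h1 := Complex.imCLM.hasFDerivAt.comp_hasDerivAt x (schwartz_hasDerivAt φ x)
    have h3 : (Complex.imCLM ∘ φ) = fun _ => (0 : ℝ) := by
      ext y; simp [hφ y]
    rw [h3] at h1
    exact h1.unique (hasDerivAt_const x (0 : ℝ))
  have hdZ : Hs.derivL2One Z =ᵐ[volume] cplx fun x => (schwartzDeriv φ x).re := by
    obtain ⟨z', hz1, hz2⟩ := Hs.exists_derivL2One Z
    have hz3 : HasWeakDeriv (Hs.crep Z) (schwartzDeriv φ) := by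
      have := schwartz_hasWeakDeriv φ
      rwa [show (φ : ℝ → ℂ) = Hs.crep Z from (funext hφr).trans hcZ.symm] at this
    filter_upwards [hz2, hz1.unique hz3] with x hx hx'
    rw [hx, hx', cplx]
    exact Complex.ext rfl (hdφ x)
  have key := hW Z
  rw [hB₂, inner_L2_eq hau hdZ, inner_L2_eq hcu hZ, inner_L2_eq hF hdZ, inner_L2_eq hG hZ] at key
  have mφ : MemLp (fun x => (φ x).re) 2 (volume : Measure ℝ) := (memLp_schwartz φ).re
  have mφ' : MemLp (fun x => (schwartzDeriv φ x).re) 2 (volume : Measure ℝ) :=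
    (memLp_schwartz (schwartzDeriv φ)).re
  rw [derivCLM_apply_apply, map_neg]
  show -(ofReal (fun x => a x * w' x - f x) (schwartzDeriv φ)) =
    ofReal (fun x => c x * Hs.rep W x + g x) φ
  rw [ofReal_apply_eq_inner (r := fun x => a x * w' x - f x) (maw.sub hf) hdφ fun x => rfl,
    ofReal_apply_eq_inner (r := fun x => c x * Hs.rep W x + g x) (mcw.add hg) hφ fun x => rfl, ← Complex.ofReal_neg]
  congr 1
  have i1 : ∫ x, (a x * w' x - f x) * (schwartzDeriv φ x).re =
      (∫ x, a x * w' x * (schwartzDeriv φ x).re) - ∫ x, f x * (schwartzDeriv φ x).re := by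
    have := integral_sub (maw.integrable_mul mφ') (hf.integrable_mul mφ')
    simp only [Pi.mul_apply, ← sub_mul] at this
    exact this
  have i2 : ∫ x, (c x * Hs.rep W x + g x) * (φ x).re =
      (∫ x, c x * Hs.rep W x * (φ x).re) + ∫ x, g x * (φ x).re := by
    have := integral_add (mcw.integrable_mul mφ) (hg.integrable_mul mφ)
    simp only [Pi.mul_apply, ← add_mul] at this
    exact this
  rw [i1, i2]
  linarith

/-! ### Perturbations of the constant one -/

/-- Functions `a` with `a - 1 ∈ H^s`. -/
def IsPert (s : ℝ) (a : ℝ → ℝ) : Prop := ∃ A : Hs s, ∀ x, a x = 1 + Hs.rep A x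

section

variable {s : ℝ} [hs : Fact (1 / 2 < s)] {a b : ℝ → ℝ}

theorem IsPert.continuous (ha : IsPert s a) : Continuous a := by
  obtain ⟨A, hA⟩ := ha
  rw [show a = fun x => 1 + Hs.rep A x from funext hA]
  exact continuous_const.add (Hs.continuous_rep A)

theorem IsPert.exists_bound (ha : IsPert s a) : ∃ B, ∀ x, |a x| ≤ B := by
  obtain ⟨A, hA⟩ := ha
  refine ⟨1 + Hs.supConst s * ‖A‖, fun x => ?_⟩
  rw [hA]
  refine (abs_add_le _ _).trans ?_
  rw [abs_one]
  linarith [Hs.abs_rep_le A x]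

theorem IsPert.mul (ha : IsPert s a) (hb : IsPert s b) : IsPert s fun x => a x * b x := by
  obtain ⟨A, hA⟩ := ha
  obtain ⟨B, hB⟩ := hb
  refine ⟨A + B + Hs.mul A B, fun x => ?_⟩
  show a x * b x = _
  rw [hA, hB, Hs.rep_add, Hs.rep_add, Hs.rep_mul]
  ring

theorem isPert_one : IsPert s fun _ => 1 := ⟨0, fun x => by rw [Hs.rep_zero, add_zero]⟩

theorem IsPert.pow (ha : IsPert s a) (n : ℕ) : IsPert s fun x => a x ^ n := by
  induction n with
  | zero => simpa using isPert_one
  | succ n ih => simpa only [pow_succ] using ih.mul ha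

/-- `a` tends to one at infinity, so it exceeds `1/2` outside a compact set, on which it attains a
positive minimum. -/
theorem IsPert.exists_lower (ha : IsPert s a) (hpos : ∀ x, 0 < a x) : ∃ c > 0, ∀ x, c ≤ a x := by
  have hac := ha.continuous
  obtain ⟨A, hA⟩ := ha
  have h1 : Tendsto a (cocompact ℝ) (𝓝 (1 + 0)) := by
    rw [show a = fun x => 1 + Hs.rep A x from funext hA]
    exact tendsto_const_nhds.add (Hs.tendsto_rep A)
  have h2 : ∀ᶠ x in cocompact ℝ, 1 / 2 < a x := h1.eventually_const_lt (by norm_num)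
  obtain ⟨K, hK, hKs⟩ := mem_cocompact.mp h2
  rcases K.eq_empty_or_nonempty with rfl | hne
  · refine ⟨1 / 2, by norm_num, fun x => ?_⟩
    have : x ∈ {x | 1 / 2 < a x} := hKs (by simp)
    exact le_of_lt this
  · obtain ⟨x₀, hx₀, hmin⟩ := hK.exists_isMinOn hne hac.continuousOn
    refine ⟨min (1 / 2) (a x₀), lt_min (by norm_num) (hpos x₀), fun x => ?_⟩
    by_cases hx : x ∈ K
    · exact (min_le_right _ _).trans (hmin hx)
    · have : x ∈ {x | 1 / 2 < a x} := hKs hx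
      exact (min_le_left _ _).trans (le_of_lt this)

/-- `1 / (1 + A) = 1 - A / (1 + A)`, and the quotient is in `H^s`. -/
theorem IsPert.inv (ha : IsPert s a) (hpos : ∀ x, 0 < a x) : IsPert s fun x => (a x)⁻¹ := by
  obtain ⟨c, hc, hca⟩ := ha.exists_lower hpos
  obtain ⟨A, hA⟩ := ha
  have hlow : ∀ x, c ≤ ‖1 + Hs.crep A x‖ := by
    intro x
    have : 1 + Hs.crep A x = ((a x : ℝ) : ℂ) := by rw [hA x]; simp [Hs.crep]
    rw [this, Complex.norm_real, Real.norm_of_nonneg (hpos x).le]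
    exact hca x
  have hq := sob_quot_lt_top hs.out (Hs.continuous_crep A) hc hlow (Hs.sob_crep_lt_top A)
  have e : quot (Hs.crep A) = cplx fun x => Hs.rep A x / (1 + Hs.rep A x) := by
    ext x
    simp [quot, cplx]
  rw [e] at hq
  have hcont : Continuous fun x => Hs.rep A x / (1 + Hs.rep A x) := by
    refine (Hs.continuous_rep A).div (continuous_const.add (Hs.continuous_rep A)) fun x => ?_
    rw [← hA]
    exact (hpos x).ne'
  refine ⟨-Hs.ofFun _ hq, fun x => ?_⟩
  rw [Hs.rep_neg, Hs.rep_ofFun hcont]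
  have := (hpos x).ne'
  show (a x)⁻¹ = 1 + -(Hs.rep A x / (1 + Hs.rep A x))
  rw [hA] at this ⊢
  field_simp
  ring

theorem IsPert.sob_mul_lt_top (ha : IsPert s a) {σ : ℝ} (h0 : 0 ≤ σ) (hσ : σ ≤ s) {f : ℝ → ℂ}
    (hf : sob σ f < ⊤) : sob σ (fun x => (a x : ℂ) * f x) < ⊤ := by
  obtain ⟨A, hA⟩ := ha
  have e : (fun x => (a x : ℂ) * f x) = f + Hs.crep A * f := by
    ext x
    rw [hA]
    simp [Hs.crep, add_mul]
  rw [e]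
  exact sob_add_lt_top hf (GreenNaghdi.sob_mul_lt_top hs.out h0 hσ (Hs.sob_crep_lt_top A) hf)

/-- Elliptic regularity. -/
theorem exists_regular_solution {a c f g : ℝ → ℝ} (ha : IsPert s a) (hc : IsPert s c)
    (hapos : ∀ x, 0 < a x) (hcpos : ∀ x, 0 < c x) (hf : sob s (cplx f) < ⊤)
    (hg : sob s (cplx g) < ⊤) :
    ∃ w w' : ℝ → ℝ, HasWeakDeriv (cplx w) (cplx w') ∧ sob (s + 1) (cplx w) < ⊤ ∧
      HasWeakDeriv (cplx fun x => a x * w' x - f x) (cplx fun x => 3 * c x * w x + g x) ∧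
      sob (s + 1) (cplx fun x => a x * w' x - f x) < ⊤ := by
  obtain ⟨α, hα, haα⟩ := ha.exists_lower hapos
  obtain ⟨γ, hγ, hcγ⟩ := hc.exists_lower hcpos
  obtain ⟨A, hA⟩ := ha.exists_bound
  obtain ⟨C, hC⟩ := hc.exists_bound
  have hA0 : 0 ≤ A := (abs_nonneg _).trans (hA 0)
  have hC0 : 0 ≤ C := (abs_nonneg _).trans (hC 0)
  have hs0 : 0 ≤ s := by linarith [hs.out]
  obtain ⟨w, w', h1, h2⟩ := exists_weak_solution (a := a) (c := fun x => 3 * c x) (f := f) (g := g)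
    (B := A + 3 * C) (α := min α (3 * γ)) ha.continuous (continuous_const.mul hc.continuous)
    (lt_min hα (by positivity)) (fun x => (hA x).trans (by linarith))
    (fun x => by rw [abs_mul, abs_of_pos (by norm_num : (0 : ℝ) < 3)]; linarith [hC x])
    (fun x => (min_le_left _ _).trans (haα x))
    (fun x => (min_le_right _ _).trans (by linarith [hcγ x]))
    (memLp_of_cplx (memLp_of_sob_lt_top hf)) (memLp_of_cplx (memLp_of_sob_lt_top hg))
  have hai := ha.inv hapos
  -- Bootstrap on the pair `w` and `k = a w' - f`: from `w' = a⁻¹ (k + f)` and `k' = 3 c w + g` both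
  -- derivatives inherit the order known for the pair, capped at `s`, so the pair gains one order
  -- per round.
  have step : ∀ n : ℕ, sob (min (1 + n) (s + 1)) (cplx w) < ⊤ ∧
      sob (min (1 + n) (s + 1)) (cplx fun x => a x * w' x - f x) < ⊤ := by
    intro n
    induction n with
    | zero =>
      have h : min (1 + ((0 : ℕ) : ℝ)) (s + 1) ≤ 1 := by simp
      exact ⟨(sob_mono h _).trans_lt h1.sob_one_lt_top, (sob_mono h _).trans_lt h2.sob_one_lt_top⟩
    | succ n ih =>
      set τ := min (1 + (n : ℝ)) (s + 1) with hτ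
      have hn : (0 : ℝ) ≤ n := Nat.cast_nonneg n
      have hτ0 : 0 ≤ τ := le_min (by linarith) (by linarith)
      set ρ := min τ s with hρ
      have hρ0 : 0 ≤ ρ := le_min hτ0 hs0
      have hρs : ρ ≤ s := min_le_right _ _
      have hρτ : ρ ≤ τ := min_le_left _ _
      have hle : min (1 + ((n + 1 : ℕ) : ℝ)) (s + 1) ≤ ρ + 1 := by
        rw [hρ, hτ, ← min_add_add_right, ← min_add_add_right]
        refine le_min (le_min ?_ ?_) (min_le_right _ _)
        · refine (min_le_left _ _).trans (le_of_eq ?_)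
          push_cast
          ring
        · exact (min_le_right _ _).trans (by linarith)
      have d1 : sob ρ (cplx w') < ⊤ := by
        have e : cplx w' = fun x => (((a x)⁻¹ : ℝ) : ℂ) *
            ((cplx fun x => a x * w' x - f x) + cplx f) x := by
          ext x
          have := (hapos x).ne'
          rw [Pi.add_apply, cplx, cplx, ← Complex.ofReal_add, ← Complex.ofReal_mul]
          congr 1
          field_simp
          ring
        rw [e]
        exact hai.sob_mul_lt_top hρ0 hρs (sob_add_lt_top ((sob_mono hρτ _).trans_lt ih.2)
          ((sob_mono hρs _).trans_lt hf))
      have d2 : sob ρ (cplx fun x => 3 * c x * w x + g x) < ⊤ := by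
        have e : (cplx fun x => 3 * c x * w x + g x) =
            (3 : ℂ) • (fun x => (c x : ℂ) * cplx w x) + cplx g := by
          ext x
          simp [cplx, mul_assoc]
        rw [e]
        exact sob_add_lt_top (sob_smul_lt_top 3 (hc.sob_mul_lt_top hρ0 hρs
          ((sob_mono hρτ _).trans_lt ih.1))) ((sob_mono hρs _).trans_lt hg)
      exact ⟨(sob_mono hle _).trans_lt (h1.sob_lt_top ((sob_mono hρτ _).trans_lt ih.1) d1),
        (sob_mono hle _).trans_lt (h2.sob_lt_top ((sob_mono hρτ _).trans_lt ih.2) d2)⟩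
  obtain ⟨n, hn⟩ := exists_nat_ge s
  have hle : s + 1 ≤ min (1 + (n : ℝ)) (s + 1) := le_min (by linarith) le_rfl
  exact ⟨w, w', h1, (sob_mono hle _).trans_lt (step n).1, h2, (sob_mono hle _).trans_lt (step n).2⟩

/-! ### The elliptic equation as an isomorphism of Sobolev spaces. -/

namespace Hs

/-- The derivative `H^(s+1) → H^s`. -/
abbrev der : Hs (s + 1) →L[ℝ] Hs s := dL (by simp)

/-- The inclusion `H^(s+1) → H^s`. -/
abbrev inc : Hs (s + 1) →L[ℝ] Hs s := inclL (by simp)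

theorem hasWeakDeriv_der (F : Hs (s + 1)) : HasWeakDeriv (crep F) (crep (der F)) :=
  hasWeakDeriv_rep _ F

theorem hasDerivAt_der (F : Hs (s + 1)) (x : ℝ) : HasDerivAt (rep F) (rep (der F) x) x :=
  hasDerivAt_rep _ F x

theorem rep_inc (F : Hs (s + 1)) : rep (inc F) = rep F := rep_inclL _ F

/-- `T` is the multiplication by the function `a`. -/
def IsMulOp (T : Hs s →L[ℝ] Hs s) (a : ℝ → ℝ) : Prop := ∀ F x, rep (T F) x = a x * rep F x

theorem isMulOp_one : IsMulOp (1 : Hs s →L[ℝ] Hs s) fun _ => 1 := fun F x => by simp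

theorem isMulOp_one_add (A : Hs s) : IsMulOp (1 + mul A) fun x => 1 + rep A x := fun F x => by
  rw [_root_.add_apply, rep_add, rep_mul, one_apply_eq_self]
  ring

theorem IsMulOp.mul {S T : Hs s →L[ℝ] Hs s} (hS : IsMulOp S a) (hT : IsMulOp T b) :
    IsMulOp (S * T) fun x => a x * b x := fun F x => by
  rw [mul_apply_eq_comp, hS, hT, mul_assoc]

theorem IsMulOp.pow {S : Hs s →L[ℝ] Hs s} (hS : IsMulOp S a) (n : ℕ) :
    IsMulOp (S ^ n) fun x => a x ^ n := by
  induction n with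
  | zero => simpa using isMulOp_one
  | succ n ih => simpa only [pow_succ] using ih.mul hS

theorem IsMulOp.ext {S T : Hs s →L[ℝ] Hs s} (hS : IsMulOp S a) (hT : IsMulOp T a) : S = T := by
  ext F
  exact rep_injective (funext fun x => by rw [hS, hT])

theorem exists_isMulOp (ha : IsPert s a) : ∃ T : Hs s →L[ℝ] Hs s, IsMulOp T a := by
  obtain ⟨A, hA⟩ := ha
  refine ⟨1 + mul A, ?_⟩
  rw [show a = fun x => 1 + rep A x from funext hA]
  exact isMulOp_one_add A

/-- The inverse operator is multiplication by `a⁻¹`. Since inversion in a Banach algebra is smooth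
at units, division depends smoothly on the denominator. -/
theorem isUnit_of_pos {T : Hs s →L[ℝ] Hs s} (hT : IsMulOp T a) (ha : IsPert s a)
    (hpos : ∀ x, 0 < a x) : IsUnit T ∧ IsMulOp (Ring.inverse T) fun x => (a x)⁻¹ := by
  obtain ⟨S, hS⟩ := exists_isMulOp (ha.inv hpos)
  have h1 : T * S = 1 := by
    refine (hT.mul hS).ext ?_
    simpa [(hpos _).ne'] using isMulOp_one
  have h2 : S * T = 1 := by
    refine (hS.mul hT).ext ?_
    simpa [(hpos _).ne'] using isMulOp_one
  let u : (Hs s →L[ℝ] Hs s)ˣ := ⟨T, S, h1, h2⟩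
  refine ⟨u.isUnit, ?_⟩
  have : Ring.inverse T = S := Ring.inverse_unit u
  rwa [this]

/-- The first-order system that is equivalent to the elliptic equation. -/
def ellip (S T : Hs s →L[ℝ] Hs s) : Hs (s + 1) × Hs (s + 1) →L[ℝ] Hs s × Hs s :=
  (S ∘L der ∘L .fst ℝ _ _ - inc ∘L .snd ℝ _ _).prod
    (der ∘L .snd ℝ _ _ - (3 : ℝ) • (T ∘L inc ∘L .fst ℝ _ _))

theorem ellip_apply (S T : Hs s →L[ℝ] Hs s) (p : Hs (s + 1) × Hs (s + 1)) :
    ellip S T p = (S (der p.1) - inc p.2, der p.2 - (3 : ℝ) • T (inc p.1)) := rfl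

/-- For a null vector `K = a W'` and `K' = 3 b W`; integrating `K W'` by parts gives `∫ a W'² + 3 ∫
b W² = 0`. -/
theorem ellip_injective {S T : Hs s →L[ℝ] Hs s} (hS : IsMulOp S a) (hT : IsMulOp T b)
    (hapos : ∀ x, 0 < a x) (hbpos : ∀ x, 0 < b x) : Function.Injective (ellip S T) := by
  rw [injective_iff_map_eq_zero]
  rintro ⟨W, K⟩ h
  rw [ellip_apply, Prod.mk_eq_zero] at h
  have hK : ∀ x, rep K x = a x * rep (der W) x := by
    intro x
    have := congrArg (fun F => rep F x) h.1
    simp only [rep_sub, rep_zero, hS _ x, rep_inc] at this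
    linarith
  have hK' : ∀ x, rep (der K) x = 3 * (b x * rep W x) := by
    intro x
    have := congrArg (fun F => rep F x) h.2
    simp only [rep_sub, rep_zero, rep_smul, hT _ x, rep_inc] at this
    linarith
  have key := (hasWeakDeriv_der K).integral_mul (hasWeakDeriv_der W)
  have e1 : (∫ x, crep K x * crep (der W) x) = ((∫ x, a x * rep (der W) x ^ 2 : ℝ) : ℂ) := by
    rw [← integral_complex_ofReal]
    refine integral_congr_ae (Eventually.of_forall fun x => ?_)
    simp only [crep, hK]
    push_cast
    ring
  have e2 : (∫ x, crep (der K) x * crep W x) = ((∫ x, 3 * (b x * rep W x ^ 2) : ℝ) : ℂ) := by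
    rw [← integral_complex_ofReal]
    refine integral_congr_ae (Eventually.of_forall fun x => ?_)
    simp only [crep, hK']
    push_cast
    ring
  rw [e1, e2, ← Complex.ofReal_neg, Complex.ofReal_inj] at key
  have p1 : 0 ≤ ∫ x, a x * rep (der W) x ^ 2 := integral_nonneg fun x => by
    have := hapos x
    positivity
  have hnn : ∀ x, 0 ≤ 3 * (b x * rep W x ^ 2) := fun x => by
    have := hbpos x
    positivity
  have p2 : 0 ≤ ∫ x, 3 * (b x * rep W x ^ 2) := integral_nonneg hnn
  have z : ∫ x, 3 * (b x * rep W x ^ 2) = 0 := by linarith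
  have hint : Integrable fun x => 3 * (b x * rep W x ^ 2) := by
    have := (memLp_rep (der K)).integrable_mul (memLp_rep W)
    refine this.congr (Eventually.of_forall fun x => ?_)
    simp only [Pi.mul_apply, hK']
    ring
  have hae := (integral_eq_zero_iff_of_nonneg hnn hint).mp z
  have hW : W = 0 := by
    have hW0 : rep W =ᵐ[volume] fun _ => (0 : ℝ) := by
      filter_upwards [hae] with x hx
      have := (hbpos x).ne'
      simpa [this] using hx
    refine rep_injective ?_
    rw [ae_eq_imp_eq (continuous_rep W) continuous_const hW0]
    ext x
    rw [rep_zero]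
  subst hW
  have hK0 : K = 0 := rep_injective (funext fun x => by rw [hK, map_zero, rep_zero, rep_zero, mul_zero])
  rw [hK0]
  rfl

/-- The second unknown is `K = a w' - f` for the regular solution `w`. The almost everywhere
identities become equalities because both sides have continuous representatives. -/
theorem ellip_surjective {S T : Hs s →L[ℝ] Hs s} (hS : IsMulOp S a) (hT : IsMulOp T b)
    (ha : IsPert s a) (hb : IsPert s b) (hapos : ∀ x, 0 < a x) (hbpos : ∀ x, 0 < b x) :
    Function.Surjective (ellip S T) := by
  rintro ⟨f, g⟩
  obtain ⟨w, w', h1, h2, h3, h4⟩ := exists_regular_solution ha hb hapos hbpos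
    (sob_crep_lt_top f) (sob_crep_lt_top g)
  obtain ⟨W, hW⟩ : ∃ W : Hs (s + 1), W = ofFun w h2 := ⟨_, rfl⟩
  obtain ⟨K, hK⟩ : ∃ K : Hs (s + 1), K = ofFun _ h4 := ⟨_, rfl⟩
  have rW : crep W =ᵐ[volume] cplx w := ofL2_inj (memLp_crep W) h1.left (by
    rw [ofL2_crep, hW]; rfl)
  have rK : crep K =ᵐ[volume] cplx fun x => a x * w' x - rep f x :=
    ofL2_inj (memLp_crep K) h3.left (by rw [ofL2_crep, hK]; rfl)
  have rW' : crep (der W) =ᵐ[volume] cplx w' :=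
    (hasWeakDeriv_der W).unique (h1.congr rW.symm ae_eq_rfl)
  have rK' : crep (der K) =ᵐ[volume] cplx fun x => 3 * b x * w x + rep g x :=
    (hasWeakDeriv_der K).unique (h3.congr rK.symm ae_eq_rfl)
  refine ⟨(W, K), ?_⟩
  rw [ellip_apply, Prod.mk.injEq]
  constructor
  · refine rep_injective (ae_eq_imp_eq (continuous_rep _) (continuous_rep _) ?_)
    filter_upwards [rW', rK] with x hx hx'
    have hx := Complex.ofReal_injective hx
    have hx' := Complex.ofReal_injective hx'
    rw [rep_sub, hS, rep_inc, hx, hx']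
    ring
  · refine rep_injective (ae_eq_imp_eq (continuous_rep _) (continuous_rep _) ?_)
    filter_upwards [rW, rK'] with x hx hx'
    have hx := Complex.ofReal_injective hx
    have hx' := Complex.ofReal_injective hx'
    rw [rep_sub, rep_smul, hT, rep_inc, hx, hx']
    ring

/-- The elliptic system is uniquely solvable. -/
theorem exists_ellip_equiv {S T : Hs s →L[ℝ] Hs s} (hS : IsMulOp S a) (hT : IsMulOp T b)
    (ha : IsPert s a) (hb : IsPert s b) (hapos : ∀ x, 0 < a x) (hbpos : ∀ x, 0 < b x) :
    ∃ e : (Hs (s + 1) × Hs (s + 1)) ≃L[ℝ] (Hs s × Hs s), (e : _ →L[ℝ] _) = ellip S T := by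
  refine ⟨ContinuousLinearEquiv.ofBijective (ellip S T) ?_ ?_, ?_⟩
  · exact LinearMap.ker_eq_bot.mpr (ellip_injective hS hT hapos hbpos)
  · exact LinearMap.range_eq_top.mpr (ellip_surjective hS hT ha hb hapos hbpos)
  · exact ContinuousLinearEquiv.coe_ofBijective _ _ _

end Hs

end

/-! ### Local flows -/

/-- Picard–Lindelöf with one time interval for a whole ball of initial values. Continuity of the
flow at `(y₀, 0)` permits shrinking the ball and the time so that orbits stay in `N`. -/
theorem exists_local_flow {E : Type*} [NormedAddCommGroup E] [NormedSpace ℝ E] [CompleteSpace E]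
    {f : E → E} {y₀ : E} (hf : ContDiffAt ℝ 1 f y₀) {N : Set E} (hN : N ∈ 𝓝 y₀) :
    ∃ T > 0, ∃ r > 0, ∃ α : E × ℝ → E,
      (∀ y ∈ Metric.closedBall y₀ r, α (y, 0) = y ∧ ∀ t ∈ Icc 0 T,
        HasDerivWithinAt (fun t => α (y, t)) (f (α (y, t))) (Icc 0 T) t ∧ α (y, t) ∈ N) ∧
      ContinuousOn α (Metric.closedBall y₀ r ×ˢ Icc 0 T) := by
  obtain ⟨ε, hε, a, r, L, K, hr, h⟩ := IsPicardLindelof.of_contDiffAt_one hf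
  obtain ⟨α, hα, hc⟩ :=
    (h 0).exists_forall_mem_closedBall_eq_hasDerivWithinAt_continuousOn
  simp only [zero_sub, zero_add] at hα hc
  have h0 : (y₀, (0 : ℝ)) ∈ Metric.closedBall y₀ (r : ℝ) ×ˢ Icc (-ε) ε :=
    ⟨Metric.mem_closedBall_self r.2, by simp [hε.le]⟩
  have hy0 : α (y₀, 0) = y₀ := (hα y₀ h0.1).1
  -- The flow is continuous jointly in the initial value and time, so `N` is not left near `(y₀,
  -- 0)`.
  have hpre : α ⁻¹' N ∈ 𝓝[Metric.closedBall y₀ (r : ℝ) ×ˢ Icc (-ε) ε] (y₀, (0 : ℝ)) :=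
    (hc _ h0) (by rwa [hy0])
  have hpre' : α ⁻¹' N ∈ 𝓝 (y₀, (0 : ℝ)) := by
    rwa [nhdsWithin_eq_nhds.mpr] at hpre
    exact prod_mem_nhds (Metric.closedBall_mem_nhds _ hr) (Icc_mem_nhds (by linarith) hε)
  rw [nhds_prod_eq, mem_prod_iff] at hpre'
  obtain ⟨U, hU, W, hW, hUW⟩ := hpre'
  obtain ⟨ρ, hρ, hρU⟩ := Metric.nhds_basis_closedBall.mem_iff.mp hU
  obtain ⟨δ, hδ, hδW⟩ := Metric.nhds_basis_closedBall.mem_iff.mp hW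
  have hsub : Icc 0 (min δ ε) ⊆ Icc (-ε) ε := fun t ht =>
    ⟨by linarith [ht.1], ht.2.trans (min_le_right _ _)⟩
  refine ⟨min δ ε, lt_min hδ hε, min ρ r, lt_min hρ hr, α, fun y hy => ?_, ?_⟩
  · have hyr := Metric.closedBall_subset_closedBall (min_le_right _ _) hy
    refine ⟨(hα y hyr).1, fun t ht => ⟨((hα y hyr).2 t (hsub ht)).mono hsub, ?_⟩⟩
    refine hUW (a := (y, t)) ⟨hρU (Metric.closedBall_subset_closedBall (min_le_left _ _) hy),
      hδW ?_⟩
    rw [Metric.mem_closedBall, Real.dist_0_eq_abs, abs_of_nonneg ht.1]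
    exact ht.2.trans (min_le_left _ _)
  · exact hc.mono (prod_mono (Metric.closedBall_subset_closedBall (min_le_right _ _)) hsub)

/-! ### The system in Lagrangian coordinates -/

namespace Hs

variable {s : ℝ} [hs : Fact (1 / 2 < s)]

/-- The space of the initial height, the displacement and the velocity. -/
abbrev Lag (s : ℝ) : Type := Hs s × Hs (s + 1) × Hs (s + 1)

/-- The multiplication by `1 / (1 + ψₓ)`. -/
def invJac (ψ : Hs (s + 1)) : Hs s →L[ℝ] Hs s := Ring.inverse (1 + mul (der ψ))

/-- The relative height `h₀ / (1 + ψₓ) - 1`. -/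
def relHeight (y : Lag s) : Hs s := invJac y.2.1 (y.1 - der y.2.1)

/-- The flux on the right-hand side of the elliptic equation. -/
def lagFlux (y : Lag s) : Hs s :=
  (3 / 2 : ℝ) • ((2 : ℝ) • relHeight y + mul (relHeight y) (relHeight y)) +
    -- `h³` brings three inverse powers of the Jacobian and `uₓ²`, by the chain rule, two more.
    (2 : ℝ) • ((1 + mul y.1) ^ 3 * invJac y.2.1 ^ 5 : Hs s →L[ℝ] Hs s) (mul (der y.2.2) (der y.2.2))

/-- The elliptic system in Lagrangian coordinates. -/
def lagEllip (y : Lag s) : Hs (s + 1) × Hs (s + 1) →L[ℝ] Hs s × Hs s :=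
  -- Three inverse powers come from `h³` and one from the chain rule for `wₓ`. In the second
  -- equation `h φ_y = h₀`, so the displacement drops out.
  ellip ((1 + mul y.1) ^ 3 * invJac y.2.1 ^ 4) (1 + mul y.1)

/-- The solution of the elliptic system. -/
def lagSol (y : Lag s) : Hs (s + 1) × Hs (s + 1) :=
  -- The sign of the data puts the flux into the second unknown, which thus becomes the full flux `k
  -- ∘ φ`.
  ContinuousLinearMap.inverse (lagEllip y) (-lagFlux y, 0)

/-- The vector field of the system in Lagrangian coordinates. -/
def lagField (y : Lag s) : Lag s := (0, y.2.2, -(lagSol y).1)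

/-- The states with positive height and with a displacement that is a diffeomorphism. -/
def lagDomain (s : ℝ) : Set (Lag s) :=
  {y | (∀ x, 0 < 1 + rep y.1 x) ∧ ∀ x, 0 < 1 + rep (der y.2.1) x}

theorem isPert_one_add (A : Hs s) : IsPert s fun x => 1 + rep A x := ⟨A, fun _ => rfl⟩

theorem isMulOp_invJac {ψ : Hs (s + 1)} (h : ∀ x, 0 < 1 + rep (der ψ) x) :
    IsUnit (1 + mul (der ψ) : Hs s →L[ℝ] Hs s) ∧
      IsMulOp (invJac ψ) fun x => (1 + rep (der ψ) x)⁻¹ :=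
  isUnit_of_pos (isMulOp_one_add _) (isPert_one_add _) h

/-- The coefficient `h₀³ / (1 + ψₓ)⁴`. -/
def lagCoeff (y : Lag s) (x : ℝ) : ℝ :=
  (1 + rep y.1 x) ^ 3 * ((1 + rep (der y.2.1) x)⁻¹) ^ 4

theorem lagCoeff_facts {y : Lag s} (hy : y ∈ lagDomain s) :
    IsMulOp ((1 + mul y.1) ^ 3 * invJac y.2.1 ^ 4) (lagCoeff y) ∧ IsPert s (lagCoeff y) ∧
      ∀ x, 0 < lagCoeff y x :=
  ⟨((isMulOp_one_add y.1).pow 3).mul ((isMulOp_invJac hy.2).2.pow 4),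
    ((isPert_one_add y.1).pow 3).mul (((isPert_one_add (der y.2.1)).inv hy.2).pow 4), fun x => by
      have h1 := hy.1 x
      have h2 := hy.2 x
      unfold lagCoeff
      positivity⟩

theorem exists_lagEllip_equiv {y : Lag s} (hy : y ∈ lagDomain s) :
    ∃ e : (Hs (s + 1) × Hs (s + 1)) ≃L[ℝ] (Hs s × Hs s), (e : _ →L[ℝ] _) = lagEllip y := by
  obtain ⟨h1, h2, h3⟩ := lagCoeff_facts hy
  exact exists_ellip_equiv h1 (isMulOp_one_add y.1) h2 (isPert_one_add y.1) h3 hy.1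

theorem lagEllip_lagSol {y : Lag s} (hy : y ∈ lagDomain s) :
    lagEllip y (lagSol y) = (-lagFlux y, 0) := by
  obtain ⟨e, he⟩ := exists_lagEllip_equiv hy
  rw [lagSol, ← he, ContinuousLinearMap.inverse_equiv]
  exact e.apply_symm_apply _

theorem rep_relHeight {y : Lag s} (hy : y ∈ lagDomain s) (x : ℝ) :
    1 + rep (relHeight y) x = (1 + rep y.1 x) / (1 + rep (der y.2.1) x) := by
  have h := (hy.2 x).ne'
  rw [relHeight, (isMulOp_invJac hy.2).2, rep_sub]
  field_simp
  ring

theorem rep_lagFlux {y : Lag s} (hy : y ∈ lagDomain s) (x : ℝ) :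
    rep (lagFlux y) x = 3 / 2 * (((1 + rep y.1 x) / (1 + rep (der y.2.1) x)) ^ 2 - 1) +
      2 * ((1 + rep y.1 x) ^ 3 * ((1 + rep (der y.2.1) x)⁻¹) ^ 5 * rep (der y.2.2) x ^ 2) := by
  have h := ((isMulOp_one_add y.1).pow 3).mul ((isMulOp_invJac hy.2).2.pow 5)
  rw [lagFlux, rep_add, rep_smul, rep_add, rep_smul, rep_mul, rep_smul, h, rep_mul,
    ← rep_relHeight hy]
  ring

/-- The solution of the elliptic system, as a pair of functions. -/
theorem lagSol_eq {y : Lag s} (hy : y ∈ lagDomain s) (x : ℝ) :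
    rep (lagSol y).2 x = lagCoeff y x * rep (der (lagSol y).1) x + rep (lagFlux y) x ∧
      rep (der (lagSol y).2) x = 3 * ((1 + rep y.1 x) * rep (lagSol y).1 x) := by
  have h := lagEllip_lagSol hy
  rw [lagEllip, ellip_apply, Prod.mk.injEq] at h
  constructor
  · have := congrArg (fun F => rep F x) h.1
    simp only [rep_sub, rep_neg, (lagCoeff_facts hy).1 _ x, rep_inc] at this
    linarith
  · have := congrArg (fun F => rep F x) h.2
    simp only [rep_sub, rep_zero, rep_smul, isMulOp_one_add y.1 _ x, rep_inc] at this
    linarith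

/-- Positive heights are bounded below by a positive constant, and the `H^s` norm controls the
supremum norm. -/
theorem isOpen_pos : IsOpen {A : Hs s | ∀ x, 0 < 1 + rep A x} := by
  rw [Metric.isOpen_iff]
  intro A hA
  obtain ⟨c, hc, hcA⟩ := (isPert_one_add A).exists_lower hA
  have hS : 0 ≤ supConst s := by unfold supConst; positivity
  refine ⟨c / (supConst s + 1), by positivity, fun B hB x => ?_⟩
  rw [Metric.mem_ball, dist_eq_norm, lt_div_iff₀ (by positivity)] at hB
  have h1 := abs_rep_le (B - A) x
  rw [rep_sub] at h1
  have h2 := (abs_le.mp h1).1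
  have h3 := hcA x
  nlinarith [norm_nonneg (B - A)]

/-- A sum of compositions with fixed operators, in which `C¹` dependence on `S` and `T` is evident.
-/
theorem ellip_eq (S T : Hs s →L[ℝ] Hs s) : ellip S T =
    (ContinuousLinearMap.inl ℝ (Hs s) (Hs s)) ∘L (S ∘L (der ∘L .fst ℝ _ _) - inc ∘L .snd ℝ _ _) +
    (ContinuousLinearMap.inr ℝ (Hs s) (Hs s)) ∘L
      (der ∘L .snd ℝ _ _ - (3 : ℝ) • (T ∘L (inc ∘L .fst ℝ _ _))) := by
  ext p <;> simp [ellip]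

/-- Only bounded linear and bilinear maps and inverses occur: inverses of multiplication operators,
and the inverse of the elliptic isomorphism, both smooth in the operator. No derivative is lost
because the latter inverse lands in `H^(s+1)`. -/
theorem contDiffAt_lagField {y : Lag s} (hy : y ∈ lagDomain s) : ContDiffAt ℝ 1 lagField y ∧
    ContDiffAt ℝ 1 (lagSol : Lag s → _) y := by
  have hη : ContDiffAt ℝ 1 (fun y : Lag s => y.1) y := contDiff_fst.contDiffAt
  have hψ : ContDiffAt ℝ 1 (fun y : Lag s => y.2.1) y := contDiff_snd.fst.contDiffAt
  have hv : ContDiffAt ℝ 1 (fun y : Lag s => y.2.2) y := contDiff_snd.snd.contDiffAt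
  have hψ' : ContDiffAt ℝ 1 (fun y : Lag s => der y.2.1) y := (der (s := s)).contDiff.contDiffAt.comp y hψ
  have hv' : ContDiffAt ℝ 1 (fun y : Lag s => der y.2.2) y := (der (s := s)).contDiff.contDiffAt.comp y hv
  have hM : ContDiff ℝ 1 (mul : Hs s → Hs s →L[ℝ] Hs s) := (mul (s := s)).contDiff
  have hH : ContDiffAt ℝ 1 (fun y : Lag s => (1 + mul y.1 : Hs s →L[ℝ] Hs s)) y :=
    contDiffAt_const.add (hM.contDiffAt.comp y hη)
  have hP : ContDiffAt ℝ 1 (fun y : Lag s => (1 + mul (der y.2.1) : Hs s →L[ℝ] Hs s)) y :=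
    contDiffAt_const.add (hM.contDiffAt.comp y hψ')
  have hI : ContDiffAt ℝ 1 (fun y : Lag s => invJac y.2.1) y := by
    obtain ⟨u, hu⟩ := (isMulOp_invJac hy.2).1
    have := contDiffAt_ringInverse ℝ (n := 1) u
    rw [hu] at this
    exact this.comp y hP
  have hθ : ContDiffAt ℝ 1 (relHeight : Lag s → Hs s) y := hI.clm_apply (hη.sub hψ')
  have hflux : ContDiffAt ℝ 1 (lagFlux : Lag s → Hs s) y := by
    unfold lagFlux
    refine ContDiffAt.add (ContDiffAt.const_smul _ ((hθ.const_smul _).add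
      ((hM.contDiffAt.comp y hθ).clm_apply hθ))) (ContDiffAt.const_smul _ ?_)
    exact ((hH.pow 3).mul (hI.pow 5)).clm_apply ((hM.contDiffAt.comp y hv').clm_apply hv')
  have hE : ContDiffAt ℝ 1 (lagEllip : Lag s → _) y := by
    unfold lagEllip
    simp only [ellip_eq]
    have hS := (hH.pow 3).mul (hI.pow 4)
    refine ContDiffAt.add (contDiffAt_const.clm_comp ((hS.clm_comp contDiffAt_const).sub
      contDiffAt_const)) (contDiffAt_const.clm_comp (contDiffAt_const.sub
      (ContDiffAt.const_smul _ (hH.clm_comp contDiffAt_const))))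
  have hsol : ContDiffAt ℝ 1 (lagSol : Lag s → _) y := by
    obtain ⟨e, he⟩ := exists_lagEllip_equiv hy
    have := contDiffAt_map_inverse (𝕜 := ℝ) (n := 1) e
    rw [he] at this
    exact (this.comp y hE).clm_apply (hflux.neg.prodMk contDiffAt_const)
  exact ⟨contDiffAt_const.prodMk (hv.prodMk hsol.fst.neg), hsol⟩

end Hs

/-- The first component has zero time derivative and so is a parameter; joint continuity of the flow
includes continuity in this parameter. -/
theorem exists_local_flow_triple {A B : Type*} [NormedAddCommGroup A] [NormedSpace ℝ A]
    [CompleteSpace A] [NormedAddCommGroup B] [NormedSpace ℝ B] [CompleteSpace B]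
    {w : A × B × B → B} {η₀ : A} {u₀ : B}
    (hf : ContDiffAt ℝ 1 (fun y : A × B × B => ((0 : A), y.2.2, -w y)) (η₀, 0, u₀))
    {N : Set (A × B × B)} (hN : N ∈ 𝓝 (η₀, (0 : B), u₀)) :
    ∃ T > 0, ∃ V ∈ 𝓝 (η₀, u₀), ∃ ψ v : A × B → ℝ → B,
      (∀ d ∈ V, (d.1, 0, d.2) ∈ N ∧ ψ d 0 = 0 ∧ v d 0 = d.2 ∧ ∀ t ∈ Icc 0 T,
        (d.1, ψ d t, v d t) ∈ N ∧ HasDerivWithinAt (ψ d) (v d t) (Icc 0 T) t ∧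
        HasDerivWithinAt (v d) (-w (d.1, ψ d t, v d t)) (Icc 0 T) t) ∧
      ContinuousOn (fun q : (A × B) × ℝ => ψ q.1 q.2) (V ×ˢ Icc 0 T) ∧
      ContinuousOn (fun q : (A × B) × ℝ => v q.1 q.2) (V ×ˢ Icc 0 T) := by
  obtain ⟨T, hT, r, hr, α, hα, hc⟩ := exists_local_flow hf hN
  let ι : A × B → A × B × B := fun d => (d.1, 0, d.2)
  have hι : Continuous ι := continuous_fst.prodMk (continuous_const.prodMk continuous_snd)
  have hV : ι ⁻¹' Metric.closedBall (η₀, 0, u₀) r ∈ 𝓝 (η₀, u₀) :=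
    hι.continuousAt.preimage_mem_nhds (Metric.closedBall_mem_nhds _ hr)
  refine ⟨T, hT, _, hV, fun d t => (α (ι d, t)).2.1, fun d t => (α (ι d, t)).2.2, ?_, ?_, ?_⟩
  · intro d hd
    obtain ⟨h0, h1⟩ := hα (ι d) hd
    have h0T : (0 : ℝ) ∈ Icc 0 T := ⟨le_rfl, hT.le⟩
    have hconst : ∀ t ∈ Icc 0 T, (α (ι d, t)).1 = d.1 := by
      intro t ht
      have hd1 : ∀ t ∈ Icc 0 T, HasDerivWithinAt (fun t => (α (ι d, t)).1) 0 (Icc 0 T) t :=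
        fun t ht => (h1 t ht).1.fst
      have := constant_of_derivWithin_zero (f := fun t => (α (ι d, t)).1)
        (fun t ht => (hd1 t ht).differentiableWithinAt)
        (fun t ht => (hd1 t ⟨ht.1, ht.2.le⟩).derivWithin
          (uniqueDiffOn_Icc hT t ⟨ht.1, ht.2.le⟩)) t ht
      rw [this]
      show (α (ι d, 0)).1 = d.1
      rw [h0]
    have hmem := (h1 0 h0T).2
    rw [h0] at hmem
    refine ⟨hmem, ?_, ?_, fun t ht => ?_⟩
    · show (α (ι d, 0)).2.1 = 0
      rw [h0]
    · show (α (ι d, 0)).2.2 = d.2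
      rw [h0]
    have e : α (ι d, t) = (d.1, (α (ι d, t)).2.1, (α (ι d, t)).2.2) := by
      rw [← hconst t ht]
    refine ⟨?_, (h1 t ht).1.snd.fst, ?_⟩
    · rw [← e]
      exact (h1 t ht).2
    · rw [← e]
      exact (h1 t ht).1.snd.snd
  · exact (continuous_fst.comp continuous_snd).comp_continuousOn (hc.comp
      ((hι.comp continuous_fst).prodMk continuous_snd).continuousOn fun q hq => ⟨hq.1, hq.2⟩)
  · exact (continuous_snd.comp continuous_snd).comp_continuousOn (hc.comp
      ((hι.comp continuous_fst).prodMk continuous_snd).continuousOn fun q hq => ⟨hq.1, hq.2⟩)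

namespace Hs

variable {s : ℝ} [hs : Fact (1 / 2 < s)]

theorem supConst_nonneg : 0 ≤ supConst s := by unfold supConst; positivity

/-- Displacements whose derivative is small enough. -/
def smallDisp (s : ℝ) [Fact (1 / 2 < s)] : Set (Hs (s + 1)) :=
  -- The bound forces `|ψ_y| ≤ 1/2` pointwise; adding one keeps the denominator positive.
  {ψ | ‖der ψ‖ < 1 / 2 / (supConst s + 1)}

theorem abs_der_le {ψ : Hs (s + 1)} (h : ψ ∈ smallDisp s) (x : ℝ) : |rep (der ψ) x| ≤ 1 / 2 := by
  have hS := supConst_nonneg (s := s)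
  have h2 : ‖der ψ‖ < 1 / 2 / (supConst s + 1) := h
  rw [lt_div_iff₀ (by positivity)] at h2
  refine (abs_rep_le (der ψ) x).trans ?_
  nlinarith [norm_nonneg (der ψ)]

theorem isOpen_smallDisp : IsOpen (smallDisp s) :=
  isOpen_lt (der (s := s)).continuous.norm continuous_const

theorem zero_mem_smallDisp : (0 : Hs (s + 1)) ∈ smallDisp s := by
  have hS := supConst_nonneg (s := s)
  rw [smallDisp, mem_ofPred_eq, map_zero, norm_zero]
  positivity

theorem lagDomain_of_small {y : Lag s} (h : ∀ x, 0 < 1 + rep y.1 x) (h' : y.2.1 ∈ smallDisp s) :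
    y ∈ lagDomain s :=
  ⟨h, fun x => by linarith [(abs_le.mp (abs_der_le h' x)).1]⟩

/-- The admissible states with a small displacement. -/
def smallStates (s : ℝ) [Fact (1 / 2 < s)] : Set (Lag s) :=
  {A : Hs s | ∀ x, 0 < 1 + rep A x} ×ˢ (smallDisp s ×ˢ univ)

/-- Local solutions of the system in Lagrangian coordinates. -/
theorem exists_lag_flow {η₀ : Hs s} (hη₀ : ∀ x, 0 < 1 + rep η₀ x) (u₀ : Hs (s + 1)) :
    ∃ T > 0, ∃ V ∈ 𝓝 (η₀, u₀), ∃ ψ v : Hs s × Hs (s + 1) → ℝ → Hs (s + 1),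
      (∀ d ∈ V, (d.1, 0, d.2) ∈ smallStates s ∧ ψ d 0 = 0 ∧ v d 0 = d.2 ∧ ∀ t ∈ Icc 0 T,
        (d.1, ψ d t, v d t) ∈ smallStates s ∧ HasDerivWithinAt (ψ d) (v d t) (Icc 0 T) t ∧
        HasDerivWithinAt (v d) (-(lagSol (d.1, ψ d t, v d t)).1) (Icc 0 T) t) ∧
      ContinuousOn (fun q : (Hs s × Hs (s + 1)) × ℝ => ψ q.1 q.2) (V ×ˢ Icc 0 T) ∧
      ContinuousOn (fun q : (Hs s × Hs (s + 1)) × ℝ => v q.1 q.2) (V ×ˢ Icc 0 T) := by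
  have hy : ((η₀, 0, u₀) : Lag s) ∈ lagDomain s := lagDomain_of_small hη₀ zero_mem_smallDisp
  exact exists_local_flow_triple (w := fun y => (lagSol y).1) (contDiffAt_lagField hy).1
    ((isOpen_pos.prod (isOpen_smallDisp.prod isOpen_univ)).mem_nhds
      ⟨hη₀, zero_mem_smallDisp, mem_univ _⟩)

end Hs

/-! ### Composition with diffeomorphisms -/

namespace Hs

variable {s : ℝ} [hs : Fact (1 / 2 < s)]

/-- The map `y ↦ y + ψ y`. -/
def phi (ψ : Hs (s + 1)) (y : ℝ) : ℝ := y + rep ψ y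

/-- The derivative of `y ↦ y + ψ y`. -/
def jac (ψ : Hs (s + 1)) (y : ℝ) : ℝ := 1 + rep (der ψ) y

/-- The inverse of the map `y ↦ y + ψ y`. -/
def phiInv (ψ : Hs (s + 1)) : ℝ → ℝ := Function.invFun (phi ψ)

theorem hasDerivAt_phi (ψ : Hs (s + 1)) (y : ℝ) : HasDerivAt (phi ψ) (jac ψ y) y :=
  (hasDerivAt_id y).add (hasDerivAt_der ψ y)

theorem continuous_phi (ψ : Hs (s + 1)) : Continuous (phi ψ) :=
  continuous_id.add (continuous_rep ψ)

theorem continuous_jac (ψ : Hs (s + 1)) : Continuous (jac ψ) :=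
  continuous_const.add (continuous_rep _)

section

variable {ψ : Hs (s + 1)} (h : ψ ∈ smallDisp s)

include h

theorem half_le_jac (y : ℝ) : 1 / 2 ≤ jac ψ y := by
  have := (abs_le.mp (abs_der_le h y)).1
  unfold jac
  linarith

theorem jac_le_two (y : ℝ) : jac ψ y ≤ 2 := by
  have := (abs_le.mp (abs_der_le h y)).2
  unfold jac
  linarith

theorem jac_pos (y : ℝ) : 0 < jac ψ y := by linarith [half_le_jac h y]

/-- By the mean value inequality `ψ` is Lipschitz with constant `1/2`, so the identity dominates it.
-/
theorem abs_sub_le_phi (a b : ℝ) : |a - b| ≤ 2 * |phi ψ a - phi ψ b| := by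
  have h1 : |rep ψ a - rep ψ b| ≤ 1 / 2 * |a - b| := by
    have := Convex.norm_image_sub_le_of_norm_hasDerivWithin_le (f := rep ψ) (f' := rep (der ψ))
      (s := univ) (C := 1 / 2) (fun x _ => (hasDerivAt_der ψ x).hasDerivWithinAt)
      (fun x _ => abs_der_le h x) convex_univ (mem_univ b) (mem_univ a)
    simpa [Real.norm_eq_abs] using this
  have h2 : a - b = (phi ψ a - phi ψ b) - (rep ψ a - rep ψ b) := by unfold phi; ring
  have h3 : |a - b| ≤ |phi ψ a - phi ψ b| + |rep ψ a - rep ψ b| := by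
    conv_lhs => rw [h2]
    exact abs_sub _ _
  linarith

theorem phi_injective : Function.Injective (phi ψ) := by
  intro a b hab
  have := abs_sub_le_phi h a b
  rw [hab, sub_self, abs_zero, mul_zero] at this
  exact sub_eq_zero.mp (abs_nonpos_iff.mp this)

omit h in
theorem phi_surjective (ψ : Hs (s + 1)) : Function.Surjective (phi ψ) := by
  have hb := abs_rep_le ψ
  refine (continuous_phi ψ).surjective ?_ ?_
  · exact tendsto_atTop_add_right_of_le _ _ tendsto_id fun y => (abs_le.mp (hb y)).1
  · exact tendsto_atBot_add_right_of_ge _ _ tendsto_id fun y => (abs_le.mp (hb y)).2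

omit h in
theorem phi_phiInv (ψ : Hs (s + 1)) (x : ℝ) : phi ψ (phiInv ψ x) = x :=
  Function.rightInverse_invFun (phi_surjective ψ) x

theorem phiInv_phi (y : ℝ) : phiInv ψ (phi ψ y) = y :=
  Function.leftInverse_invFun (phi_injective h) y

theorem abs_phiInv_sub_le (a b : ℝ) : |phiInv ψ a - phiInv ψ b| ≤ 2 * |a - b| := by
  simpa only [phi_phiInv] using abs_sub_le_phi h (phiInv ψ a) (phiInv ψ b)

theorem continuous_phiInv : Continuous (phiInv ψ) := by
  have : LipschitzWith 2 (phiInv ψ) := LipschitzWith.of_dist_le_mul fun a b => by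
    simpa [Real.dist_eq] using abs_phiInv_sub_le h a b
  exact this.continuous

theorem hasDerivAt_phiInv (x : ℝ) : HasDerivAt (phiInv ψ) (jac ψ (phiInv ψ x))⁻¹ x :=
  (hasDerivAt_phi ψ (phiInv ψ x)).of_local_left_inverse (continuous_phiInv h).continuousAt
    (jac_pos h _).ne' (Eventually.of_forall (phi_phiInv ψ))

omit h in
theorem abs_phiInv_sub_self_le (ψ : Hs (s + 1)) (x : ℝ) :
    |phiInv ψ x - x| ≤ supConst (s + 1) * ‖ψ‖ := by
  have h1 := phi_phiInv ψ x
  unfold phi at h1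
  have h2 : phiInv ψ x - x = -rep ψ (phiInv ψ x) := by linarith
  rw [h2, abs_neg]
  exact abs_rep_le _ _

/-- Apply the map of `ψ` to both points: the images differ by the value of `ψ - ψ'` at the second
point. -/
theorem abs_phiInv_sub_phiInv_le (ψ' : Hs (s + 1)) (x : ℝ) :
    |phiInv ψ x - phiInv ψ' x| ≤ 2 * (supConst (s + 1) * ‖ψ - ψ'‖) := by
  refine (abs_sub_le_phi h _ _).trans ?_
  have h1 : phi ψ (phiInv ψ x) - phi ψ (phiInv ψ' x) = -rep (ψ - ψ') (phiInv ψ' x) := by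
    have e1 := phi_phiInv ψ x
    have e2 := phi_phiInv ψ' x
    rw [e1, rep_sub]
    unfold phi at e2 ⊢
    linarith
  rw [h1, abs_neg]
  gcongr
  exact abs_rep_le _ _

theorem lintegral_phi (F : ℝ → ℝ≥0∞) :
    ∫⁻ x, F x = ∫⁻ y, ENNReal.ofReal (jac ψ y) * F (phi ψ y) := by
  have := lintegral_image_eq_lintegral_abs_deriv_mul MeasurableSet.univ
    (fun y _ => (hasDerivAt_phi ψ y).hasDerivWithinAt) (phi_injective h).injOn F
  rw [image_univ, (phi_surjective ψ).range_eq, setLIntegral_univ, setLIntegral_univ] at this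
  simpa only [abs_of_pos (jac_pos h _)] using this

theorem lintegral_comp_phiInv (F : ℝ → ℝ≥0∞) :
    ∫⁻ x, F (phiInv ψ x) = ∫⁻ y, ENNReal.ofReal (jac ψ y) * F y := by
  rw [lintegral_phi h]
  simp only [phiInv_phi h]

theorem lintegral_comp_phiInv_le (F : ℝ → ℝ≥0∞) : ∫⁻ x, F (phiInv ψ x) ≤ 2 * ∫⁻ y, F y := by
  rw [lintegral_comp_phiInv h, ← lintegral_const_mul' _ _ (by norm_num)]
  refine lintegral_mono fun y => ?_
  gcongr
  rw [← ENNReal.ofReal_ofNat]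
  exact ENNReal.ofReal_le_ofReal (jac_le_two h y)

theorem quasiMeasurePreserving_phiInv :
    Measure.QuasiMeasurePreserving (phiInv ψ) volume volume := by
  refine ⟨(continuous_phiInv h).measurable, Measure.AbsolutelyContinuous.mk fun N hN h0 => ?_⟩
  rw [Measure.map_apply (continuous_phiInv h).measurable hN, ← lintegral_indicator_one
    ((continuous_phiInv h).measurable hN)]
  have := lintegral_comp_phiInv_le h (N.indicator 1)
  rw [lintegral_indicator_one hN, h0, mul_zero] at this
  exact nonpos_iff_eq_zero.mp this

theorem comp_phiInv_congr {E : Type*} {f g : ℝ → E} (hfg : f =ᵐ[volume] g) :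
    f ∘ phiInv ψ =ᵐ[volume] g ∘ phiInv ψ :=
  (quasiMeasurePreserving_phiInv h).ae_eq_comp hfg

theorem memLp_comp_phiInv {f : ℝ → ℂ} (hf : MemLp f 2 (volume : Measure ℝ)) :
    MemLp (f ∘ phiInv ψ) 2 (volume : Measure ℝ) := by
  refine memLp_two_of_lintegral_lt_top
    (hf.1.comp_quasiMeasurePreserving (quasiMeasurePreserving_phiInv h)) ?_
  exact (lintegral_comp_phiInv_le h fun y => ‖f y‖ₑ ^ 2).trans_lt
    (ENNReal.mul_lt_top (by norm_num) (lintegral_lt_top_of_memLp_two hf))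

theorem sob_zero_comp_le {f : ℝ → ℂ} (hf : MemLp f 2 (volume : Measure ℝ)) :
    sob 0 (f ∘ phiInv ψ) ≤ 2 * sob 0 f := by
  rw [sob_zero_eq hf, sob_zero_eq (memLp_comp_phiInv h hf)]
  exact lintegral_comp_phiInv_le h fun y => ‖f y‖ₑ ^ 2

/-- Two changes of variable with Jacobian at most `2` give the `4`; distances shrink at most by half
under `φ`, and the kernel exponent turns this into `2^(1 + 2σ)`. -/
theorem gag_comp_le {σ : ℝ} (h0 : 0 < σ) (f : ℝ → ℂ) :
    gag σ (f ∘ phiInv ψ) ≤ 4 * ENNReal.ofReal (2 ^ (1 + 2 * σ)) * gag σ f := by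
  have h2 : ∀ y, ENNReal.ofReal (jac ψ y) ≤ 2 := fun y => by
    rw [← ENNReal.ofReal_ofNat]
    exact ENNReal.ofReal_le_ofReal (jac_le_two h y)
  have e1 : gag σ (f ∘ phiInv ψ) = ∫⁻ a, ENNReal.ofReal (jac ψ a) * ∫⁻ b, ENNReal.ofReal (jac ψ b) *
      (gagWt σ (phi ψ b - phi ψ a) * ‖f b - f a‖ₑ ^ 2) := by
    rw [gag, lintegral_phi h]
    refine lintegral_congr fun a => ?_
    rw [lintegral_phi h (fun z => gagWt σ (z - phi ψ a) * _)]
    simp only [Function.comp_apply, phiInv_phi h]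
  rw [e1, gag, ← lintegral_const_mul' _ _ (by finiteness)]
  refine lintegral_mono fun a => ?_
  calc _ ≤ 2 * ∫⁻ b, 2 * ((ENNReal.ofReal (2 ^ (1 + 2 * σ)) *
          gagWt σ (b - a)) * ‖f b - f a‖ₑ ^ 2) := by
        gcongr with b
        · exact h2 a
        · exact h2 b
        -- On the diagonal the kernel is `0`, by the convention for powers of zero.
        · rcases eq_or_ne b a with rfl | hne
          · rw [sub_self, gagWt, abs_zero, Real.zero_rpow (by linarith), ENNReal.ofReal_zero]
            exact zero_le
          rw [gagWt, gagWt, ← ENNReal.ofReal_mul (by positivity)]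
          refine ENNReal.ofReal_le_ofReal ?_
          have hp : 0 < |b - a| := abs_pos.mpr (sub_ne_zero.mpr hne)
          have hle := abs_sub_le_phi h b a
          calc |phi ψ b - phi ψ a| ^ (-1 - 2 * σ) ≤ (|b - a| / 2) ^ (-1 - 2 * σ) :=
                Real.rpow_le_rpow_of_nonpos (by positivity) (by linarith) (by linarith)
            _ = 2 ^ (1 + 2 * σ) * |b - a| ^ (-1 - 2 * σ) := by
                rw [Real.div_rpow hp.le (by norm_num), div_eq_mul_inv, ← Real.rpow_neg (by norm_num),
                  mul_comm]
                congr 2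
                ring
    _ = _ := by
        simp only [mul_assoc]
        rw [lintegral_const_mul' _ _ (by norm_num), lintegral_const_mul' _ _ (by simp)]
        ring

end

/-- The constant of the composition estimate of order `σ ∈ [0, 1)`. -/
def compConst (σ : ℝ) : ℝ≥0∞ := 2 + 4 * ENNReal.ofReal (2 ^ (1 + 2 * σ))

/-- For `σ > 0` the Gagliardo comparison in both directions around the change of variables, after
passing to a measurable representative. The constant does not depend on `ψ`, which the density
argument for joint continuity requires. -/
theorem sob_comp_le {ψ : Hs (s + 1)} (h : ψ ∈ smallDisp s) {σ : ℝ} (h0 : 0 ≤ σ) (h1 : σ < 1)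
    {f : ℝ → ℂ} (hf : MemLp f 2 (volume : Measure ℝ)) :
    sob σ (f ∘ phiInv ψ) ≤ compConst σ * sob σ f := by
  rcases h0.eq_or_lt with rfl | h0
  · refine (sob_zero_comp_le h hf).trans ?_
    gcongr
    exact le_self_add
  obtain ⟨g, hg, hfg⟩ : ∃ g : ℝ → ℂ, Measurable g ∧ f =ᵐ[volume] g :=
    ⟨hf.1.mk f, hf.1.stronglyMeasurable_mk.measurable, hf.1.ae_eq_mk⟩
  have hgL : MemLp g 2 (volume : Measure ℝ) := hf.ae_eq hfg
  rw [sob_congr σ hfg, sob_congr σ (comp_phiInv_congr h hfg)]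
  have hk := gag_le_sob h0 hgL hg
  have hC := gagConst_ne_zero σ
  have hC' := (gagConst_lt_top h0 h1).ne
  calc sob σ (g ∘ phiInv ψ) ≤ sob 0 (g ∘ phiInv ψ) + (gagConst σ)⁻¹ * gag σ (g ∘ phiInv ψ) :=
        sob_le_gag h0 h1 (memLp_comp_phiInv h hgL) (hg.comp (continuous_phiInv h).measurable)
    _ ≤ 2 * sob 0 g + (gagConst σ)⁻¹ * (4 * ENNReal.ofReal (2 ^ (1 + 2 * σ)) * gag σ g) := by
        gcongr
        · exact sob_zero_comp_le h hgL
        · exact gag_comp_le h h0 g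
    _ ≤ 2 * sob σ g + (gagConst σ)⁻¹ *
          (4 * ENNReal.ofReal (2 ^ (1 + 2 * σ)) * (gagConst σ * sob σ g)) := by
        gcongr
        exact sob_mono h0.le g
    _ = compConst σ * sob σ g := by
        rw [compConst, add_mul]
        congr 1
        rw [show (gagConst σ)⁻¹ * (4 * ENNReal.ofReal (2 ^ (1 + 2 * σ)) * (gagConst σ * sob σ g)) =
          ((gagConst σ)⁻¹ * gagConst σ) * (4 * ENNReal.ofReal (2 ^ (1 + 2 * σ)) * sob σ g) by ring,
          ENNReal.inv_mul_cancel hC hC', one_mul]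

theorem compConst_lt_top (σ : ℝ) : compConst σ < ⊤ := by
  unfold compConst
  finiteness

theorem hasDerivAt_comp_phiInv {ψ : Hs (s + 1)} (h : ψ ∈ smallDisp s) {f : ℝ → ℂ} {f' : ℝ → ℂ}
    (hf : ∀ x, HasDerivAt f (f' x) x) (x : ℝ) :
    HasDerivAt (f ∘ phiInv ψ) ((((jac ψ (phiInv ψ x))⁻¹ : ℝ) : ℂ) * f' (phiInv ψ x)) x := by
  have := (hf (phiInv ψ x)).scomp x (hasDerivAt_phiInv h x)
  simpa using this

theorem abs_inv_jac_le {ψ : Hs (s + 1)} (h : ψ ∈ smallDisp s) (x : ℝ) : |(jac ψ x)⁻¹| ≤ 2 := by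
  rw [abs_inv, abs_of_pos (jac_pos h x)]
  exact inv_le_of_inv_le₀ (by norm_num) (by simpa using half_le_jac h x)

theorem memLp_inv_jac_mul {ψ : Hs (s + 1)} (h : ψ ∈ smallDisp s) {f : ℝ → ℂ}
    (hf : MemLp f 2 (volume : Measure ℝ)) :
    MemLp (fun x => (((jac ψ x)⁻¹ : ℝ) : ℂ) * f x) 2 (volume : Measure ℝ) ∧
      sob 0 (fun x => (((jac ψ x)⁻¹ : ℝ) : ℂ) * f x) ≤ ENNReal.ofReal (2 ^ 2) * sob 0 f := by
  refine memLp_of_norm_le ((Complex.continuous_ofReal.comp ((continuous_jac ψ).inv₀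
    fun x => (jac_pos h x).ne')).aestronglyMeasurable.mul hf.1) hf fun x => ?_
  show ‖(((jac ψ x)⁻¹ : ℝ) : ℂ) * f x‖ ≤ 2 * ‖f x‖
  rw [norm_mul, Complex.norm_real]
  gcongr
  exact abs_inv_jac_le h x

/-- The chain rule for weak derivatives. -/
theorem _root_.GreenNaghdi.HasWeakDeriv.comp_phiInv {ψ : Hs (s + 1)} (h : ψ ∈ smallDisp s)
    {f f' : ℝ → ℂ} (hf : HasWeakDeriv f f') :
    HasWeakDeriv (f ∘ phiInv ψ) ((fun x => (((jac ψ x)⁻¹ : ℝ) : ℂ) * f' x) ∘ phiInv ψ) := by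
  obtain ⟨φ, h1, h2⟩ := hf.exists_schwartz
  have h1' := tendsto_sob_mono zero_le_one h1
  have hm := memLp_inv_jac_mul h hf.right
  refine HasWeakDeriv.of_tendsto (l := atTop) (f := fun n => φ n ∘ phiInv ψ)
    (g := fun n => (fun x => (((jac ψ x)⁻¹ : ℝ) : ℂ) * schwartzDeriv (φ n) x) ∘ phiInv ψ)
    (Eventually.of_forall fun n => ?_) (memLp_comp_phiInv h hf.left) (memLp_comp_phiInv h hm.1) ?_ ?_
  · exact hasWeakDeriv_of_hasDerivAt (memLp_comp_phiInv h (memLp_schwartz _))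
      (memLp_comp_phiInv h (memLp_inv_jac_mul h (memLp_schwartz _)).1)
      (hasDerivAt_comp_phiInv h (schwartz_hasDerivAt (φ n)))
  · have hlim := ENNReal.Tendsto.const_mul (a := 2) h1' (Or.inr (by norm_num))
    rw [mul_zero] at hlim
    refine tendsto_of_tendsto_of_tendsto_of_le_of_le tendsto_const_nhds hlim
      (fun _ => zero_le) fun n => ?_
    exact sob_zero_comp_le h ((memLp_schwartz (φ n)).sub hf.left)
  · have hlim := ENNReal.Tendsto.const_mul (a := 2 * ENNReal.ofReal (2 ^ 2)) h2
      (Or.inr (by finiteness))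
    rw [mul_zero] at hlim
    refine tendsto_of_tendsto_of_tendsto_of_le_of_le tendsto_const_nhds hlim
      (fun _ => zero_le) fun n => ?_
    have hd := memLp_inv_jac_mul h ((memLp_schwartz (schwartzDeriv (φ n))).sub hf.right)
    have e : (fun x => (((jac ψ x)⁻¹ : ℝ) : ℂ) * schwartzDeriv (φ n) x) ∘ phiInv ψ -
        (fun x => (((jac ψ x)⁻¹ : ℝ) : ℂ) * f' x) ∘ phiInv ψ =
        (fun x => (((jac ψ x)⁻¹ : ℝ) : ℂ) * ((schwartzDeriv (φ n) : ℝ → ℂ) - f') x) ∘ phiInv ψ := by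
      ext x
      simp only [Pi.sub_apply, Function.comp_apply]
      ring
    show sob 0 (_ - _) ≤ _
    rw [e, mul_assoc]
    exact (sob_zero_comp_le h hd.1).trans (by gcongr; exact hd.2)

end Hs

/-- The pattern of a density argument: choose the approximation index `n` first, then go far along
the filter. -/
theorem tendsto_zero_of_le_of_le {ι : Type*} {l : Filter ι} {u : ι → ℝ≥0∞} {a : ι → ℝ≥0∞}
    (ha : Tendsto a l (𝓝 0)) {b : ℕ → ℝ≥0∞} (hb : Tendsto b atTop (𝓝 0)) {C : ℕ → ι → ℝ≥0∞}
    (hC : ∀ n, Tendsto (C n) l (𝓝 0)) (h : ∀ n, ∀ᶠ i in l, u i ≤ a i + C n i + b n) :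
    Tendsto u l (𝓝 0) := by
  rw [ENNReal.tendsto_nhds_zero]
  intro ε hε
  have hε2 : 0 < ε / 2 := ENNReal.half_pos hε.ne'
  obtain ⟨n, hn⟩ := (hb.eventually_lt_const hε2).exists
  have h1 := ha.add (hC n)
  rw [add_zero] at h1
  filter_upwards [h n, h1.eventually_lt_const hε2] with i hi hi'
  calc u i ≤ a i + C n i + b n := hi
    _ ≤ ε / 2 + ε / 2 := add_le_add hi'.le hn.le
    _ = ε := ENNReal.add_halves ε

theorem tendsto_sq_zero {ι : Type*} {l : Filter ι} {u : ι → ℝ≥0∞} (h : Tendsto u l (𝓝 0)) :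
    Tendsto (fun i => u i ^ 2) l (𝓝 0) := by
  have := ((ENNReal.continuous_pow 2).tendsto 0).comp h
  simpa [Function.comp_def] using this

theorem exists_schwartz_decay (φ : 𝓢(ℝ, ℂ)) : ∃ C, 0 ≤ C ∧ ∀ x, ‖φ x‖ ≤ C * (1 + |x|)⁻¹ := by
  obtain ⟨C₀, -, h0⟩ := φ.decay 0 0
  obtain ⟨C₁, -, h1⟩ := φ.decay 1 0
  simp only [pow_zero, one_mul, pow_one, norm_iteratedFDeriv_zero, Real.norm_eq_abs] at h0 h1
  have hb : ∀ x, ‖φ x‖ ≤ (C₀ + C₁) * (1 + |x|)⁻¹ := fun x => by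
    rw [← div_eq_mul_inv, le_div_iff₀ (by positivity)]
    linarith [h0 x, h1 x]
  refine ⟨C₀ + C₁, ?_, hb⟩
  have := (norm_nonneg _).trans (hb 0)
  simpa using this

/-! ### Joint continuity of the composition in the function and the displacement. -/

namespace Hs

variable {s : ℝ} [hs : Fact (1 / 2 < s)] {ι : Type*} {l : Filter ι}
  {ψ' : ι → Hs (s + 1)} {ψ : Hs (s + 1)}

theorem tendsto_iff_sob {F : ι → Hs s} {F₀ : Hs s} :
    Tendsto F l (𝓝 F₀) ↔ Tendsto (fun i => sob s (crep (F i) - crep F₀)) l (𝓝 0) := by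
  have e : ∀ i, sob s (crep (F i) - crep F₀) = edist (F i) F₀ ^ 2 := fun i => by
    rw [← crep_sub, sob_crep, edist_eq_enorm_sub]
  simp only [e]
  rw [tendsto_iff_edist_tendsto_0]
  exact ⟨tendsto_sq_zero, tendsto_of_tendsto_sq⟩

theorem eventually_small (h : ψ ∈ smallDisp s) (hψ : Tendsto ψ' l (𝓝 ψ)) :
    ∀ᶠ i in l, ψ' i ∈ smallDisp s := hψ (isOpen_smallDisp.mem_nhds h)

theorem tendsto_phiInv (h : ψ ∈ smallDisp s) (hψ : Tendsto ψ' l (𝓝 ψ)) (x : ℝ) :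
    Tendsto (fun i => phiInv (ψ' i) x) l (𝓝 (phiInv ψ x)) := by
  rw [tendsto_iff_dist_tendsto_zero]
  have h1 : Tendsto (fun i => 2 * (supConst (s + 1) * ‖ψ' i - ψ‖)) l (𝓝 0) := by
    have := (tendsto_iff_norm_sub_tendsto_zero.mp hψ).const_mul (supConst (s + 1))
    simpa using this.const_mul 2
  refine tendsto_of_tendsto_of_tendsto_of_le_of_le' tendsto_const_nhds h1
    (Eventually.of_forall fun i => dist_nonneg) ?_
  filter_upwards [eventually_small h hψ] with i hi
  exact abs_phiInv_sub_phiInv_le hi ψ x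

theorem tendsto_rep_of_tendsto {F : ι → Hs s} {F₀ : Hs s} (hF : Tendsto F l (𝓝 F₀)) {x : ι → ℝ}
    {x₀ : ℝ} (hx : Tendsto x l (𝓝 x₀)) : Tendsto (fun i => rep (F i) (x i)) l (𝓝 (rep F₀ x₀)) := by
  have h1 : Tendsto (fun i => rep F₀ (x i)) l (𝓝 (rep F₀ x₀)) :=
    ((continuous_rep F₀).tendsto x₀).comp hx
  have h2 : Tendsto (fun i => rep (F i - F₀) (x i)) l (𝓝 0) := by
    have h3 : Tendsto (fun i => supConst s * ‖F i - F₀‖) l (𝓝 0) := by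
      simpa using (tendsto_iff_norm_sub_tendsto_zero.mp hF).const_mul (supConst s)
    exact squeeze_zero_norm (fun i => abs_rep_le _ _) h3
  have := h1.add h2
  rw [add_zero] at this
  refine this.congr fun i => ?_
  rw [rep_sub]
  ring

theorem tendsto_inv_jac (h : ψ ∈ smallDisp s) (hψ : Tendsto ψ' l (𝓝 ψ)) (x : ℝ) :
    Tendsto (fun i => (jac (ψ' i) (phiInv (ψ' i) x))⁻¹) l (𝓝 (jac ψ (phiInv ψ x))⁻¹) := by
  refine Tendsto.inv₀ ?_ (jac_pos h _).ne'
  exact tendsto_const_nhds.add (tendsto_rep_of_tendsto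
    (((der (s := s)).continuous.tendsto ψ).comp hψ) (tendsto_phiInv h hψ x))

section

variable [l.IsCountablyGenerated]

/-- Dominated convergence. The inverse diffeomorphisms move points by a bounded amount, so the decay
`(1 + |x|)⁻¹` of `φ` survives composition uniformly, and its square is integrable. The multipliers
accommodate the Jacobian factor in the chain rule. -/
theorem tendsto_schwartz_comp (h : ψ ∈ smallDisp s) (hψ : Tendsto ψ' l (𝓝 ψ)) (φ : 𝓢(ℝ, ℂ))
    {m' : ι → ℝ → ℝ} {m : ℝ → ℝ} (hmc : ∀ᶠ i in l, Continuous (m' i))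
    (hmb : ∀ᶠ i in l, ∀ x, |m' i x| ≤ 2) (hc : Continuous m) (hb : ∀ x, |m x| ≤ 2)
    (hlim : ∀ x, Tendsto (fun i => m' i x) l (𝓝 (m x))) :
    Tendsto (fun i => sob 0 ((fun x => (m' i x : ℂ) * φ (phiInv (ψ' i) x)) -
      fun x => (m x : ℂ) * φ (phiInv ψ x))) l (𝓝 0) := by
  obtain ⟨C, hC, hφ⟩ := exists_schwartz_decay φ
  set B := supConst (s + 1) * (‖ψ‖ + 1) with hB
  have hB0 : 0 ≤ B := mul_nonneg supConst_nonneg (by positivity)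
  have hψb : ∀ᶠ i in l, ‖ψ' i‖ < ‖ψ‖ + 1 := hψ.norm.eventually_lt_const (by linarith)
  have dec : ∀ χ : Hs (s + 1), ‖χ‖ ≤ ‖ψ‖ + 1 → ∀ x, ‖φ (phiInv χ x)‖ ≤ C * (1 + B) * (1 + |x|)⁻¹ := by
    intro χ hχ x
    refine (hφ _).trans ?_
    rw [mul_assoc]
    gcongr
    have h1 : |phiInv χ x - x| ≤ B := (abs_phiInv_sub_self_le χ x).trans
      (mul_le_mul_of_nonneg_left hχ supConst_nonneg)
    have h2 : |x| ≤ |phiInv χ x| + B := by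
      have := abs_sub_abs_le_abs_sub x (phiInv χ x)
      rw [abs_sub_comm] at this
      linarith
    rw [inv_le_iff_one_le_mul₀ (by positivity), mul_assoc, ← div_eq_inv_mul, ← mul_div_assoc,
      le_div_iff₀ (by positivity)]
    nlinarith [abs_nonneg (phiInv χ x)]
  set D := 4 * (C * (1 + B)) with hD
  have hbound : ∀ᶠ i in l, ∀ x, ‖(m' i x : ℂ) * φ (phiInv (ψ' i) x) - m x * φ (phiInv ψ x)‖ₑ ^ 2 ≤
      ENNReal.ofReal (D ^ 2 * (1 + ‖x‖) ^ (-2 : ℝ)) := by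
    filter_upwards [hmb, hψb] with i hi hi' x
    have h1 : ‖(m' i x : ℂ) * φ (phiInv (ψ' i) x) - m x * φ (phiInv ψ x)‖ ≤ D * (1 + |x|)⁻¹ := by
      refine (norm_sub_le _ _).trans ?_
      rw [norm_mul, norm_mul, Complex.norm_real, Complex.norm_real]
      calc _ ≤ 2 * (C * (1 + B) * (1 + |x|)⁻¹) + 2 * (C * (1 + B) * (1 + |x|)⁻¹) := by
            gcongr
            · exact hi x
            · exact dec _ hi'.le x
            · exact hb x
            · exact dec _ (by linarith) x
        _ = _ := by rw [hD]; ring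
    rw [← ofReal_norm, ← ENNReal.ofReal_pow (by positivity)]
    refine ENNReal.ofReal_le_ofReal ?_
    rw [Real.rpow_neg (by positivity), Real.rpow_two, ← inv_pow, ← mul_pow]
    gcongr
    exact h1
  have hcont : ∀ᶠ i in l, Continuous fun x => (m' i x : ℂ) * φ (phiInv (ψ' i) x) - m x * φ (phiInv ψ x) := by
    filter_upwards [hmc, eventually_small h hψ] with i hi hi'
    exact ((Complex.continuous_ofReal.comp hi).mul (φ.continuous.comp (continuous_phiInv hi'))).sub
      ((Complex.continuous_ofReal.comp hc).mul (φ.continuous.comp (continuous_phiInv h)))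
  have hfin : ∫⁻ x : ℝ, ENNReal.ofReal (D ^ 2 * (1 + ‖x‖) ^ (-2 : ℝ)) < ⊤ := by
    have : Integrable fun x : ℝ => D ^ 2 * (1 + ‖x‖) ^ (-2 : ℝ) :=
      (integrable_one_add_norm (by simp)).const_mul _
    exact this.lintegral_lt_top
  have key := tendsto_lintegral_filter_of_dominated_convergence (μ := volume) (l := l)
    (F := fun i x => ‖(m' i x : ℂ) * φ (phiInv (ψ' i) x) - m x * φ (phiInv ψ x)‖ₑ ^ 2)
    (f := fun _ => 0) (fun x : ℝ => ENNReal.ofReal (D ^ 2 * (1 + ‖x‖) ^ (-2 : ℝ)))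
    (hcont.mono fun i hi => (hi.measurable.enorm.pow_const 2))
    (hbound.mono fun i hi => Eventually.of_forall hi) hfin.ne
    (Eventually.of_forall fun x => by
      have h1 : Tendsto (fun i => (m' i x : ℂ) * φ (phiInv (ψ' i) x) - m x * φ (phiInv ψ x)) l
          (𝓝 ((m x : ℂ) * φ (phiInv ψ x) - m x * φ (phiInv ψ x))) :=
        (((Complex.continuous_ofReal.tendsto _).comp (hlim x)).mul
          ((φ.continuous.tendsto _).comp (tendsto_phiInv h hψ x))).sub tendsto_const_nhds
      rw [sub_self] at h1
      exact tendsto_sq_zero (by simpa using h1.enorm))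
  rw [lintegral_zero] at key
  refine key.congr' ?_
  filter_upwards [hcont, hbound] with i hi hi'
  have hm : MemLp (fun x => (m' i x : ℂ) * φ (phiInv (ψ' i) x) - m x * φ (phiInv ψ x)) 2
      (volume : Measure ℝ) :=
    memLp_two_of_lintegral_lt_top hi.aestronglyMeasurable ((lintegral_mono hi').trans_lt hfin)
  exact (sob_zero_eq hm).symm

theorem tendsto_sob_one_schwartz_comp (h : ψ ∈ smallDisp s) (hψ : Tendsto ψ' l (𝓝 ψ))
    (φ : 𝓢(ℝ, ℂ)) :
    Tendsto (fun i => sob 1 ((φ : ℝ → ℂ) ∘ phiInv (ψ' i) - (φ : ℝ → ℂ) ∘ phiInv ψ)) l (𝓝 0) := by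
  have l1 := tendsto_schwartz_comp h hψ φ (m' := fun _ _ => 1) (m := fun _ => 1)
    (Eventually.of_forall fun _ => continuous_const) (Eventually.of_forall fun _ _ => by norm_num)
    continuous_const (fun _ => by norm_num) fun _ => tendsto_const_nhds
  have cj : ∀ {χ : Hs (s + 1)}, χ ∈ smallDisp s → Continuous fun x => (jac χ (phiInv χ x))⁻¹ :=
    fun hχ => ((continuous_jac _).comp (continuous_phiInv hχ)).inv₀ fun x => (jac_pos hχ _).ne'
  have l2 := tendsto_schwartz_comp h hψ (schwartzDeriv φ)
    (m' := fun i x => (jac (ψ' i) (phiInv (ψ' i) x))⁻¹) (m := fun x => (jac ψ (phiInv ψ x))⁻¹)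
    ((eventually_small h hψ).mono fun i hi => cj hi)
    ((eventually_small h hψ).mono fun i hi x => abs_inv_jac_le hi _) (cj h)
    (fun x => abs_inv_jac_le h _) (tendsto_inv_jac h hψ)
  have l3 := l1.add (ENNReal.Tendsto.const_mul (a := (fourPiSq)⁻¹) l2
    (Or.inr (ENNReal.inv_ne_top.mpr fourPiSq_ne_zero)))
  rw [mul_zero, add_zero] at l3
  refine l3.congr' ?_
  filter_upwards [eventually_small h hψ] with i hi
  have hd := ((schwartz_hasWeakDeriv φ).comp_phiInv hi).sub ((schwartz_hasWeakDeriv φ).comp_phiInv h)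
  have := sob_succ_eq 0 hd
  rw [zero_add] at this
  rw [this]
  congr 2
  simp only [Complex.ofReal_one, one_mul]
  rfl

/-- Continuity of the composition in the base range of orders. -/
theorem tendsto_comp_base (h : ψ ∈ smallDisp s) (hψ : Tendsto ψ' l (𝓝 ψ)) {σ : ℝ} (h0 : 0 ≤ σ)
    (h1 : σ < 1) {f' : ι → ℝ → ℂ} {f : ℝ → ℂ} (hf : sob σ f < ⊤)
    (hf' : Tendsto (fun i => sob σ (f' i - f)) l (𝓝 0)) :
    sob σ (f ∘ phiInv ψ) < ⊤ ∧
      Tendsto (fun i => sob σ (f' i ∘ phiInv (ψ' i) - f ∘ phiInv ψ)) l (𝓝 0) := by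
  have hc := compConst_lt_top σ
  have hfL := memLp_of_sob_lt_top hf
  refine ⟨(sob_comp_le h h0 h1 hfL).trans_lt (ENNReal.mul_lt_top hc hf), ?_⟩
  obtain ⟨φ, hφ⟩ := exists_schwartz_tendsto hf
  have cm : ∀ {u : ℝ≥0∞} (_ : u ≠ ⊤) {κ : Type} {k : Filter κ} {w : κ → ℝ≥0∞}, Tendsto w k (𝓝 0) →
      Tendsto (fun i => u * w i) k (𝓝 0) := fun hu _ _ _ hw => by
    simpa using ENNReal.Tendsto.const_mul hw (Or.inr hu)
  have cm' : ∀ {u : ℝ≥0∞} (_ : u ≠ ⊤) {w : ι → ℝ≥0∞}, Tendsto w l (𝓝 0) →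
      Tendsto (fun i => u * w i) l (𝓝 0) := fun hu _ hw => by
    simpa using ENNReal.Tendsto.const_mul hw (Or.inr hu)
  refine tendsto_zero_of_le_of_le (a := fun i => 2 * compConst σ * sob σ (f' i - f))
    (b := fun n => 12 * compConst σ * sob σ (φ n - f))
    (C := fun n i => 8 * sob σ ((φ n : ℝ → ℂ) ∘ phiInv (ψ' i) - (φ n : ℝ → ℂ) ∘ phiInv ψ))
    (cm' (ENNReal.mul_ne_top (by norm_num) hc.ne) hf')
    (cm (ENNReal.mul_ne_top (by norm_num) hc.ne) hφ)
    (fun n => cm' (by norm_num) (tendsto_sob_mono h1.le (tendsto_sob_one_schwartz_comp h hψ (φ n))))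
    fun n => ?_
  filter_upwards [eventually_small h hψ, sob_lt_top_of_tendsto hf' hf] with i hi hfi
  -- Three terms are covered by the uniform composition estimate; the remaining one involves a fixed
  -- Schwartz function. Unwinding the nested sums gives `2`, `8` and `4 + 8 = 12`.
  have e : f' i ∘ phiInv (ψ' i) - f ∘ phiInv ψ = (f' i - f) ∘ phiInv (ψ' i) +
      ((f - (φ n : ℝ → ℂ)) ∘ phiInv (ψ' i) + (((φ n : ℝ → ℂ) ∘ phiInv (ψ' i) - (φ n : ℝ → ℂ) ∘ phiInv ψ) +
        ((φ n : ℝ → ℂ) - f) ∘ phiInv ψ)) := by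
    ext x
    simp only [Pi.sub_apply, Pi.add_apply, Function.comp_apply]
    ring
  have hφL := memLp_schwartz (φ n)
  have b1 := sob_comp_le hi h0 h1 ((memLp_of_sob_lt_top hfi).sub hfL)
  have b2 := sob_comp_le hi h0 h1 (hfL.sub hφL)
  have b3 := sob_comp_le h h0 h1 (hφL.sub hfL)
  rw [sob_comm σ f] at b2
  rw [e]
  refine (sob_add_le _ _ _).trans ?_
  refine (add_le_add (mul_le_mul_right b1 2) (mul_le_mul_right ((sob_add_le _ _ _).trans
    (add_le_add (mul_le_mul_right b2 2) (mul_le_mul_right ((sob_add_le _ _ _).trans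
      (add_le_add le_rfl (mul_le_mul_right b3 2))) 2))) 2)).trans ?_
  refine le_of_eq ?_
  ring

/-- The function `1 / (1 + ψₓ) - 1`. -/
def invJacFun (ψ : Hs (s + 1)) : Hs s := invJac ψ (-der ψ)

omit [l.IsCountablyGenerated] in
theorem rep_invJacFun (h : ψ ∈ smallDisp s) (x : ℝ) : (jac ψ x)⁻¹ = 1 + rep (invJacFun ψ) x := by
  have hp : ∀ x, 0 < 1 + rep (der ψ) x := jac_pos h
  have := (hp x).ne'
  rw [invJacFun, (isMulOp_invJac hp).2, rep_neg, jac]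
  field_simp
  ring

omit [l.IsCountablyGenerated] in
theorem tendsto_invJacFun (h : ψ ∈ smallDisp s) (hψ : Tendsto ψ' l (𝓝 ψ)) :
    Tendsto (fun i => invJacFun (ψ' i)) l (𝓝 (invJacFun ψ)) := by
  have hd := ((der (s := s)).continuous.tendsto ψ).comp hψ
  obtain ⟨u, hu⟩ := (isMulOp_invJac (jac_pos h)).1
  have h1 := (contDiffAt_ringInverse ℝ (n := 1) u).continuousAt
  rw [hu] at h1
  have h2 : Tendsto (fun i => (1 + mul (der (ψ' i)) : Hs s →L[ℝ] Hs s)) l (𝓝 (1 + mul (der ψ))) :=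
    tendsto_const_nhds.add (((mul (s := s)).continuous.tendsto _).comp hd)
  have h3 : Tendsto (fun i => invJac (ψ' i)) l (𝓝 (invJac ψ)) := h1.tendsto.comp h2
  exact ((isBoundedBilinearMap_apply (𝕜 := ℝ) (E := Hs s) (F := Hs s)).continuous.tendsto
    (invJac ψ, -der ψ)).comp (h3.prodMk_nhds hd.neg)

/-- The derivative of `f ∘ φ⁻¹` is `(f' / φ_y) ∘ φ⁻¹`. Here `1 / φ_y - 1` is in `H^s` and depends
continuously on `ψ`, so multiplication by it preserves order `σ ≤ s`, and the hypothesis of order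
`σ` applies to this derivative. -/
theorem tendsto_comp_step (h : ψ ∈ smallDisp s) (hψ : Tendsto ψ' l (𝓝 ψ)) {σ : ℝ} (h0 : 0 ≤ σ)
    (h1 : σ ≤ s)
    (ih : ∀ {f' : ι → ℝ → ℂ} {f : ℝ → ℂ}, sob σ f < ⊤ →
      Tendsto (fun i => sob σ (f' i - f)) l (𝓝 0) → sob σ (f ∘ phiInv ψ) < ⊤ ∧
        Tendsto (fun i => sob σ (f' i ∘ phiInv (ψ' i) - f ∘ phiInv ψ)) l (𝓝 0))
    {f' : ι → ℝ → ℂ} {f : ℝ → ℂ} (hf : sob (σ + 1) f < ⊤)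
    (hf' : Tendsto (fun i => sob (σ + 1) (f' i - f)) l (𝓝 0)) :
    sob (σ + 1) (f ∘ phiInv ψ) < ⊤ ∧
      Tendsto (fun i => sob (σ + 1) (f' i ∘ phiInv (ψ' i) - f ∘ phiInv ψ)) l (𝓝 0) := by
  have hle : σ ≤ σ + 1 := by linarith
  obtain ⟨g, hg⟩ := exists_hasWeakDeriv ((sob_mono (by linarith : (1 : ℝ) ≤ σ + 1) f).trans_lt hf)
  -- Convergence places `f' i` in order `σ + 1` only eventually; elsewhere the value of `g'` is
  -- irrelevant.
  have hex : ∀ i, ∃ g', sob (σ + 1) (f' i) < ⊤ → HasWeakDeriv (f' i) g' := fun i => by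
    by_cases hi : sob (σ + 1) (f' i) < ⊤
    · obtain ⟨g', hg'⟩ := exists_hasWeakDeriv
        ((sob_mono (by linarith : (1 : ℝ) ≤ σ + 1) (f' i)).trans_lt hi)
      exact ⟨g', fun _ => hg'⟩
    · exact ⟨0, fun h => absurd h hi⟩
  choose g' hg' using hex
  have hev := sob_lt_top_of_tendsto hf' hf
  have hgσ : sob σ g < ⊤ := (hg.sob_deriv_le σ).trans_lt (ENNReal.mul_lt_top fourPiSq_ne_top.lt_top hf)
  have hglim : Tendsto (fun i => sob σ (g' i - g)) l (𝓝 0) := by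
    have := ENNReal.Tendsto.const_mul (a := fourPiSq) hf' (Or.inr fourPiSq_ne_top)
    rw [mul_zero] at this
    refine tendsto_of_tendsto_of_tendsto_of_le_of_le' tendsto_const_nhds this
      (Eventually.of_forall fun _ => zero_le) ?_
    filter_upwards [hev] with i hi
    exact ((hg' i hi).sub hg).sob_deriv_le σ
  have hA := tendsto_iff_sob.mp (tendsto_invJacFun h hψ)
  have hprod := tendsto_sob_mul hs.out h0 h1 (sob_crep_lt_top (invJacFun ψ)) hgσ hA hglim
  have hk : sob σ (g + crep (invJacFun ψ) * g) < ⊤ := sob_add_lt_top hgσ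
    (sob_mul_lt_top hs.out h0 h1 (sob_crep_lt_top _) hgσ)
  have hklim : Tendsto (fun i => sob σ ((g' i + crep (invJacFun (ψ' i)) * g' i) -
      (g + crep (invJacFun ψ) * g))) l (𝓝 0) := by
    have l1 := (ENNReal.Tendsto.const_mul (a := 2) hglim (Or.inr (by norm_num))).add
      (ENNReal.Tendsto.const_mul (a := 2) hprod (Or.inr (by norm_num)))
    simp only [mul_zero, add_zero] at l1
    refine tendsto_of_tendsto_of_tendsto_of_le_of_le tendsto_const_nhds l1
      (fun _ => zero_le) fun i => ?_
    show sob σ _ ≤ _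
    rw [add_sub_add_comm]
    exact sob_add_le _ _ _
  have ek : ∀ {χ : Hs (s + 1)} (_ : χ ∈ smallDisp s) (q : ℝ → ℂ),
      (fun x => (((jac χ x)⁻¹ : ℝ) : ℂ) * q x) = q + crep (invJacFun χ) * q := fun hχ q => by
    ext x
    rw [rep_invJacFun hχ]
    simp [crep, add_mul]
  have c1 := ih hk hklim
  have c0 := ih ((sob_mono hle f).trans_lt hf) (tendsto_sob_mono hle hf')
  have hW : ∀ {χ : Hs (s + 1)} (_ : χ ∈ smallDisp s) {q q' : ℝ → ℂ}, HasWeakDeriv q q' →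
      HasWeakDeriv (q ∘ phiInv χ) ((q' + crep (invJacFun χ) * q') ∘ phiInv χ) := fun hχ _ _ hq => by
    rw [← ek hχ]
    exact hq.comp_phiInv hχ
  refine ⟨(hW h hg).sob_lt_top c0.1 c1.1, ?_⟩
  have l3 := c0.2.add (ENNReal.Tendsto.const_mul (a := (fourPiSq)⁻¹) c1.2
    (Or.inr (ENNReal.inv_ne_top.mpr fourPiSq_ne_zero)))
  rw [mul_zero, add_zero] at l3
  refine l3.congr' ?_
  filter_upwards [eventually_small h hψ, hev] with i hi hi'
  exact (sob_succ_eq σ ((hW hi (hg' i hi')).sub (hW h hg))).symm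

/-- Continuity of the composition. -/
theorem tendsto_comp (h : ψ ∈ smallDisp s) (hψ : Tendsto ψ' l (𝓝 ψ)) {σ : ℝ} (h0 : 0 ≤ σ)
    (h1 : σ ≤ s + 1) {f' : ι → ℝ → ℂ} {f : ℝ → ℂ} (hf : sob σ f < ⊤)
    (hf' : Tendsto (fun i => sob σ (f' i - f)) l (𝓝 0)) :
    sob σ (f ∘ phiInv ψ) < ⊤ ∧
      Tendsto (fun i => sob σ (f' i ∘ phiInv (ψ' i) - f ∘ phiInv ψ)) l (𝓝 0) := by
  -- Induction on the integer part of the order; each step removes one derivative until the order is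
  -- below `1`.
  have main : ∀ n : ℕ, ∀ τ : ℝ, 0 ≤ τ → τ < n + 1 → τ ≤ s + 1 →
      ∀ {f' : ι → ℝ → ℂ} {f : ℝ → ℂ}, sob τ f < ⊤ →
      Tendsto (fun i => sob τ (f' i - f)) l (𝓝 0) → sob τ (f ∘ phiInv ψ) < ⊤ ∧
        Tendsto (fun i => sob τ (f' i ∘ phiInv (ψ' i) - f ∘ phiInv ψ)) l (𝓝 0) := by
    intro n
    induction n with
    | zero =>
      intro τ h2 h3 h4 f' f h5 h6
      exact tendsto_comp_base h hψ h2 (by simpa using h3) h5 h6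
    | succ n ih =>
      intro τ h2 h3 h4 f' f h5 h6
      rcases lt_or_ge τ 1 with hτ | hτ
      · exact tendsto_comp_base h hψ h2 hτ h5 h6
      obtain ⟨ρ, rfl⟩ : ∃ ρ, τ = ρ + 1 := ⟨τ - 1, by ring⟩
      push_cast at h3
      exact tendsto_comp_step h hψ (by linarith) (by linarith)
        (ih ρ (by linarith) (by linarith) (by linarith)) h5 h6
  obtain ⟨n, hn⟩ := exists_nat_gt σ
  exact main n σ h0 (by linarith) h1 hf hf'

end

/-- The composition of a function with the inverse of `y ↦ y + ψ y`. -/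
def comp {σ : ℝ} (ψ : Hs (s + 1)) (F : Hs σ) : Hs σ :=
  open Classical in
  if h : sob σ (cplx (rep F ∘ phiInv ψ)) < ⊤ then ofFun _ h else 0

section

variable {σ : ℝ} [hσ : Fact (1 / 2 < σ)]

theorem rep_comp (h : ψ ∈ smallDisp s) (h1 : σ ≤ s + 1) (F : Hs σ) (x : ℝ) :
    rep (comp ψ F) x = rep F (phiInv ψ x) := by
  have hlt : sob σ (cplx (rep F ∘ phiInv ψ)) < ⊤ :=
    -- Only finiteness is wanted, and along the trivial filter the convergence hypotheses are
    -- vacuous.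
    (tendsto_comp (l := (⊥ : Filter ℕ)) (ψ' := fun _ => ψ) (f' := fun _ => 0) h tendsto_bot
      (by linarith [hσ.out]) h1 (sob_crep_lt_top F) tendsto_bot).1
  rw [comp, dif_pos hlt, rep_ofFun ((continuous_rep F).comp (continuous_phiInv h))]
  rfl

theorem tendsto_comp_Hs [l.IsCountablyGenerated] (h : ψ ∈ smallDisp s) (h1 : σ ≤ s + 1)
    (hψ : Tendsto ψ' l (𝓝 ψ)) {F' : ι → Hs σ} {F : Hs σ} (hF : Tendsto F' l (𝓝 F)) :
    Tendsto (fun i => comp (ψ' i) (F' i)) l (𝓝 (comp ψ F)) := by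
  rw [tendsto_iff_sob]
  have := (tendsto_comp h hψ (by linarith [hσ.out]) h1 (sob_crep_lt_top F)
    (tendsto_iff_sob.mp hF)).2
  refine this.congr' ?_
  filter_upwards [eventually_small h hψ] with i hi
  congr 1
  ext x
  simp only [Pi.sub_apply, Function.comp_apply, crep, rep_comp hi h1, rep_comp h h1]

end

end Hs

/-! ### Products with distributions -/

theorem norm_besselL2_sub (σ : ℝ) {F G : 𝓢'(ℝ, ℂ)} (hF : MemSobolev σ 2 F)
    (hG : MemSobolev σ 2 G) : besselL2 σ (F - G) = besselL2 σ F - besselL2 σ G :=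
  besselL2_eq (by
    rw [map_sub, besselL2_spec hF, besselL2_spec hG]
    exact (map_sub (Lp.toTemperedDistributionCLM ℂ (volume : Measure ℝ) 2) _ _).symm)

/-- The symbol `2π|ξ| (1 + ξ²)^(-1/2)` is at most `2π`. Formulated for distributions, it also covers
negative orders, where `dx F` need not be a function. -/
theorem norm_besselL2_dx_le {σ : ℝ} {F : 𝓢'(ℝ, ℂ)} (hF : MemSobolev σ 2 F) :
    ‖besselL2 (σ - 1) (dx F)‖ ≤ 2 * Real.pi * ‖besselL2 σ F‖ := by
  set m : ℝ → ℂ := fun ξ => (((1 + ‖ξ‖ ^ 2) ^ ((-1) / 2 : ℝ) : ℝ) : ℂ) with hm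
  set d : ℝ → ℂ := fun ξ => 2 * Real.pi * Complex.I * ξ with hd
  have hmt : m.HasTemperateGrowth := bessel_symbol_temperate (-1)
  have hdt : d.HasTemperateGrowth := by fun_prop
  have h1 : besselPotential ℝ ℂ (σ - 1) (dx F) =
      fourierMultiplierCLM ℂ (m * d) (besselPotential ℝ ℂ σ F) := by
    have e1 : besselPotential ℝ ℂ (σ - 1) (dx F) =
        besselPotential ℝ ℂ (-1) (besselPotential ℝ ℂ σ (dx F)) := by
      rw [besselPotential_besselPotential_apply, sub_eq_add_neg]
    rw [e1, dx_eq_fourierMultiplier, ← fourierMultiplierCLM_fourierMultiplierCLM_apply hmt hdt,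
      besselPotential, besselPotential,
      fourierMultiplierCLM_fourierMultiplierCLM_apply hdt (bessel_symbol_temperate σ),
      fourierMultiplierCLM_fourierMultiplierCLM_apply (hdt.mul (bessel_symbol_temperate σ)) hmt,
      fourierMultiplierCLM_fourierMultiplierCLM_apply (bessel_symbol_temperate σ) hmt,
      fourierMultiplierCLM_fourierMultiplierCLM_apply ((bessel_symbol_temperate σ).mul hmt) hdt]
    refine congrArg (fun a => fourierMultiplierCLM ℂ a F) ?_
    ring
  rw [besselL2_spec (Hs.memSobolev_dx hF), besselL2_spec hF] at h1
  have h2 := (fourierMultiplier_toTemperedDistribution_iff (hmt.mul hdt) _ _).1 h1.symm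
  rw [← Lp.norm_fourier_eq, ← Lp.norm_fourier_eq (besselL2 σ F)]
  refine Lp.norm_le_mul_norm_of_ae_le_mul ?_
  filter_upwards [h2] with ξ hξ
  rw [hξ, norm_mul]
  refine mul_le_mul_of_nonneg_right ?_ (norm_nonneg _)
  have e3 : ‖(m * d) ξ‖ = 2 * Real.pi * ((1 + ξ ^ 2) ^ (-1 / 2 : ℝ) * |ξ|) := by
    have hn : 0 ≤ (1 + ξ ^ 2) ^ (-1 / 2 : ℝ) := by positivity
    simp only [hm, hd, Pi.mul_apply, norm_mul, Complex.norm_real, Complex.norm_I,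
      Complex.norm_ofNat, Real.norm_eq_abs, sq_abs, abs_of_pos Real.pi_pos, abs_of_nonneg hn]
    ring
  rw [e3]
  refine mul_le_of_le_one_right (by positivity) ?_
  rw [show (-1 / 2 : ℝ) = -(1 / 2) by norm_num, Real.rpow_neg (by positivity), ← Real.sqrt_eq_rpow,
    inv_mul_le_one₀ (Real.sqrt_pos.2 (by positivity))]
  exact Real.abs_le_sqrt (by linarith)

/-- Because the symbol is even, the Bessel potential is its own transpose. Every test function is
thus written so that `J^τ` can be moved onto the distribution. -/
theorem smulLeft_fourier_symm {τ : ℝ} (φ : 𝓢(ℝ, ℂ)) :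
    𝓕 (SchwartzMap.smulLeftCLM ℂ (fun ξ : ℝ => (((1 + ‖ξ‖ ^ 2) ^ (τ / 2) : ℝ) : ℂ))
      (𝓕⁻ (SchwartzMap.fourierMultiplierCLM ℂ
        (fun ξ : ℝ => (((1 + ‖ξ‖ ^ 2) ^ (-τ / 2) : ℝ) : ℂ)) φ))) = φ := by
  have key : SchwartzMap.smulLeftCLM ℂ (fun ξ : ℝ => (((1 + ‖ξ‖ ^ 2) ^ (τ / 2) : ℝ) : ℂ))
      (𝓕⁻ (SchwartzMap.fourierMultiplierCLM ℂ
        (fun ξ : ℝ => (((1 + ‖ξ‖ ^ 2) ^ (-τ / 2) : ℝ) : ℂ)) φ)) = 𝓕⁻ φ := by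
    ext ξ
    rw [SchwartzMap.smulLeftCLM_apply_apply (bessel_symbol_temperate τ),
      SchwartzMap.fourierMultiplierCLM_apply]
    have e : ∀ (g : 𝓢(ℝ, ℂ)) (x : ℝ), (𝓕⁻ g) x = (𝓕 g) (-x) := fun g x => by
      rw [SchwartzMap.fourierInv_coe, SchwartzMap.fourier_coe]
      exact Real.fourierInv_eq_fourier_neg _ _
    rw [e, FourierTransform.fourier_fourierInv_eq,
      SchwartzMap.smulLeftCLM_apply_apply (bessel_symbol_temperate (-τ)), e, smul_smul,
      ← Complex.ofReal_mul, norm_neg, ← Real.rpow_add (by positivity)]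
    rw [show τ / 2 + -τ / 2 = 0 by ring]
    simp
  rw [key, FourierTransform.fourier_fourierInv_eq]

theorem besselL2_schwartz (σ : ℝ) (φ : 𝓢(ℝ, ℂ)) :
    besselL2 σ (ofL2 φ) = (SchwartzMap.fourierMultiplierCLM ℂ
      (fun ξ : ℝ => (((1 + ‖ξ‖ ^ 2) ^ (σ / 2) : ℝ) : ℂ)) φ).toLp 2 := by
  refine besselL2_eq ?_
  rw [ofL2_schwartz, besselPotential, Lp.toTemperedDistribution_toLp_eq,
    fourierMultiplierCLM_toTemperedDistributionCLM_eq (bessel_symbol_temperate σ)]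

/-- On test functions the duality pairing is evaluation. -/
theorem pairing_schwartz {τ : ℝ} {G : 𝓢'(ℝ, ℂ)} (hG : MemSobolev τ 2 G) (φ : 𝓢(ℝ, ℂ)) :
    pairing τ G (ofL2 φ) = G φ := by
  conv_rhs => rw [← smulLeft_fourier_symm (τ := τ) φ]
  rw [← fourierMultiplierCLM_apply_apply, ← besselPotential, besselL2_spec hG,
    Lp.toTemperedDistribution_apply, pairing, besselL2_schwartz]
  refine integral_congr_ae ?_
  filter_upwards [SchwartzMap.coeFn_toLp (SchwartzMap.fourierMultiplierCLM ℂ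
      (fun ξ : ℝ => (((1 + ‖ξ‖ ^ 2) ^ (-τ / 2) : ℝ) : ℂ)) φ) 2 volume] with x hx
  rw [hx, smul_eq_mul, mul_comm]

theorem tendsto_pairing {ι : Type*} {l : Filter ι} {σ : ℝ} {G : ι → 𝓢'(ℝ, ℂ)} {G₀ : 𝓢'(ℝ, ℂ)}
    {q : ι → 𝓢'(ℝ, ℂ)} {q₀ : 𝓢'(ℝ, ℂ)}
    (hG : Tendsto (fun i => besselL2 σ (G i)) l (𝓝 (besselL2 σ G₀)))
    (hq : Tendsto (fun i => besselL2 (-σ) (q i)) l (𝓝 (besselL2 (-σ) q₀))) :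
    Tendsto (fun i => pairing σ (G i) (q i)) l (𝓝 (pairing σ G₀ q₀)) := by
  obtain ⟨B, e⟩ : ∃ B : L2 →L[ℂ] L2 →L[ℂ] ℂ, ∀ u v : L2, B u v = ∫ x, u x * v x :=
    ⟨ContinuousLinearMap.lpPairing (volume : Measure ℝ) 2 2 (ContinuousLinearMap.mul ℂ ℂ),
      fun u v => ContinuousLinearMap.lpPairing_eq_integral _ u v⟩
  unfold pairing
  simp only [← e]
  have hB : Continuous fun p : L2 × L2 => B p.1 p.2 := B.isBoundedBilinearMap.continuous
  have h1 := (hB.tendsto (besselL2 σ G₀, besselL2 (-σ) q₀)).comp (hG.prodMk_nhds hq)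
  exact h1

theorem tendsto_besselL2 {ι : Type*} {l : Filter ι} {σ : ℝ} {f : ι → ℝ → ℂ} {f₀ : ℝ → ℂ}
    (hf : ∀ i, sob σ (f i) < ⊤) (hf₀ : sob σ f₀ < ⊤)
    (h : Tendsto (fun i => sob σ (f i - f₀)) l (𝓝 0)) :
    Tendsto (fun i => besselL2 σ (ofL2 (f i))) l (𝓝 (besselL2 σ (ofL2 f₀))) := by
  rw [tendsto_iff_edist_tendsto_0]
  refine tendsto_of_tendsto_sq (h.congr fun i => ?_)
  rw [edist_eq_enorm_sub, ← norm_besselL2_sub σ (memSobolev_and_enorm_besselL2 (hf i)).1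
    (memSobolev_and_enorm_besselL2 hf₀).1, ← ofL2_sub (memLp_of_sob_lt_top (hf i))
    (memLp_of_sob_lt_top hf₀)]
  refine ((memSobolev_and_enorm_besselL2 ?_).2).symm
  exact (sob_sub_le σ _ _).trans_lt (two_mul_add_lt_top (hf i) hf₀)

/-- `(1 + f) · f' = (f + f² / 2)'`. -/
theorem pairing_deriv {s : ℝ} (hs : 1 / 2 < s) {f : ℝ → ℂ} (hf : sob s f < ⊤) (φ : 𝓢(ℝ, ℂ)) :
    sob s ((φ : ℝ → ℂ) + f * φ) < ⊤ ∧
    pairing (s - 1) (dx (ofL2 f)) (ofL2 ((φ : ℝ → ℂ) + f * φ)) =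
      dx (ofL2 (f + (1 / 2 : ℂ) • (f * f))) φ := by
  have h0 : 0 ≤ s := by linarith
  obtain ⟨g, hg⟩ := exists_schwartz_tendsto hf
  have hφ := sob_schwartz_lt_top s φ
  have hfφ := sob_mul_lt_top hs h0 le_rfl hf hφ
  have hff := sob_mul_lt_top hs h0 le_rfl hf hf
  have hq : sob s ((φ : ℝ → ℂ) + f * φ) < ⊤ :=
    (sob_add_le s _ _).trans_lt (two_mul_add_lt_top hφ hfφ)
  have hE : sob s (f + (1 / 2 : ℂ) • (f * f)) < ⊤ :=
    (sob_add_le s _ _).trans_lt (two_mul_add_lt_top hf (sob_smul_lt_top _ hff))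
  refine ⟨hq, ?_⟩
  have hG : Tendsto (fun n => besselL2 (s - 1) (dx (ofL2 (g n)))) atTop
      (𝓝 (besselL2 (s - 1) (dx (ofL2 f)))) := by
    have hb := tendsto_besselL2 (fun n => sob_schwartz_lt_top s (g n)) hf hg
    rw [tendsto_iff_norm_sub_tendsto_zero] at hb ⊢
    refine squeeze_zero (fun _ => norm_nonneg _) (fun n => ?_)
      (by simpa using hb.const_mul (2 * Real.pi))
    have m1 := (memSobolev_and_enorm_besselL2 (sob_schwartz_lt_top s (g n))).1
    have m2 := (memSobolev_and_enorm_besselL2 hf).1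
    rw [← norm_besselL2_sub _ (Hs.memSobolev_dx m1) (Hs.memSobolev_dx m2), ← map_sub,
      ← norm_besselL2_sub _ m1 m2]
    exact norm_besselL2_dx_le (m1.sub m2)
  have hgφ : Tendsto (fun n => sob s ((g n : ℝ → ℂ) * φ - f * φ)) atTop (𝓝 0) :=
    tendsto_sob_mul hs h0 le_rfl hf hφ hg (g := fun _ => (φ : ℝ → ℂ)) (by simp [sob_zero_fun])
  have hgg : Tendsto (fun n => sob s ((g n : ℝ → ℂ) * g n - f * f)) atTop (𝓝 0) :=
    tendsto_sob_mul hs h0 le_rfl hf hf hg hg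
  have hqn : Tendsto (fun n => besselL2 (-(s - 1)) (ofL2 ((φ + schwartzMul (g n) φ : 𝓢(ℝ, ℂ))
      : ℝ → ℂ))) atTop (𝓝 (besselL2 (-(s - 1)) (ofL2 ((φ : ℝ → ℂ) + f * φ)))) := by
    refine tendsto_besselL2 (fun n => sob_schwartz_lt_top _ _)
      -- Here `s > 1/2` gives `1 - s ≤ s`: the product with a test function, of order `s`, lies in
      -- the dual of `H^(s-1)`.
      ((sob_mono (by linarith) _).trans_lt hq) (tendsto_sob_mono (τ := s) (by linarith) ?_)
    refine hgφ.congr fun n => congrArg (sob s) (funext fun x => ?_)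
    show g n x * φ x - f x * φ x = (φ x + schwartzMul (g n) φ x) - (φ x + f x * φ x)
    rw [congrFun (schwartzMul_coe (g n) φ) x, Pi.mul_apply]
    ring
  refine tendsto_nhds_unique (tendsto_pairing hG hqn) ?_
  have hEn : Tendsto (fun n => ofL2 ((g n + (1 / 2 : ℂ) • schwartzMul (g n) (g n) : 𝓢(ℝ, ℂ))
      : ℝ → ℂ) (-SchwartzMap.derivCLM ℂ ℂ φ)) atTop
      (𝓝 (ofL2 (f + (1 / 2 : ℂ) • (f * f)) (-SchwartzMap.derivCLM ℂ ℂ φ))) := by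
    refine tendsto_ofL2_apply (Eventually.of_forall fun n => memLp_schwartz _)
      (memLp_of_sob_lt_top hE) (tendsto_sob_mono h0 ?_) _
    have hl : Tendsto (fun n => 2 * sob s ((g n : ℝ → ℂ) - f) +
        2 * (‖(1 / 2 : ℂ)‖ₑ ^ 2 * sob s ((g n : ℝ → ℂ) * g n - f * f))) atTop (𝓝 0) := by
      have a1 := ENNReal.Tendsto.const_mul (a := 2) hg (Or.inr (by norm_num))
      have a2 := ENNReal.Tendsto.const_mul (a := 2) (ENNReal.Tendsto.const_mul
        (a := ‖(1 / 2 : ℂ)‖ₑ ^ 2) hgg (Or.inr (by finiteness))) (Or.inr (by norm_num))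
      simpa using a1.add a2
    refine tendsto_of_tendsto_of_tendsto_of_le_of_le tendsto_const_nhds hl (fun _ => zero_le)
      fun n => ?_
    have m : MemLp ((g n : ℝ → ℂ) * (g n : ℝ → ℂ) - f * f) 2 (volume : Measure ℝ) := by
      rw [← schwartzMul_coe]
      exact (memLp_schwartz _).sub (memLp_of_sob_lt_top hff)
    rw [← sob_smul s m]
    refine le_trans (le_of_eq (congrArg (sob s) (funext fun x => ?_))) (sob_add_le s _ _)
    show (g n x + (1 / 2 : ℂ) * schwartzMul (g n) (g n) x) - (f x + (1 / 2 : ℂ) * (f x * f x)) =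
      (g n x - f x) + (1 / 2 : ℂ) * (g n x * g n x - f x * f x)
    rw [congrFun (schwartzMul_coe (g n) (g n)) x, Pi.mul_apply]
    ring
  rw [← derivCLM_apply_apply] at hEn
  refine hEn.congr fun n => ?_
  -- For Schwartz functions the pairing is an integral and the claim is the product rule.
  have m1 := (memSobolev_and_enorm_besselL2 (sob_schwartz_lt_top s (g n))).1
  rw [pairing_schwartz (Hs.memSobolev_dx m1), (schwartz_hasWeakDeriv (g n)).eq,
    ← derivCLM_apply_apply, (schwartz_hasWeakDeriv _).eq, ofL2_apply (memLp_schwartz _),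
    ofL2_apply (memLp_schwartz _)]
  refine integral_congr_ae (Eventually.of_forall fun x => ?_)
  have d1 := schwartz_hasDerivAt (g n + (1 / 2 : ℂ) • schwartzMul (g n) (g n)) x
  have d2 := schwartz_hasDerivAt (g n) x
  have d3 : HasDerivAt ((g n + (1 / 2 : ℂ) • schwartzMul (g n) (g n) : 𝓢(ℝ, ℂ)) : ℝ → ℂ)
      (schwartzDeriv (g n) x + (1 / 2 : ℂ) * (schwartzDeriv (g n) x * g n x +
        g n x * schwartzDeriv (g n) x)) x := by
    refine (d2.add ((d2.mul d2).const_mul (1 / 2 : ℂ))).congr_of_eventuallyEq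
      (Eventually.of_forall fun y => ?_)
    show g n y + (1 / 2 : ℂ) * schwartzMul (g n) (g n) y = g n y + (1 / 2 : ℂ) * (g n y * g n y)
    rw [congrFun (schwartzMul_coe (g n) (g n)) y, Pi.mul_apply]
  have d4 : (φ + schwartzMul (g n) φ) x = φ x + g n x * φ x := by
    rw [_root_.add_apply, congrFun (schwartzMul_coe (g n) φ) x, Pi.mul_apply]
  show φ x * schwartzDeriv _ x = (φ + schwartzMul (g n) φ) x * schwartzDeriv (g n) x
  rw [d1.unique d3, d4]
  ring

section

open Hs

variable {s : ℝ} [hs : Fact (1 / 2 < s)]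

theorem height_eq (η : Hs s) (x : ℝ) : height η x = 1 + rep η x := rfl

theorem isPert_height (η : Hs s) : IsPert s (height η) := ⟨η, height_eq η⟩

theorem rep_der (w : Hs (s + 1)) (x : ℝ) : rep (der w) x = fn (dx w.toDist) x := by
  rw [rep, der, toDist_dL]

/-- The density `(h² - 1) / 2`. -/
def heightSq (η : Hs s) : Hs s := η + (1 / 2 : ℝ) • mul η η

theorem rep_heightSq (η : Hs s) (x : ℝ) : rep (heightSq η) x = (height η x ^ 2 - 1) / 2 := by
  rw [heightSq, rep_add, rep_smul, rep_mul, height_eq]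
  ring

/-- The product `h hₓ` is `∂ₓ (h² - 1) / 2`. -/
theorem isProduct_iff (η : Hs s) (P : 𝓢'(ℝ, ℂ)) :
    IsProduct (s - 1) (height η) (dx η.toDist) P ↔ P = dx (heightSq η).toDist := by
  have e : ∀ φ : 𝓢(ℝ, ℂ), (fun x => (height η x : ℂ) * φ x) = (φ : ℝ → ℂ) + crep η * φ :=
    fun φ => funext fun x => by
      show (height η x : ℂ) * φ x = φ x + crep η x * φ x
      rw [height_eq]
      push_cast
      ring
  have e2 : ofL2 (crep η + (1 / 2 : ℂ) • (crep η * crep η)) = (heightSq η).toDist := by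
    rw [← ofL2_crep]
    refine congrArg ofL2 (funext fun x => ?_)
    show (rep η x : ℂ) + 1 / 2 * (rep η x * rep η x) = rep (heightSq η) x
    rw [rep_heightSq, height_eq]
    push_cast
    ring
  have h := pairing_deriv hs.out (sob_crep_lt_top η)
  rw [e2, ofL2_crep] at h
  constructor
  · rintro ⟨-, hP⟩
    ext φ
    rw [(hP φ).2.2, e, (h φ).2]
  · rintro rfl
    refine ⟨memSobolev_dx η.memSobolev, fun φ => ?_⟩
    rw [e]
    refine ⟨memLp_of_sob_lt_top (h φ).1, ?_, (h φ).2.symm⟩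
    exact (memSobolev_and_enorm_besselL2 (h φ).1).1.mono (by linarith [hs.out])

/-- The flux whose derivative is `3 h w` in the elliptic equation for the nonlocal term. -/
def nonlocalFlux (η : Hs s) (u w : Hs (s + 1)) (x : ℝ) : ℝ :=
  height η x ^ 3 * rep (der w) x + 3 * rep (heightSq η) x + 2 * (height η x ^ 3 * rep (der u) x ^ 2)

/-- With `h hₓ = ∂ₓ (h² - 1) / 2` every term except `3 h w` is an exact derivative. The equation in
`H^(s-1)` becomes a weak derivative relation between continuous functions, which can be transported
by a change of variable. -/
theorem isNonlocalTerm_iff (η : Hs s) (u w : Hs (s + 1)) :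
    IsNonlocalTerm η u w ↔
      HasWeakDeriv (cplx (nonlocalFlux η u w)) (cplx fun x => 3 * (height η x * rep w x)) := by
  obtain ⟨A, hA⟩ : ∃ A : Hs s, ∀ x, height η x ^ 3 = 1 + rep A x := (isPert_height η).pow 3
  set F1 := der w + mul A (der w) with hF1
  set F2 := mul (der u) (der u) + mul A (mul (der u) (der u)) with hF2
  set F3 := inc w + mul η (inc w) with hF3
  have r1 : (fun x => height η x ^ 3 * fn (dx w.toDist) x) = rep F1 := funext fun x => by
    rw [hF1, rep_add, rep_mul, hA x, rep_der]; ring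
  have r2 : (fun x => height η x ^ 3 * fn (dx u.toDist) x ^ 2) = rep F2 := funext fun x => by
    rw [hF2, rep_add, rep_mul, rep_mul A, rep_mul, hA x, rep_der]; ring
  have r3 : (fun x => height η x * fn w.toDist x) = rep F3 := funext fun x => by
    show height η x * rep w x = _
    rw [hF3, rep_add, rep_mul, rep_inc, height_eq]; ring
  clear_value F1 F2 F3
  have r4 : nonlocalFlux η u w = rep (F1 + (3 : ℝ) • heightSq η + (2 : ℝ) • F2) :=
    funext fun x => by
      rw [nonlocalFlux, rep_add, rep_add, rep_smul, rep_smul, ← congrFun r1 x, ← congrFun r2 x,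
        rep_der, rep_der]
  have r5 : (fun x => 3 * (height η x * rep w x)) = rep ((3 : ℝ) • F3) := funext fun x => by
    rw [rep_smul, ← congrFun r3 x, rep]
  have key : IsNonlocalTerm η u w ↔
      dx (F1 + (3 : ℝ) • heightSq η + (2 : ℝ) • F2).toDist = ((3 : ℝ) • F3).toDist := by
    have e : IsNonlocalTerm η u w ↔ (3 : ℂ) • F3.toDist - dx F1.toDist =
        (3 : ℂ) • dx (heightSq η).toDist + (2 : ℂ) • dx F2.toDist := by
      unfold IsNonlocalTerm opA
      rw [r1, r2, r3, ofReal_rep, ofReal_rep, ofReal_rep]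
      constructor
      · rintro ⟨P, hP, h⟩
        rw [h, (isProduct_iff η P).1 hP]
      · exact fun h => ⟨_, (isProduct_iff η _).2 rfl, h⟩
    have c : ∀ (r : ℝ) (F : Hs s), (r • F).toDist = (r : ℂ) • F.toDist := fun r F => by
      rw [map_smul]; ext φ; simp
    rw [e, c, map_add, map_add, map_add, map_add, c, c, map_smul, map_smul]
    push_cast
    constructor
    · intro h
      rw [sub_eq_iff_eq_add] at h
      rw [h]
      abel
    · intro h
      rw [← h]
      abel
  rw [key]
  have r4' : cplx (nonlocalFlux η u w) = crep (F1 + (3 : ℝ) • heightSq η + (2 : ℝ) • F2) := by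
    rw [r4]
  have r5' : cplx (fun x => 3 * (height η x * rep w x)) = crep ((3 : ℝ) • F3) := by rw [r5]
  rw [r4', r5', ← ofL2_crep, ← ofL2_crep]
  exact ⟨fun h => ⟨memLp_crep _, memLp_crep _, h⟩, fun h => h.eq⟩

end

/-! ### Time derivatives -/

section

open Hs

variable {s : ℝ} [hs : Fact (1 / 2 < s)]

/-- Difference quotients in `H^s` converge uniformly, so they may be evaluated at a point that moves
merely continuously. -/
theorem hasDerivWithinAt_rep_sub {A : ℝ → Hs s} {A' : Hs s} {S : Set ℝ} {t : ℝ}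
    (hA : HasDerivWithinAt A A' S t) {y : ℝ → ℝ} (hy : ContinuousWithinAt y S t) :
    HasDerivWithinAt (fun τ => rep (A τ - A t) (y τ)) (rep A' (y t)) S t := by
  rw [hasDerivWithinAt_iff_tendsto_slope] at hA ⊢
  refine (tendsto_rep_of_tendsto hA (hy.mono_left (nhdsWithin_mono t sdiff_subset))).congr
    fun τ => ?_
  rw [slope, slope, vsub_eq_sub, rep_smul, sub_self, rep_zero, vsub_eq_sub, sub_zero, smul_eq_mul]

theorem hasDerivWithinAt_rep_apply {A : ℝ → Hs s} {A' : Hs s} {S : Set ℝ} {t : ℝ}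
    (hA : HasDerivWithinAt A A' S t) (x : ℝ) :
    HasDerivWithinAt (fun τ => rep (A τ) x) (rep A' x) S t := by
  have := (hasDerivWithinAt_rep_sub hA (y := fun _ => x) continuousWithinAt_const).add_const
    (rep (A t) x)
  refine this.congr (fun τ _ => ?_) ?_ <;> rw [rep_sub] <;> ring

theorem hasDerivWithinAt_rep_comp {A : ℝ → Hs s} {A' : Hs s} {S : Set ℝ} {t : ℝ}
    (hA : HasDerivWithinAt A A' S t) {y : ℝ → ℝ} {y' d : ℝ} (hy : HasDerivWithinAt y y' S t)
    (hd : HasDerivAt (rep (A t)) d (y t)) :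
    HasDerivWithinAt (fun τ => rep (A τ) (y τ)) (rep A' (y t) + d * y') S t := by
  have h1 := hasDerivWithinAt_rep_sub hA hy.continuousWithinAt
  have h2 := hd.comp_hasDerivWithinAt t hy
  have e : (fun τ => rep (A τ) (y τ)) =
      (fun τ => rep (A τ - A t) (y τ)) + (rep (A t) ∘ y) := funext fun τ => by
    show rep (A τ) (y τ) = rep (A τ - A t) (y τ) + rep (A t) (y τ)
    rw [rep_sub]; ring
  rw [e]
  exact h1.add h2

/-- Writing `φ_τ⁻¹(x) = φ_t⁻¹(x - (ψ_τ - ψ_t)(φ_τ⁻¹(x)))` leaves only the fixed map `φ_t⁻¹` to be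
differentiated. -/
theorem hasDerivWithinAt_phiInv {ψ : ℝ → Hs (s + 1)} {v : Hs (s + 1)} {S : Set ℝ} {t : ℝ}
    (h : ψ t ∈ smallDisp s) (hψ : HasDerivWithinAt ψ v S t) (x : ℝ) :
    HasDerivWithinAt (fun τ => phiInv (ψ τ) x)
      (-((jac (ψ t) (phiInv (ψ t) x))⁻¹ * rep v (phiInv (ψ t) x))) S t := by
  have hc : ContinuousWithinAt (fun τ => phiInv (ψ τ) x) S t :=
    tendsto_phiInv h hψ.continuousWithinAt x
  have h1 := (hasDerivWithinAt_rep_sub hψ hc).const_sub x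
  have e : ∀ τ, phiInv (ψ τ) x = phiInv (ψ t) (x - rep (ψ τ - ψ t) (phiInv (ψ τ) x)) := by
    intro τ
    have h2 : x - rep (ψ τ - ψ t) (phiInv (ψ τ) x) = phi (ψ t) (phiInv (ψ τ) x) := by
      have h3 : phiInv (ψ τ) x + rep (ψ τ) (phiInv (ψ τ) x) = x := phi_phiInv (ψ τ) x
      rw [phi, rep_sub]
      linarith
    rw [h2, phiInv_phi h]
  have e0 : x - rep (ψ t - ψ t) (phiInv (ψ t) x) = x := by rw [sub_self, rep_zero, sub_zero]
  have h3 := (hasDerivAt_phiInv h (x - rep (ψ t - ψ t) (phiInv (ψ t) x))).comp_hasDerivWithinAt t h1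
  rw [e0] at h3
  rw [mul_neg] at h3
  exact h3.congr (fun τ _ => e τ) (e t)

theorem exists_primitive {E : Type*} [NormedAddCommGroup E] [NormedSpace ℝ E] [CompleteSpace E]
    {T : ℝ} (hT : 0 ≤ T) {G : ℝ → E} (hG : ContinuousOn G (Icc 0 T)) :
    ∃ I : ℝ → E, I 0 = 0 ∧ ∀ t ∈ Icc 0 T, HasDerivWithinAt I (G t) (Icc 0 T) t := by
  -- Constant extension beyond the interval makes the integrand continuous on the whole line.
  set Ge : ℝ → E := fun t => G (projIcc 0 T hT t)
  have hc : Continuous Ge := hG.domRestrict.comp continuous_projIcc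
  refine ⟨fun t => ∫ τ in (0 : ℝ)..t, Ge τ, by simp, fun t ht => ?_⟩
  have := (intervalIntegral.integral_hasDerivAt_right (hc.intervalIntegrable 0 t)
    hc.stronglyMeasurable.stronglyMeasurableAtFilter hc.continuousAt).hasDerivWithinAt
    (s := Icc 0 T)
  have e : Ge t = G t := by simp only [Ge, projIcc_of_mem hT ht]
  rwa [e] at this

theorem eq_of_hasDerivWithinAt {E : Type*} [NormedAddCommGroup E] [NormedSpace ℝ E] {T : ℝ}
    {f g f' : ℝ → E} (hf : ∀ t ∈ Icc 0 T, HasDerivWithinAt f (f' t) (Icc 0 T) t)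
    (hg : ∀ t ∈ Icc 0 T, HasDerivWithinAt g (f' t) (Icc 0 T) t) (h0 : f 0 = g 0) :
    ∀ t ∈ Icc 0 T, f t = g t := by
  intro t ht
  have hd : ∀ t ∈ Icc 0 T, HasDerivWithinAt (fun t => f t - g t) 0 (Icc 0 T) t := fun t ht => by
    have := (hf t ht).sub (hg t ht)
    rw [sub_self] at this
    exact this
  have := constant_of_has_deriv_right_zero (fun t ht => (hd t ht).continuousWithinAt)
    (fun t ht => (hd t (Ico_subset_Icc_self ht)).mono_of_mem_nhdsWithin
      (Icc_mem_nhdsGE_of_mem ht)) t ht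
  simp only [h0, sub_self] at this
  exact sub_eq_zero.1 this

/-- A curve in `H^s` that is pointwise differentiable, with a continuous derivative in `H^s`, is
differentiable. -/
theorem hasDerivWithinAt_of_pointwise {T : ℝ} {F G : ℝ → Hs s} (hG : ContinuousOn G (Icc 0 T))
    (h : ∀ x, ∀ t ∈ Icc 0 T, HasDerivWithinAt (fun τ => rep (F τ) x) (rep (G t) x) (Icc 0 T) t) :
    ∀ t ∈ Icc 0 T, HasDerivWithinAt F (G t) (Icc 0 T) t := by
  intro t ht
  -- The curve agrees pointwise with `F 0` plus the primitive of `G`, hence also in `H^s`.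
  obtain ⟨I, hI0, hI⟩ := exists_primitive (ht.1.trans ht.2) hG
  have e : ∀ τ ∈ Icc 0 T, F τ = F 0 + I τ := fun τ hτ => rep_injective (funext fun x => by
    rw [rep_add]
    refine eq_of_hasDerivWithinAt (g := fun τ => rep (F 0) x + rep (I τ) x) (h x)
      (fun t ht => ?_) ?_ τ hτ
    · exact (hasDerivWithinAt_rep_apply (hI t ht) x).const_add _
    · show _ = rep (F 0) x + rep (I 0) x
      rw [hI0, rep_zero, add_zero])
  exact ((hI t ht).const_add (F 0)).congr e (e t ht)

theorem hasWeakDeriv_of_rep {A B : Hs s} (h : ∀ x, HasDerivAt (rep A) (rep B x) x) :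
    dx A.toDist = B.toDist := by
  rw [← ofL2_crep, ← ofL2_crep]
  exact (hasWeakDeriv_of_hasDerivAt (memLp_crep A) (memLp_crep B)
    fun x => (h x).ofReal_comp).eq

/-- A height with a potential that satisfies a transport equation satisfies the equation of mass
conservation. -/
theorem hasDerivWithinAt_of_potential {T : ℝ} {η Q : ℝ → Hs s} {B : ℝ → ℝ → ℝ}
    (hQ : ContinuousOn Q (Icc 0 T))
    (hB : ∀ t ∈ Icc 0 T, ∀ x, HasDerivAt (B t) (rep (η t) x) x)
    (hBt : ∀ x, ∀ t ∈ Icc 0 T, HasDerivWithinAt (fun τ => B τ x) (rep (Q t) x) (Icc 0 T) t) :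
    ∀ t ∈ Icc 0 T, HasDerivWithinAt (fun t => inclL (sub_le_self s zero_le_one) (η t))
      (dL (le_refl (s - 1)) (Q t)) (Icc 0 T) t := by
  intro t ht
  have hT := ht.1.trans ht.2
  obtain ⟨I, hI0, hI⟩ := exists_primitive hT hQ
  -- The time integral of `Q` is the increment of the potential, so its `x`-derivative is the
  -- increment of `η`. This exhibits `η` as the image under `∂ₓ` of a differentiable curve.
  have e : ∀ τ ∈ Icc 0 T, inclL (sub_le_self s zero_le_one) (η τ) =
      inclL (sub_le_self s zero_le_one) (η 0) + dL (le_refl (s - 1)) (I τ) := by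
    intro τ hτ
    have h1 : rep (I τ) = fun x => B τ x - B 0 x := funext fun x =>
      eq_of_hasDerivWithinAt (fun t ht => hasDerivWithinAt_rep_apply (hI t ht) x)
        (fun t ht => (hBt x t ht).sub_const _) (by rw [hI0, rep_zero, sub_self]) τ hτ
    have h2 : dx (I τ).toDist = (η τ - η 0).toDist := hasWeakDeriv_of_rep fun x => by
      rw [h1, rep_sub]
      exact (hB τ hτ x).sub (hB 0 ⟨le_rfl, hT⟩ x)
    refine toDist_injective ?_
    rw [map_add, toDist_inclL, toDist_inclL, toDist_dL, h2, map_sub]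
    abel
  exact (((dL (le_refl (s - 1))).hasFDerivAt.comp_hasDerivWithinAt t (hI t ht)).const_add
    (inclL (sub_le_self s zero_le_one) (η 0))).congr e (e t ht)

end

/-! ### From the Lagrangian to the Eulerian variables -/

section

open Hs

variable {s : ℝ} [hs : Fact (1 / 2 < s)]

/-- The height perturbation in Eulerian variables. -/
def eulHeight (y : Lag s) : Hs s := comp y.2.1 (relHeight y)

/-- The velocity in Eulerian variables. -/
def eulVel (y : Lag s) : Hs (s + 1) := comp y.2.1 y.2.2

/-- The nonlocal term in Eulerian variables. -/
def eulTerm (y : Lag s) : Hs (s + 1) := comp y.2.1 (lagSol y).1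

/-- The mass flux `h u`. -/
def massFlux (η : Hs s) (u : Hs (s + 1)) : Hs s := inc u + mul η (inc u)

/-- The acceleration `-(u uₓ + w)`. -/
def velRate (u w : Hs (s + 1)) : Hs s := -(mul (inc u) (der u) + inc w)

theorem rep_massFlux (η : Hs s) (u : Hs (s + 1)) (x : ℝ) :
    rep (massFlux η u) x = height η x * rep u x := by
  rw [massFlux, rep_add, rep_mul, rep_inc, height_eq]
  ring

theorem rep_velRate (u w : Hs (s + 1)) (x : ℝ) :
    rep (velRate u w) x = -(rep u x * rep (der u) x + rep w x) := by
  rw [velRate, rep_neg, rep_add, rep_mul, rep_inc, rep_inc]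

theorem smallStates_subset {y : Lag s} (hy : y ∈ smallStates s) : y ∈ lagDomain s :=
  lagDomain_of_small hy.1 hy.2.1

theorem rep_der_comp {ψ : Hs (s + 1)} (h : ψ ∈ smallDisp s) (F : Hs (s + 1)) (x : ℝ) :
    rep (der (comp ψ F)) x = rep (der F) (phiInv ψ x) * (jac ψ (phiInv ψ x))⁻¹ := by
  refine (hasDerivAt_der (comp ψ F) x).unique ?_
  have := (hasDerivAt_der F (phiInv ψ x)).comp x (hasDerivAt_phiInv h x)
  refine this.congr_of_eventuallyEq (Eventually.of_forall fun z => ?_)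
  exact rep_comp h le_rfl F z

theorem height_eulHeight {y : Lag s} (hy : y ∈ smallStates s) (x : ℝ) :
    height (eulHeight y) x =
      (1 + rep y.1 (phiInv y.2.1 x)) / jac y.2.1 (phiInv y.2.1 x) := by
  rw [height_eq, eulHeight, rep_comp hy.2.1 (by linarith), rep_relHeight (smallStates_subset hy),
    jac]

theorem eulHeight_mem_Us {y : Lag s} (hy : y ∈ smallStates s) : eulHeight y ∈ Us s := fun x => by
  rw [height_eulHeight hy]
  exact div_pos (hy.1 _) (jac_pos hy.2.1 _)

/-- The second unknown of the Lagrangian system is the Eulerian flux along the flow; `h φ_y = h₀`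
cancels the Jacobian of the chain rule. -/
theorem isNonlocalTerm_eul {y : Lag s} (hy : y ∈ smallStates s) :
    IsNonlocalTerm (eulHeight y) (eulVel y) (eulTerm y) := by
  have hL := lagSol_eq (smallStates_subset hy)
  have hk : nonlocalFlux (eulHeight y) (eulVel y) (eulTerm y) =
      rep (comp y.2.1 (lagSol y).2) := funext fun x => by
    rw [nonlocalFlux, rep_heightSq, height_eulHeight hy, eulVel, eulTerm, rep_der_comp hy.2.1,
      rep_der_comp hy.2.1, rep_comp hy.2.1 le_rfl, (hL _).1, lagCoeff,
      rep_lagFlux (smallStates_subset hy), ← jac]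
    ring
  have hk' : (fun x => 3 * (height (eulHeight y) x * rep (eulTerm y) x)) =
      rep (der (comp y.2.1 (lagSol y).2)) := funext fun x => by
    rw [height_eulHeight hy, eulTerm, rep_comp hy.2.1 le_rfl, rep_der_comp hy.2.1, (hL _).2]
    ring
  rw [isNonlocalTerm_iff, hk, hk']
  exact hasWeakDeriv_der _

theorem phiInv_zero (x : ℝ) : phiInv (0 : Hs (s + 1)) x = x := by
  have := phi_phiInv (0 : Hs (s + 1)) x
  rwa [phi, rep_zero, add_zero] at this

theorem eul_initial {η₀ : Hs s} {u₀ : Hs (s + 1)} (h : ((η₀, 0, u₀) : Lag s) ∈ smallStates s) :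
    eulHeight ((η₀, 0, u₀) : Lag s) = η₀ ∧ eulVel ((η₀, 0, u₀) : Lag s) = u₀ := by
  constructor
  · refine rep_injective (funext fun x => ?_)
    have := height_eulHeight h x
    rw [phiInv_zero, height_eq, jac, map_zero, rep_zero, add_zero, div_one] at this
    exact add_left_cancel this
  · refine rep_injective (funext fun x => ?_)
    rw [eulVel, rep_comp h.2.1 le_rfl, phiInv_zero]

variable {ι : Type*} {l : Filter ι} [l.IsCountablyGenerated]

theorem tendsto_relHeight {y : ι → Lag s} {y₀ : Lag s} (h : y₀ ∈ smallStates s)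
    (hy : Tendsto y l (𝓝 y₀)) : Tendsto (fun i => relHeight (y i)) l (𝓝 (relHeight y₀)) := by
  have h1 : Tendsto (fun i => (y i).1) l (𝓝 y₀.1) := (continuous_fst.tendsto _).comp hy
  have h2 : Tendsto (fun i => der (y i).2.1) l (𝓝 (der y₀.2.1)) :=
    ((der.continuous.comp (continuous_fst.comp continuous_snd)).tendsto _).comp hy
  have hu := (isMulOp_invJac (s := s) (ψ := y₀.2.1) (jac_pos h.2.1)).1
  obtain ⟨U, hU⟩ := hu
  have h3 : Tendsto (fun i => (1 + mul (der (y i).2.1) : Hs s →L[ℝ] Hs s)) l (𝓝 ↑U) := by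
    rw [hU]
    exact ((mul.continuous.tendsto _).comp h2).const_add 1
  have h4 : Tendsto (fun i => invJac (y i).2.1) l (𝓝 (invJac y₀.2.1)) := by
    have := (NormedRing.inverse_continuousAt U).tendsto.comp h3
    rw [hU] at this
    exact this
  have hB : Continuous fun p : (Hs s →L[ℝ] Hs s) × Hs s => p.1 p.2 :=
    isBoundedBilinearMap_apply.continuous
  exact (hB.tendsto (invJac y₀.2.1, y₀.1 - der y₀.2.1)).comp (h4.prodMk_nhds (h1.sub h2))

theorem tendsto_eul {y : ι → Lag s} {y₀ : Lag s} (h : y₀ ∈ smallStates s)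
    (hy : Tendsto y l (𝓝 y₀)) :
    Tendsto (fun i => eulHeight (y i)) l (𝓝 (eulHeight y₀)) ∧
      Tendsto (fun i => eulVel (y i)) l (𝓝 (eulVel y₀)) ∧
      Tendsto (fun i => eulTerm (y i)) l (𝓝 (eulTerm y₀)) := by
  have h1 : Tendsto (fun i => (y i).2.1) l (𝓝 y₀.2.1) :=
    ((continuous_fst.comp continuous_snd).tendsto _).comp hy
  have h2 : Tendsto (fun i => (y i).2.2) l (𝓝 y₀.2.2) :=
    ((continuous_snd.comp continuous_snd).tendsto _).comp hy
  have h3 : Tendsto (fun i => (lagSol (y i)).1) l (𝓝 (lagSol y₀).1) :=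
    (continuous_fst.tendsto _).comp
      ((contDiffAt_lagField (smallStates_subset h)).2.continuousAt.tendsto.comp hy)
  exact ⟨tendsto_comp_Hs h.2.1 (by linarith) h1 (tendsto_relHeight h hy),
    tendsto_comp_Hs h.2.1 le_rfl h1 h2, tendsto_comp_Hs h.2.1 le_rfl h1 h3⟩

theorem tendsto_bilin {E F G : Type*} [NormedAddCommGroup E] [NormedSpace ℝ E]
    [NormedAddCommGroup F] [NormedSpace ℝ F] [NormedAddCommGroup G] [NormedSpace ℝ G]
    (B : E →L[ℝ] F →L[ℝ] G) {e : ι → E} {e₀ : E} {f : ι → F} {f₀ : F} (he : Tendsto e l (𝓝 e₀))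
    (hf : Tendsto f l (𝓝 f₀)) : Tendsto (fun i => B (e i) (f i)) l (𝓝 (B e₀ f₀)) := by
  have hB : Continuous fun p : E × F => B p.1 p.2 := B.isBoundedBilinearMap.continuous
  exact (hB.tendsto (e₀, f₀)).comp (he.prodMk_nhds hf)

theorem tendsto_clm {E F : Type*} [NormedAddCommGroup E] [NormedSpace ℝ E]
    [NormedAddCommGroup F] [NormedSpace ℝ F] (L : E →L[ℝ] F) {e : ι → E} {e₀ : E}
    (he : Tendsto e l (𝓝 e₀)) : Tendsto (fun i => L (e i)) l (𝓝 (L e₀)) :=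
  (L.continuous.tendsto e₀).comp he

theorem tendsto_massFlux {η : ι → Hs s} {η₀ : Hs s} {u : ι → Hs (s + 1)} {u₀ : Hs (s + 1)}
    (hη : Tendsto η l (𝓝 η₀)) (hu : Tendsto u l (𝓝 u₀)) :
    Tendsto (fun i => massFlux (η i) (u i)) l (𝓝 (massFlux η₀ u₀)) := by
  unfold massFlux
  exact (tendsto_clm inc hu).add (tendsto_bilin mul hη (tendsto_clm inc hu))

theorem tendsto_velRate {u w : ι → Hs (s + 1)} {u₀ w₀ : Hs (s + 1)}
    (hu : Tendsto u l (𝓝 u₀)) (hw : Tendsto w l (𝓝 w₀)) :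
    Tendsto (fun i => velRate (u i) (w i)) l (𝓝 (velRate u₀ w₀)) := by
  unfold velRate
  exact ((tendsto_bilin mul (tendsto_clm inc hu) (tendsto_clm der hu)).add
    (tendsto_clm inc hw)).neg

end

/-! ### Existence and continuous dependence -/

section

open Hs

variable {s : ℝ} [hs : Fact (1 / 2 < s)]

/-- Solutions of the system in Lagrangian coordinates. -/
structure IsLagSolution (T : ℝ) (η₀ : Hs s) (ψ v : ℝ → Hs (s + 1)) : Prop where
  mem : ∀ t ∈ Icc 0 T, ((η₀, ψ t, v t) : Lag s) ∈ smallStates s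
  disp : ∀ t ∈ Icc 0 T, HasDerivWithinAt ψ (v t) (Icc 0 T) t
  vel : ∀ t ∈ Icc 0 T, HasDerivWithinAt v (-(lagSol ((η₀, ψ t, v t) : Lag s)).1) (Icc 0 T) t

variable {T : ℝ} {η₀ : Hs s} {ψ v : ℝ → Hs (s + 1)}

theorem IsLagSolution.tendsto_eul (h : IsLagSolution T η₀ ψ v) {t : ℝ} (ht : t ∈ Icc 0 T) :
    Tendsto (fun t => eulHeight ((η₀, ψ t, v t) : Lag s)) (𝓝[Icc 0 T] t)
        (𝓝 (eulHeight ((η₀, ψ t, v t) : Lag s))) ∧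
      Tendsto (fun t => eulVel ((η₀, ψ t, v t) : Lag s)) (𝓝[Icc 0 T] t)
        (𝓝 (eulVel ((η₀, ψ t, v t) : Lag s))) ∧
      Tendsto (fun t => eulTerm ((η₀, ψ t, v t) : Lag s)) (𝓝[Icc 0 T] t)
        (𝓝 (eulTerm ((η₀, ψ t, v t) : Lag s))) :=
  GreenNaghdi.tendsto_eul (h.mem t ht) (tendsto_const_nhds.prodMk_nhds
    ((h.disp t ht).continuousWithinAt.tendsto.prodMk_nhds (h.vel t ht).continuousWithinAt.tendsto))

/-- At fixed `x` the velocity is `v(t, φ⁻¹(x))`, and the chain rule produces `-w - u uₓ`. This rate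
is continuous in `H^s`, which upgrades the pointwise derivative. -/
theorem IsLagSolution.hasDerivWithinAt_vel (h : IsLagSolution T η₀ ψ v) :
    ∀ t ∈ Icc 0 T, HasDerivWithinAt (fun t => inc (eulVel ((η₀, ψ t, v t) : Lag s)))
      (velRate (eulVel ((η₀, ψ t, v t) : Lag s)) (eulTerm ((η₀, ψ t, v t) : Lag s)))
      (Icc 0 T) t := by
  refine hasDerivWithinAt_of_pointwise (fun t ht => ?_) fun x t ht => ?_
  · exact tendsto_velRate (h.tendsto_eul ht).2.1 (h.tendsto_eul ht).2.2
  · have hs' := (h.mem t ht).2.1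
    have h1 := hasDerivWithinAt_rep_comp (h.vel t ht)
      (hasDerivWithinAt_phiInv hs' (h.disp t ht) x) (hasDerivAt_der (v t) _)
    have e : ∀ τ ∈ Icc 0 T, rep (inc (eulVel ((η₀, ψ τ, v τ) : Lag s))) x =
        rep (v τ) (phiInv (ψ τ) x) := fun τ hτ => by
      rw [rep_inc, eulVel, rep_comp (h.mem τ hτ).2.1 le_rfl]
    refine (h1.congr e (e t ht)).congr_deriv ?_
    rw [rep_velRate, eulVel, eulTerm, rep_comp hs' le_rfl, rep_comp hs' le_rfl, rep_der_comp hs',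
      rep_neg]
    ring

/-- The mass to the left of a particle is conserved, so the primitive of `h` is the initial one
composed with `φ⁻¹`. It is differentiable in `x` even when `h` is merely continuous; subtracting `x`
gives a potential of `η`. -/
theorem IsLagSolution.hasDerivWithinAt_height (h : IsLagSolution T η₀ ψ v) :
    ∀ t ∈ Icc 0 T, HasDerivWithinAt
      (fun t => inclL (sub_le_self s zero_le_one) (eulHeight ((η₀, ψ t, v t) : Lag s)))
      (dL (le_refl (s - 1)) (-massFlux (eulHeight ((η₀, ψ t, v t) : Lag s))
        (eulVel ((η₀, ψ t, v t) : Lag s)))) (Icc 0 T) t := by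
  set H : ℝ → ℝ := fun y => ∫ z in (0 : ℝ)..y, rep η₀ z with hH
  have dH : ∀ y, HasDerivAt H (rep η₀ y) y := fun y =>
    (continuous_rep η₀).integral_hasStrictDerivAt 0 y |>.hasDerivAt
  have dK : ∀ y, HasDerivAt (fun y => y + H y) (1 + rep η₀ y) y := fun y =>
    (hasDerivAt_id y).add (dH y)
  refine hasDerivWithinAt_of_potential
    (B := fun t x => (phiInv (ψ t) x + H (phiInv (ψ t) x)) - x) (fun t ht => ?_)
    (fun t ht x => ?_) fun x t ht => ?_
  · exact (tendsto_massFlux (h.tendsto_eul ht).1 (h.tendsto_eul ht).2.1).neg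
  · have hm := h.mem t ht
    refine (((dK _).comp x (hasDerivAt_phiInv hm.2.1 x)).sub (hasDerivAt_id x)).congr_deriv ?_
    have := height_eulHeight hm x
    rw [height_eq, div_eq_mul_inv] at this
    rw [← this]
    ring
  · have hm := h.mem t ht
    refine (((dK _).comp_hasDerivWithinAt t
      (hasDerivWithinAt_phiInv hm.2.1 (h.disp t ht) x)).sub_const x).congr_deriv ?_
    rw [rep_neg, rep_massFlux, height_eulHeight hm, eulVel, rep_comp hm.2.1 le_rfl]
    ring

theorem heightDeriv_eq (hT : 0 < T) {η : ℝ → Hs s} {t : ℝ} (ht : t ∈ Icc 0 T) {D : Hs (s - 1)}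
    (h : HasDerivWithinAt (fun t => inclL (sub_le_self s zero_le_one) (η t)) D (Icc 0 T) t) :
    heightDeriv T η t = D :=
  h.derivWithin (uniqueDiffOn_Icc hT t ht)

theorem velDeriv_eq (hT : 0 < T) {u : ℝ → Hs (s + 1)} {t : ℝ} (ht : t ∈ Icc 0 T) {D : Hs s}
    (h : HasDerivWithinAt (fun t => inc (u t)) D (Icc 0 T) t) : velDeriv T u t = D :=
  h.derivWithin (uniqueDiffOn_Icc hT t ht)

theorem contDiffOn_of_hasDerivWithinAt {E : Type*} [NormedAddCommGroup E] [NormedSpace ℝ E]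
    (hT : 0 < T) {f f' : ℝ → E} (h : ∀ t ∈ Icc 0 T, HasDerivWithinAt f (f' t) (Icc 0 T) t)
    (hf' : ContinuousOn f' (Icc 0 T)) : ContDiffOn ℝ 1 f (Icc 0 T) := by
  rw [contDiffOn_one_iff_derivWithin (uniqueDiffOn_Icc hT)]
  exact ⟨fun t ht => (h t ht).differentiableWithinAt,
    hf'.congr fun t ht => (h t ht).derivWithin (uniqueDiffOn_Icc hT t ht)⟩

theorem ofReal_mul_der (u : Hs (s + 1)) :
    ofReal (fun x => fn u.toDist x * fn (dx u.toDist) x) = (mul (inc u) (der u)).toDist := by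
  rw [← ofReal_rep (mul (inc u) (der u))]
  refine congrArg ofReal (funext fun x => ?_)
  rw [rep_mul, rep_inc, rep_der]
  rfl

theorem ofReal_massFlux (η : Hs s) (u : Hs (s + 1)) :
    ofReal (fun x => height η x * fn u.toDist x) = (massFlux η u).toDist := by
  rw [← ofReal_rep (massFlux η u)]
  refine congrArg ofReal (funext fun x => ?_)
  rw [rep_massFlux]
  rfl

theorem toDist_inc (u : Hs (s + 1)) : (inc u).toDist = u.toDist := toDist_inclL _ u

theorem IsLagSolution.isSolution (hT : 0 < T) (h : IsLagSolution T η₀ ψ v) {u₀ : Hs (s + 1)}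
    (hψ : ψ 0 = 0) (hv : v 0 = u₀) :
    IsSolution s T η₀ u₀ (fun t => eulHeight ((η₀, ψ t, v t) : Lag s))
      (fun t => eulVel ((η₀, ψ t, v t) : Lag s)) where
  mem_Us t ht := eulHeight_mem_Us (h.mem t ht)
  continuousOn_height t ht := (h.tendsto_eul ht).1
  continuousOn_vel t ht := (h.tendsto_eul ht).2.1
  contDiffOn_height := contDiffOn_of_hasDerivWithinAt hT h.hasDerivWithinAt_height fun t ht =>
    tendsto_clm (dL (le_refl (s - 1)))
      (tendsto_massFlux (h.tendsto_eul ht).1 (h.tendsto_eul ht).2.1).neg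
  contDiffOn_vel := contDiffOn_of_hasDerivWithinAt hT h.hasDerivWithinAt_vel fun t ht =>
    tendsto_velRate (h.tendsto_eul ht).2.1 (h.tendsto_eul ht).2.2
  momentum t ht := by
    refine ⟨_, isNonlocalTerm_eul (h.mem t ht), ?_⟩
    rw [velDeriv_eq hT ht (h.hasDerivWithinAt_vel t ht), ofReal_mul_der, ← toDist_inc (eulTerm _),
      velRate, map_neg, map_add]
    abel
  mass t ht := by
    rw [heightDeriv_eq hT ht (h.hasDerivWithinAt_height t ht), ofReal_massFlux, toDist_dL, map_neg,
      map_neg]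
    abel
  initial_height := by
    have h0 := h.mem 0 ⟨le_rfl, hT.le⟩
    rw [hψ] at h0 ⊢
    exact (eul_initial h0).1
  initial_vel := by
    have h0 := h.mem 0 ⟨le_rfl, hT.le⟩
    rw [hψ] at h0 ⊢
    rw [(eul_initial h0).2, hv]

/-- Joint continuity and compactness of the time interval give uniformity in time. -/
theorem tendstoUniformlyOn_of_continuousOn {D E : Type*} [TopologicalSpace D] [UniformSpace E]
    {V : Set D} {f : D → ℝ → E} (hf : ContinuousOn (fun q : D × ℝ => f q.1 q.2) (V ×ˢ Icc 0 T))
    {d : D} (hd : d ∈ V) : TendstoUniformlyOn f (f d) (𝓝[V] d) (Icc 0 T) := by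
  intro U hU
  obtain ⟨v, hv, h⟩ := isCompact_Icc.mem_uniformity_of_prod (f := f) hf hd (symm_le_uniformity hU)
  filter_upwards [hv] with d' hd' t ht
  exact h d' hd' t ht

theorem exists_solutions (hη₀ : η₀ ∈ Us s) (u₀ : Hs (s + 1)) :
    ∃ T > 0, ∃ V ∈ 𝓝 (η₀, u₀), V ⊆ Us s ×ˢ univ ∧
      ∃ (η : Hs s × Hs (s + 1) → ℝ → Hs s) (u : Hs s × Hs (s + 1) → ℝ → Hs (s + 1)),
        (∀ d ∈ V, IsSolution s T d.1 d.2 (η d) (u d)) ∧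
        ∀ d ∈ V, TendstoUniformlyOn η (η d) (𝓝[V] d) (Icc 0 T) ∧
          TendstoUniformlyOn u (u d) (𝓝[V] d) (Icc 0 T) ∧
          TendstoUniformlyOn (fun d' => heightDeriv T (η d')) (heightDeriv T (η d)) (𝓝[V] d)
            (Icc 0 T) ∧
          TendstoUniformlyOn (fun d' => velDeriv T (u d')) (velDeriv T (u d)) (𝓝[V] d)
            (Icc 0 T) := by
  obtain ⟨T, hT, V, hV, ψ, v, h, hψ, hv⟩ := exists_lag_flow hη₀ u₀
  have hL : ∀ d ∈ V, IsLagSolution T d.1 (ψ d) (v d) := fun d hd =>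
    ⟨fun t ht => ((h d hd).2.2.2 t ht).1, fun t ht => ((h d hd).2.2.2 t ht).2.1,
      fun t ht => ((h d hd).2.2.2 t ht).2.2⟩
  have hc : ∀ q ∈ V ×ˢ Icc 0 T, _ := fun q hq =>
    tendsto_eul (l := 𝓝[V ×ˢ Icc 0 T] q) (y := fun q => ((q.1.1, ψ q.1 q.2, v q.1 q.2) : Lag s))
      (y₀ := (q.1.1, ψ q.1 q.2, v q.1 q.2)) ((hL q.1 hq.1).mem q.2 hq.2)
      (((continuous_fst.comp continuous_fst).continuousWithinAt.tendsto).prodMk_nhds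
        ((hψ q hq).tendsto.prodMk_nhds (hv q hq).tendsto))
  have cη : ContinuousOn (fun q : (Hs s × Hs (s + 1)) × ℝ =>
      eulHeight ((q.1.1, ψ q.1 q.2, v q.1 q.2) : Lag s)) (V ×ˢ Icc 0 T) := fun q hq => (hc q hq).1
  have cu : ContinuousOn (fun q : (Hs s × Hs (s + 1)) × ℝ =>
      eulVel ((q.1.1, ψ q.1 q.2, v q.1 q.2) : Lag s)) (V ×ˢ Icc 0 T) := fun q hq => (hc q hq).2.1
  refine ⟨T, hT, V, hV, fun d hd => ⟨(h d hd).1.1, mem_univ _⟩,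
    fun d t => eulHeight ((d.1, ψ d t, v d t) : Lag s),
    fun d t => eulVel ((d.1, ψ d t, v d t) : Lag s),
    fun d hd => (hL d hd).isSolution hT (h d hd).2.1 (h d hd).2.2.1, fun d hd =>
    ⟨tendstoUniformlyOn_of_continuousOn cη hd, tendstoUniformlyOn_of_continuousOn cu hd,
      tendstoUniformlyOn_of_continuousOn ?_ hd, tendstoUniformlyOn_of_continuousOn ?_ hd⟩⟩
  · refine ContinuousOn.congr (f := fun q : (Hs s × Hs (s + 1)) × ℝ => dL (le_refl (s - 1))
      (-massFlux (eulHeight ((q.1.1, ψ q.1 q.2, v q.1 q.2) : Lag s))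
        (eulVel ((q.1.1, ψ q.1 q.2, v q.1 q.2) : Lag s)))) (fun q hq => ?_) fun q hq =>
      heightDeriv_eq hT hq.2 ((hL q.1 hq.1).hasDerivWithinAt_height q.2 hq.2)
    exact tendsto_clm (dL (le_refl (s - 1))) (tendsto_massFlux (hc q hq).1 (hc q hq).2.1).neg
  · refine ContinuousOn.congr (f := fun q : (Hs s × Hs (s + 1)) × ℝ =>
      velRate (eulVel ((q.1.1, ψ q.1 q.2, v q.1 q.2) : Lag s))
        (eulTerm ((q.1.1, ψ q.1 q.2, v q.1 q.2) : Lag s))) (fun q hq => ?_) fun q hq =>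
      velDeriv_eq hT hq.2 ((hL q.1 hq.1).hasDerivWithinAt_vel q.2 hq.2)
    exact tendsto_velRate (hc q hq).2.1 (hc q hq).2.2

end

/-! ### Uniqueness in mass coordinates -/

/-- A maximum principle for `K' = 3 D`, `a D' = K - g`. -/
theorem le_of_elliptic {K D d a g : ℝ → ℝ} {G : ℝ} (hK : ∀ y, HasDerivAt K (3 * D y) y)
    (hD : ∀ y, HasDerivAt D (d y) y) (ha : ∀ y, 0 < a y) (h : ∀ y, a y * d y = K y - g y)
    (hg : ∀ y, g y ≤ G) (hG : 0 ≤ G) (hlim : Tendsto K (cocompact ℝ) (𝓝 0)) (y : ℝ) : K y ≤ G := by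
  by_contra! hy
  have hc : Continuous K := continuous_iff_continuousAt.2 fun y => (hK y).continuousAt
  -- If `K` exceeded `G ≥ 0` somewhere, then, vanishing at infinity, it would attain its maximum.
  obtain ⟨x, hx⟩ := hc.exists_forall_ge' y
    ((hlim.eventually (gt_mem_nhds (hG.trans_lt hy))).mono fun _ h => h.le)
  have hmax : IsLocalMax K x := Eventually.of_forall hx
  have hDx : D x = 0 := by
    have := hmax.hasDerivAt_eq_zero (hK x)
    linarith
  have hd : 0 < d x := by
    have h1 : 0 < a x * d x := by rw [h]; linarith [hx y, hg x]
    exact (pos_iff_pos_of_mul_pos h1).1 (ha x)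
  have e1 : deriv K = fun y => 3 * D y := funext fun y => (hK y).deriv
  have e2 : deriv (deriv K) x = 3 * d x := by rw [e1]; exact ((hD x).const_mul 3).deriv
  -- At the maximum `D = 0` and `K'' = 3 d > 0`, so the point is also a local minimum; then `K` is
  -- locally constant, contradicting `K'' > 0`.
  have hmin := isLocalMin_of_deriv_deriv_pos (f := K) (x₀ := x) (by rw [e2]; linarith)
    (by simp only [e1, hDx, mul_zero]) (hK x).continuousAt
  have hconst : K =ᶠ[𝓝 x] fun _ => K x := by
    filter_upwards [hmax, hmin] with z h1 h2 using le_antisymm h1 h2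
  have h0 : deriv K =ᶠ[𝓝 x] fun _ => 0 := by
    filter_upwards [hconst.eventuallyEq_nhds] with z hz
    rw [hz.deriv_eq, deriv_const]
  have := h0.deriv_eq
  rw [e2, deriv_const] at this
  linarith

/-- The maximum principle for `K` and `-K` gives `|K| ≤ G`, and `a d = K - g`. -/
theorem abs_le_of_elliptic {K D d a g : ℝ → ℝ} {G : ℝ} (hK : ∀ y, HasDerivAt K (3 * D y) y)
    (hD : ∀ y, HasDerivAt D (d y) y) (ha : ∀ y, 0 < a y) (h : ∀ y, a y * d y = K y - g y)
    (hg : ∀ y, |g y| ≤ G) (hlim : Tendsto K (cocompact ℝ) (𝓝 0)) (y : ℝ) :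
    |d y| ≤ 2 * G / a y := by
  have hG : 0 ≤ G := (abs_nonneg _).trans (hg 0)
  have h1 := le_of_elliptic hK hD ha h (fun y => (abs_le.1 (hg y)).2) hG hlim y
  have h2 := le_of_elliptic (K := fun y => -K y) (D := fun y => -D y) (d := fun y => -d y)
    (g := fun y => -g y) (a := a) (fun y => ((hK y).neg).congr_deriv (by ring))
    (fun y => (hD y).neg) ha (fun y => by rw [mul_neg, h]; ring)
    (fun y => by linarith [(abs_le.1 (hg y)).1]) hG (by simpa using hlim.neg) y
  have h3 := abs_le.1 (hg y)
  rw [le_div_iff₀ (ha y), mul_comm]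
  nth_rw 1 [← abs_of_pos (ha y)]
  rw [← abs_mul, h, abs_le]
  constructor <;> linarith

/-- The flux in mass coordinates, as a function of `X_m`, `v_m` and `W_m`. -/
def massElliptic (x : ℝ × ℝ × ℝ) : ℝ :=
  (x.1⁻¹) ^ 4 * x.2.2 + 3 / 2 * ((x.1⁻¹) ^ 2 - 1) + 2 * (x.1⁻¹) ^ 5 * x.2.1 ^ 2

theorem exists_lipschitz_massElliptic {c : ℝ} (hc : 0 < c) (M : ℝ) :
    ∃ L : NNReal, LipschitzOnWith L massElliptic (Icc c M ×ˢ (Icc (-M) M ×ˢ Icc (-M) M)) := by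
  refine ContDiffOn.exists_lipschitzOnWith (n := 1) ?_ one_ne_zero
    ((convex_Icc _ _).prod ((convex_Icc _ _).prod (convex_Icc _ _)))
    (isCompact_Icc.prod (isCompact_Icc.prod isCompact_Icc))
  intro x hx
  have hx0 : x.1 ≠ 0 := (hc.trans_le hx.1.1).ne'
  have hi : ContDiffAt ℝ 1 (fun x : ℝ × ℝ × ℝ => x.1⁻¹) x := contDiffAt_fst.inv hx0
  have h1 : ContDiffAt ℝ 1 (fun x : ℝ × ℝ × ℝ => x.2.1) x := contDiffAt_snd.fst
  have h2 : ContDiffAt ℝ 1 (fun x : ℝ × ℝ × ℝ => x.2.2) x := contDiffAt_snd.snd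
  exact ((((hi.pow 4).mul h2).add (contDiffAt_const.mul ((hi.pow 2).sub contDiffAt_const))).add
    ((contDiffAt_const.mul (hi.pow 5)).mul (h1.pow 2))).contDiffWithinAt

/-- The Green-Naghdi system in mass coordinates: `X` is the position, `v` the velocity and `W` the
nonlocal term, and `p`, `z`, `q` are their derivatives. -/
structure IsMassSolution (T c M : ℝ) (X v W p z q : ℝ → ℝ → ℝ) : Prop where
  deriv_X : ∀ t ∈ Icc 0 T, ∀ m, HasDerivAt (X t) (p t m) m
  deriv_v : ∀ t ∈ Icc 0 T, ∀ m, HasDerivAt (v t) (z t m) m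
  deriv_W : ∀ t ∈ Icc 0 T, ∀ m, HasDerivAt (W t) (q t m) m
  time_X : ∀ t ∈ Icc 0 T, ∀ m, HasDerivWithinAt (fun τ => X τ m) (v t m) (Icc 0 T) t
  time_v : ∀ t ∈ Icc 0 T, ∀ m, HasDerivWithinAt (fun τ => v τ m) (-W t m) (Icc 0 T) t
  elliptic : ∀ t ∈ Icc 0 T, ∀ m,
    HasDerivAt (fun m => massElliptic (p t m, z t m, q t m)) (3 * W t m) m
  lim_flux : ∀ t ∈ Icc 0 T,
    Tendsto (fun m => massElliptic (p t m, z t m, q t m)) (cocompact ℝ) (𝓝 0)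
  lim_v : ∀ t ∈ Icc 0 T, Tendsto (v t) (cocompact ℝ) (𝓝 0)
  mem_p : ∀ t ∈ Icc 0 T, ∀ m, p t m ∈ Icc c M
  mem_z : ∀ t ∈ Icc 0 T, ∀ m, z t m ∈ Icc (-M) M
  mem_q : ∀ t ∈ Icc 0 T, ∀ m, q t m ∈ Icc (-M) M

/-- An exponential bound on the `m`-derivative of the time derivative is inherited. -/
theorem deriv_bound_of_time {T lam B : ℝ} (hl : 0 < lam) (hB : 0 ≤ B) {f g df dg : ℝ → ℝ → ℝ}
    (hf : ∀ t ∈ Icc 0 T, ∀ m, HasDerivAt (f t) (df t m) m)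
    (hg : ∀ t ∈ Icc 0 T, ∀ m, HasDerivAt (g t) (dg t m) m)
    (ht : ∀ t ∈ Icc 0 T, ∀ m, HasDerivWithinAt (fun τ => f τ m) (g t m) (Icc 0 T) t)
    (h0 : ∀ m, f 0 m = 0) (h : ∀ t ∈ Icc 0 T, ∀ m, |dg t m| ≤ B * Real.exp (lam * t)) :
    ∀ t ∈ Icc 0 T, ∀ m, |df t m| ≤ B / lam * Real.exp (lam * t) := by
  intro t htT m
  -- Mixed derivatives are never interchanged: Lipschitz bounds in `m` are integrated in time, and
  -- the resulting Lipschitz constant bounds the derivative.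
  have lip : ∀ t ∈ Icc 0 T, ∀ a b, |g t a - g t b| ≤ B * Real.exp (lam * t) * |a - b| := by
    intro t ht a b
    exact convex_univ.norm_image_sub_le_of_norm_hasDerivWithin_le
      (fun x _ => (hg t ht x).hasDerivWithinAt) (fun x _ => h t ht x) (mem_univ b) (mem_univ a)
  have key : ∀ a b, |f t a - f t b| ≤ B / lam * Real.exp (lam * t) * |a - b| := by
    intro a b
    have hder : ∀ τ ∈ Icc 0 T, HasDerivWithinAt (fun τ => f τ a - f τ b) (g τ a - g τ b)
        (Icc 0 T) τ := fun τ hτ => (ht τ hτ a).sub (ht τ hτ b)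
    refine image_norm_le_of_norm_deriv_right_le_deriv_boundary
      (f := fun τ => f τ a - f τ b) (f' := fun τ => g τ a - g τ b)
      (B := fun τ => B / lam * Real.exp (lam * τ) * |a - b|)
      (B' := fun τ => B * Real.exp (lam * τ) * |a - b|)
      (fun τ hτ => (hder τ hτ).continuousWithinAt)
      (fun τ hτ => (hder τ (Ico_subset_Icc_self hτ)).mono_of_mem_nhdsWithin
        (Icc_mem_nhdsGE_of_mem hτ)) ?_ (fun τ => ?_)
      (fun τ hτ => lip τ (Ico_subset_Icc_self hτ) a b) htT
    · simp only [h0, sub_self, norm_zero]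
      positivity
    · have h1 : HasDerivAt (fun τ => Real.exp (lam * τ)) (Real.exp (lam * τ) * (lam * 1)) τ :=
        ((hasDerivAt_id τ).const_mul lam).exp
      refine ((h1.const_mul (B / lam)).mul_const |a - b|).congr_deriv ?_
      field_simp
  refine (hf t htT m).le_of_lip' (by positivity) (Eventually.of_forall fun a => ?_)
  exact key a m

/-- Gronwall with an exponential weight: a bound `B exp (lam t)` on the differences of `p` and `z`
improves to half of itself, starting from `2 M`. -/
theorem IsMassSolution.unique {T c M : ℝ} (hc : 0 < c)
    {X₁ v₁ W₁ p₁ z₁ q₁ X₂ v₂ W₂ p₂ z₂ q₂ : ℝ → ℝ → ℝ}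
    (h₁ : IsMassSolution T c M X₁ v₁ W₁ p₁ z₁ q₁) (h₂ : IsMassSolution T c M X₂ v₂ W₂ p₂ z₂ q₂)
    (hX : X₁ 0 = X₂ 0) (hv : v₁ 0 = v₂ 0) :
    ∀ t ∈ Icc 0 T, ∀ m, X₁ t m = X₂ t m ∧ v₁ t m = v₂ t m ∧ p₁ t m = p₂ t m := by
  obtain ⟨L, hL⟩ := exists_lipschitz_massElliptic hc M
  -- Integration in time divides by `lam`. The summand `2` halves the bound for `p`; the other makes
  -- the factor `2 L M⁴` in the bound for `z` at most `lam / 2`.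
  set lam : ℝ := 2 + 4 * L * M ^ 4 with hlam
  have hM : 0 ≤ M ^ 4 := by positivity
  have hlp : 2 ≤ lam := by rw [hlam]; have := mul_nonneg L.2 hM; nlinarith
  have hlq : 2 * (2 * L * M ^ 4) ≤ lam := by rw [hlam]; linarith
  have step : ∀ B, 0 ≤ B → (∀ t ∈ Icc 0 T, ∀ m, |p₁ t m - p₂ t m| ≤ B * Real.exp (lam * t) ∧
      |z₁ t m - z₂ t m| ≤ B * Real.exp (lam * t)) → ∀ t ∈ Icc 0 T, ∀ m,
      |p₁ t m - p₂ t m| ≤ B / 2 * Real.exp (lam * t) ∧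
      |z₁ t m - z₂ t m| ≤ B / 2 * Real.exp (lam * t) := by
    intro B hB h t ht m
    have hle : ∀ C, 0 ≤ C → C * 2 ≤ B * lam → C / lam * Real.exp (lam * t) ≤
        B / 2 * Real.exp (lam * t) := fun C _ hC' => by
      gcongr ?_ * _
      rw [div_le_div_iff₀ (by linarith) two_pos]
      linarith
    refine ⟨(deriv_bound_of_time (lam := lam) (by linarith) hB
      (f := fun t m => X₁ t m - X₂ t m) (g := fun t m => v₁ t m - v₂ t m)
      (fun t ht m => (h₁.deriv_X t ht m).sub (h₂.deriv_X t ht m))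
      (fun t ht m => (h₁.deriv_v t ht m).sub (h₂.deriv_v t ht m))
      (fun t ht m => (h₁.time_X t ht m).sub (h₂.time_X t ht m)) (fun m => by simp [hX])
      (fun t ht m => (h t ht m).2) t ht m).trans (hle B hB (by nlinarith)), ?_⟩
    have hq : ∀ t ∈ Icc 0 T, ∀ m, |-(q₁ t m - q₂ t m)| ≤
        2 * L * M ^ 4 * B * Real.exp (lam * t) := by
      intro t ht m
      set E := B * Real.exp (lam * t) with hE
      have hE0 : 0 ≤ E := by positivity
      rw [abs_neg]
      have hg : ∀ m, |massElliptic (p₁ t m, z₁ t m, q₂ t m) -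
          massElliptic (p₂ t m, z₂ t m, q₂ t m)| ≤ L * E := fun m => by
        have := hL.dist_le_mul (p₁ t m, z₁ t m, q₂ t m)
          ⟨h₁.mem_p t ht m, h₁.mem_z t ht m, h₂.mem_q t ht m⟩ (p₂ t m, z₂ t m, q₂ t m)
          ⟨h₂.mem_p t ht m, h₂.mem_z t ht m, h₂.mem_q t ht m⟩
        rw [Real.dist_eq] at this
        refine this.trans (mul_le_mul_of_nonneg_left ?_ L.2)
        simp only [Prod.dist_eq, dist_self, Real.dist_eq]
        exact max_le (h t ht m).1 (max_le (h t ht m).2 hE0)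
      have hp : ∀ m, 0 < p₁ t m := fun m => hc.trans_le (h₁.mem_p t ht m).1
      -- Freezing `q₂` splits the difference of the fluxes into `p₁⁻⁴ (q₁ - q₂)` and a part
      -- controlled by the differences of `p` and `z` alone.
      have := abs_le_of_elliptic
        (K := fun m => massElliptic (p₁ t m, z₁ t m, q₁ t m) -
          massElliptic (p₂ t m, z₂ t m, q₂ t m)) (D := fun m => W₁ t m - W₂ t m)
        (d := fun m => q₁ t m - q₂ t m) (a := fun m => ((p₁ t m)⁻¹) ^ 4)
        (fun m => ((h₁.elliptic t ht m).sub (h₂.elliptic t ht m)).congr_deriv (by ring))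
        (fun m => (h₁.deriv_W t ht m).sub (h₂.deriv_W t ht m))
        (fun m => by have := hp m; positivity)
        (fun m => by simp only [massElliptic]; ring) hg
        (by simpa using (h₁.lim_flux t ht).sub (h₂.lim_flux t ht)) m
      refine this.trans ?_
      rw [inv_pow, div_inv_eq_mul]
      have hpM : p₁ t m ^ 4 ≤ M ^ 4 := pow_le_pow_left₀ (hp m).le (h₁.mem_p t ht m).2 4
      calc 2 * (L * E) * p₁ t m ^ 4 ≤ 2 * (L * E) * M ^ 4 :=
            mul_le_mul_of_nonneg_left hpM (by positivity)
        _ = 2 * L * M ^ 4 * B * Real.exp (lam * t) := by rw [hE]; ring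
    refine (deriv_bound_of_time (lam := lam) (B := 2 * L * M ^ 4 * B) (by linarith) (by positivity)
      (f := fun t m => v₁ t m - v₂ t m) (g := fun t m => -(W₁ t m - W₂ t m))
      (fun t ht m => (h₁.deriv_v t ht m).sub (h₂.deriv_v t ht m))
      (fun t ht m => ((h₁.deriv_W t ht m).sub (h₂.deriv_W t ht m)).neg)
      (fun t ht m => ((h₁.time_v t ht m).sub (h₂.time_v t ht m)).congr_deriv (by ring))
      (fun m => by simp [hv]) hq t ht m).trans (hle _ (by positivity) ?_)
    nlinarith [mul_le_mul_of_nonneg_left hlq hB]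
  have iter : ∀ n : ℕ, ∀ t ∈ Icc 0 T, ∀ m,
      |p₁ t m - p₂ t m| ≤ 2 * M / 2 ^ n * Real.exp (lam * t) ∧
      |z₁ t m - z₂ t m| ≤ 2 * M / 2 ^ n * Real.exp (lam * t) := by
    intro n
    induction n with
    | zero =>
      intro t ht m
      have h1 := h₁.mem_p t ht m
      have h2 := h₂.mem_p t ht m
      have h3 := h₁.mem_z t ht m
      have h4 := h₂.mem_z t ht m
      have hM' : 0 ≤ M := by linarith [h1.1, h1.2]
      have he : 1 ≤ Real.exp (lam * t) := Real.one_le_exp (mul_nonneg (by linarith) ht.1)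
      have hle : 2 * M ≤ 2 * M / 2 ^ 0 * Real.exp (lam * t) := by
        rw [pow_zero, div_one]
        exact le_mul_of_one_le_right (by linarith) he
      constructor <;> refine le_trans ?_ hle <;> rw [abs_le] <;> constructor <;>
        linarith [h1.1, h1.2, h2.1, h2.2, h3.1, h3.2, h4.1, h4.2]
    | succ n ih =>
      intro t ht m
      have hM' : 0 ≤ M := by linarith [(h₁.mem_p t ht m).1, (h₁.mem_p t ht m).2]
      have := step _ (by positivity) ih t ht m
      rwa [div_div, ← pow_succ] at this
  have lim : ∀ x : ℝ, Tendsto (fun n : ℕ => 2 * M / 2 ^ n * x) atTop (𝓝 0) := fun x => by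
    have : Tendsto (fun n : ℕ => 2 * M * (1 / 2 : ℝ) ^ n * x) atTop (𝓝 (2 * M * 0 * x)) :=
      ((_root_.tendsto_pow_atTop_nhds_zero_of_lt_one (by norm_num) (by norm_num)).const_mul _).mul_const _
    simpa [div_eq_mul_inv] using this
  have hz : ∀ t ∈ Icc 0 T, ∀ m, p₁ t m = p₂ t m ∧ z₁ t m = z₂ t m := fun t ht m =>
    ⟨sub_eq_zero.1 (abs_nonpos_iff.1 (ge_of_tendsto' (lim _) fun n => (iter n t ht m).1)),
      sub_eq_zero.1 (abs_nonpos_iff.1 (ge_of_tendsto' (lim _) fun n => (iter n t ht m).2))⟩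
  -- Equal derivatives leave a constant difference, which vanishes at infinity.
  have hv' : ∀ t ∈ Icc 0 T, ∀ m, v₁ t m = v₂ t m := by
    intro t ht m
    have hd : ∀ m, HasDerivAt (fun m => v₁ t m - v₂ t m) 0 m := fun m =>
      ((h₁.deriv_v t ht m).sub (h₂.deriv_v t ht m)).congr_deriv (by rw [(hz t ht m).2, sub_self])
    have hcst : ∀ a, v₁ t a - v₂ t a = v₁ t m - v₂ t m := fun a =>
      is_const_of_deriv_eq_zero (fun m => (hd m).differentiableAt) (fun m => (hd m).deriv) a m
    have hl := (h₁.lim_v t ht).sub (h₂.lim_v t ht)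
    rw [sub_zero] at hl
    exact sub_eq_zero.1 (tendsto_nhds_unique (tendsto_const_nhds.congr fun a => (hcst a).symm) hl)
  intro t ht m
  refine ⟨eq_of_hasDerivWithinAt (f := fun t => X₁ t m) (g := fun t => X₂ t m)
    (f' := fun t => v₁ t m) (fun t ht => h₁.time_X t ht m) (fun t ht => ?_)
    (congrFun hX m) t ht, hv' t ht m, (hz t ht m).1⟩
  rw [hv' t ht m]
  exact h₂.time_X t ht m

/-! ### Mass coordinates of a solution -/

/-- A function on the line with derivative bounded below by a positive constant has a
differentiable inverse. -/
theorem exists_inverse {H H' : ℝ → ℝ} {c : ℝ} (hc : 0 < c) (hH : ∀ x, HasDerivAt H (H' x) x)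
    (hH' : ∀ x, c ≤ H' x) :
    ∃ X : ℝ → ℝ, (∀ x, X (H x) = x) ∧ (∀ m, H (X m) = m) ∧
      (∀ a b, |X a - X b| ≤ c⁻¹ * |a - b|) ∧ (∀ m, HasDerivAt X (H' (X m))⁻¹ m) ∧
      Tendsto X (cocompact ℝ) (cocompact ℝ) := by
  have hcont : Continuous H := continuous_iff_continuousAt.2 fun x => (hH x).continuousAt
  have hg : ∀ x, HasDerivAt (fun x => H x - c * x) (H' x - c * 1) x := fun x =>
    (hH x).sub ((hasDerivAt_id x).const_mul c)
  -- Monotonicity of `H - c x` yields at once expansion by `c`, surjectivity and the Lipschitz bound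
  -- for the inverse.
  have mono : Monotone fun x => H x - c * x := monotone_of_deriv_nonneg
    (fun x => (hg x).differentiableAt) fun x => by rw [(hg x).deriv]; linarith [hH' x]
  have hlow : ∀ a b, b ≤ a → c * (a - b) ≤ H a - H b := fun a b hab => by
    have := mono hab
    simp only at this
    linarith
  have habs : ∀ a b, c * |a - b| ≤ |H a - H b| := fun a b => by
    rcases le_total b a with hab | hab
    · rw [abs_of_nonneg (sub_nonneg.2 hab)]
      exact (hlow a b hab).trans (le_abs_self _)
    · rw [abs_sub_comm a b, abs_sub_comm (H a), abs_of_nonneg (sub_nonneg.2 hab)]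
      exact (hlow b a hab).trans (le_abs_self _)
  have hsurj : Function.Surjective H := by
    refine hcont.surjective ?_ ?_
    · refine tendsto_atTop_mono' atTop ?_
        ((tendsto_id.const_mul_atTop hc).atTop_add (tendsto_const_nhds (x := H 0)))
      filter_upwards [eventually_ge_atTop (0 : ℝ)] with x hx
      have := hlow x 0 hx
      simp only [id]
      linarith
    · refine tendsto_atBot_mono' atBot ?_
        ((tendsto_id.const_mul_atBot hc).atBot_add (tendsto_const_nhds (x := H 0)))
      filter_upwards [eventually_le_atBot (0 : ℝ)] with x hx
      have := hlow 0 x hx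
      simp only [id]
      linarith
  choose X hX using hsurj
  have hlip : ∀ a b, |X a - X b| ≤ c⁻¹ * |a - b| := fun a b => by
    have := habs (X a) (X b)
    rw [hX, hX] at this
    rwa [inv_mul_eq_div, le_div_iff₀ hc, mul_comm]
  have hXc : Continuous X := (LipschitzWith.of_dist_le_mul (K := ⟨c⁻¹, by positivity⟩)
    fun a b => hlip a b).continuous
  have hinv : ∀ x, X (H x) = x := fun x => by
    have := habs (X (H x)) x
    rw [hX, sub_self, abs_zero] at this
    exact sub_eq_zero.1 (abs_nonpos_iff.1 (nonpos_of_mul_nonpos_right this hc))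
  refine ⟨X, hinv, hX, hlip, fun m => ?_, ?_⟩
  · exact (hH (X m)).of_local_left_inverse hXc.continuousAt (hc.trans_le (hH' _)).ne'
      (Eventually.of_forall hX)
  · exact (Homeomorph.mk ⟨X, H, hX, hinv⟩ hXc hcont).isClosedEmbedding.tendsto_cocompact

section

open Hs

variable {s : ℝ} [hs : Fact (1 / 2 < s)] {T : ℝ}

theorem continuous_height (η : Hs s) : Continuous (height η) :=
  continuous_const.add (continuous_rep η)

theorem exists_rep_nonlocalFlux (η : Hs s) (u w : Hs (s + 1)) :
    ∃ F : Hs s, nonlocalFlux η u w = rep F := by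
  obtain ⟨A, hA⟩ : ∃ A : Hs s, ∀ x, height η x ^ 3 = 1 + rep A x := (isPert_height η).pow 3
  set B := der w + (2 : ℝ) • mul (der u) (der u) with hB
  refine ⟨B + mul A B + (3 : ℝ) • heightSq η, funext fun x => ?_⟩
  rw [nonlocalFlux, rep_add, rep_add, rep_mul, rep_smul, hA, hB, rep_add, rep_smul, rep_mul]
  ring

theorem IsNonlocalTerm.hasDerivAt {η : Hs s} {u w : Hs (s + 1)} (h : IsNonlocalTerm η u w)
    (x : ℝ) : HasDerivAt (nonlocalFlux η u w) (3 * (height η x * rep w x)) x := by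
  obtain ⟨F, hF⟩ := exists_rep_nonlocalFlux η u w
  have hw := (isNonlocalTerm_iff η u w).1 h
  rw [hF] at hw ⊢
  have h1 := hw.hasDerivAt (continuous_crep F) (Complex.continuous_ofReal.comp
    (continuous_const.mul ((continuous_height η).mul (continuous_rep w)))) x
  exact Complex.reCLM.hasFDerivAt.comp_hasDerivAt x h1

/-- Near each time the height stays above half of its lower bound there, by the embedding into
bounded functions; compactness in time leaves finitely many such bounds. -/
theorem exists_height_bounds {η : ℝ → Hs s} (hη : ContinuousOn η (Icc 0 T))
    (hpos : ∀ t ∈ Icc 0 T, η t ∈ Us s) :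
    ∃ c > 0, ∃ C, ∀ t ∈ Icc 0 T, ∀ x, c ≤ height (η t) x ∧ height (η t) x ≤ C := by
  obtain ⟨B, hB⟩ := isCompact_Icc.exists_bound_of_continuousOn hη
  have hlow : ∃ c > 0, ∀ t ∈ Icc 0 T, ∀ x, c ≤ height (η t) x := by
    refine isCompact_Icc.induction_on (p := fun S => ∃ c > 0, ∀ t ∈ S, ∀ x, c ≤ height (η t) x)
      ⟨1, one_pos, by simp⟩ (fun S S' hS ⟨c, hc, h⟩ => ⟨c, hc, fun t ht => h t (hS ht)⟩)
      (fun S S' ⟨c, hc, h⟩ ⟨c', hc', h'⟩ => ⟨min c c', lt_min hc hc', fun t ht x => ?_⟩)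
      fun t ht => ?_
    · rcases ht with ht | ht
      · exact (min_le_left _ _).trans (h t ht x)
      · exact (min_le_right _ _).trans (h' t ht x)
    · obtain ⟨c, hc, h⟩ := (isPert_height (η t)).exists_lower (hpos t ht)
      have hlim : Tendsto (fun τ => supConst s * ‖η τ - η t‖) (𝓝[Icc 0 T] t) (𝓝 0) := by
        have h1 := (tendsto_iff_norm_sub_tendsto_zero.1 (hη t ht).tendsto).const_mul (supConst s)
        rwa [mul_zero] at h1
      refine ⟨_, hlim.eventually (gt_mem_nhds (half_pos hc)), c / 2, half_pos hc, fun τ hτ x => ?_⟩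
      have h1 := abs_rep_le (η τ - η t) x
      rw [rep_sub] at h1
      have h2 := (abs_le.1 h1).1
      have h3 := h x
      have h4 : supConst s * ‖η τ - η t‖ < c / 2 := hτ
      rw [height_eq] at h3 ⊢
      linarith
  obtain ⟨c, hc, h⟩ := hlow
  refine ⟨c, hc, 1 + supConst s * B, fun t ht x => ⟨h t ht x, ?_⟩⟩
  have h1 := (le_abs_self _).trans (abs_rep_le (η t) x)
  have h2 := mul_le_mul_of_nonneg_left (hB t ht) (supConst_nonneg (s := s))
  rw [height_eq]
  linarith

variable {η₀ : Hs s} {u₀ : Hs (s + 1)} {η : ℝ → Hs s} {u : ℝ → Hs (s + 1)}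

/-- The integrated form of the equation of mass conservation. -/
theorem IsSolution.exists_potential (hT : 0 < T) (h : IsSolution s T η₀ u₀ η u) :
    ∃ N : ℝ → Hs s, N 0 = 0 ∧
      (∀ t ∈ Icc 0 T, HasDerivWithinAt N (-massFlux (η t) (u t)) (Icc 0 T) t) ∧
      ∀ t ∈ Icc 0 T, ∀ x, HasDerivAt (rep (N t)) (rep (η t) x - rep η₀ x) x := by
  have hc : ContinuousOn (fun t => -massFlux (η t) (u t)) (Icc 0 T) := fun t ht =>
    (tendsto_massFlux (h.continuousOn_height t ht).tendsto (h.continuousOn_vel t ht).tendsto).neg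
  obtain ⟨N, hN0, hN⟩ := exists_primitive hT.le hc
  refine ⟨N, hN0, hN, fun t ht x => ?_⟩
  -- The curves `η - η₀` and `∂ₓ N` vanish initially and have the same time derivative in `H^(s-1)`,
  -- so they coincide.
  have hη : ∀ t ∈ Icc 0 T, HasDerivWithinAt
      (fun t => inclL (sub_le_self s zero_le_one) (η t) - inclL (sub_le_self s zero_le_one) η₀)
      (dL (le_refl (s - 1)) (-massFlux (η t) (u t))) (Icc 0 T) t := by
    intro t ht
    have h1 := (h.contDiffOn_height.differentiableOn one_ne_zero t ht).hasDerivWithinAt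
    have h2 : heightDeriv T η t = dL (le_refl (s - 1)) (-massFlux (η t) (u t)) := by
      refine toDist_injective ?_
      have := h.mass t ht
      rw [ofReal_massFlux] at this
      rw [toDist_dL, map_neg, map_neg]
      exact eq_neg_of_add_eq_zero_left this
    rw [← h2]
    exact h1.sub_const _
  have e := eq_of_hasDerivWithinAt hη
    (fun t ht => (dL (le_refl (s - 1))).hasFDerivAt.comp_hasDerivWithinAt t (hN t ht))
    (by rw [h.initial_height, sub_self]; show (0 : Hs (s - 1)) = dL (le_refl (s - 1)) (N 0)
        rw [hN0, map_zero]) t ht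
  have e' : dx (N t).toDist = (η t - η₀).toDist := by
    have := congrArg toDist e
    rw [map_sub, toDist_inclL, toDist_inclL] at this
    rw [map_sub, this]
    exact (toDist_dL _ _).symm
  have hw : HasWeakDeriv (crep (N t)) (crep (η t - η₀)) :=
    ⟨memLp_crep _, memLp_crep _, by rw [ofL2_crep, ofL2_crep, e']⟩
  have h1 := Complex.reCLM.hasFDerivAt.comp_hasDerivAt x
    (hw.hasDerivAt (continuous_crep _) (continuous_crep _) x)
  rw [← rep_sub]
  exact h1

/-- The momentum equation in `H^s`. -/
theorem IsSolution.exists_term (h : IsSolution s T η₀ u₀ η u) :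
    ∃ w : ℝ → Hs (s + 1), ∀ t ∈ Icc 0 T, IsNonlocalTerm (η t) (u t) (w t) ∧
      HasDerivWithinAt (fun t => inc (u t)) (velRate (u t) (w t)) (Icc 0 T) t := by
  have hm : ∀ t, ∃ w : Hs (s + 1), t ∈ Icc 0 T → IsNonlocalTerm (η t) (u t) w ∧
      HasDerivWithinAt (fun t => inc (u t)) (velRate (u t) w) (Icc 0 T) t := by
    intro t
    by_cases ht : t ∈ Icc 0 T
    · obtain ⟨w, hw, e⟩ := h.momentum t ht
      refine ⟨w, fun _ => ⟨hw, ?_⟩⟩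
      have h1 := (h.contDiffOn_vel.differentiableOn one_ne_zero t ht).hasDerivWithinAt
      have h2 : velDeriv T u t = velRate (u t) w := by
        refine toDist_injective ?_
        rw [ofReal_mul_der, ← toDist_inc] at e
        rw [velRate, map_neg, map_add, eq_sub_of_add_eq e]
        abel
      rw [← h2]
      exact h1
    · exact ⟨0, fun h => absurd h ht⟩
  -- The terms are chosen separately at each time; no regularity in time is needed for uniqueness.
  choose w hw using hm
  exact ⟨w, hw⟩

end

section

open Hs

variable {s : ℝ} [hs : Fact (1 / 2 < s)] {T : ℝ}

theorem IsMassSolution.mono {T c M c' M' : ℝ} {X v W p z q : ℝ → ℝ → ℝ}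
    (h : IsMassSolution T c M X v W p z q) (hc : c' ≤ c) (hM : M ≤ M') :
    IsMassSolution T c' M' X v W p z q where
  deriv_X := h.deriv_X
  deriv_v := h.deriv_v
  deriv_W := h.deriv_W
  time_X := h.time_X
  time_v := h.time_v
  elliptic := h.elliptic
  lim_flux := h.lim_flux
  lim_v := h.lim_v
  mem_p t ht m := Icc_subset_Icc hc hM (h.mem_p t ht m)
  mem_z t ht m := Icc_subset_Icc (neg_le_neg hM) hM (h.mem_z t ht m)
  mem_q t ht m := Icc_subset_Icc (neg_le_neg hM) hM (h.mem_q t ht m)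

/-- The mass to the left of a point, for the initial height. -/
def initialMass (η₀ : Hs s) (x : ℝ) : ℝ := x + ∫ y in (0 : ℝ)..x, rep η₀ y

theorem hasDerivAt_initialMass (η₀ : Hs s) (x : ℝ) :
    HasDerivAt (initialMass η₀) (1 + rep η₀ x) x :=
  (hasDerivAt_id x).add ((continuous_rep η₀).integral_hasStrictDerivAt 0 x).hasDerivAt

variable {η₀ : Hs s} {u₀ : Hs (s + 1)} {η : ℝ → Hs s} {u : ℝ → Hs (s + 1)}

/-- `X(t, ·)` inverts the mass function `initialMass + N(t)`, whose derivatives are `h` in `x` and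
`-h u` in `t`. Differentiating the inverse gives `X_t = u(t, X)`, so particle paths exist without
solving an equation for them. -/
theorem IsSolution.exists_massSolution (hT : 0 < T) (h : IsSolution s T η₀ u₀ η u) :
    ∃ c > 0, ∃ (M : ℝ) (X W z q : ℝ → ℝ → ℝ),
      IsMassSolution T c M X (fun t m => rep (u t) (X t m)) W
        (fun t m => (height (η t) (X t m))⁻¹) z q ∧
      (∀ t ∈ Icc 0 T, ∀ x, ∃ m, X t m = x) ∧ ∀ x, X 0 (initialMass η₀ x) = x := by
  obtain ⟨N, hN0, hN, hNx⟩ := h.exists_potential hT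
  obtain ⟨w, hw⟩ := h.exists_term
  obtain ⟨c, hc, C, hb⟩ := exists_height_bounds h.continuousOn_height h.mem_Us
  obtain ⟨U, hU⟩ := isCompact_Icc.exists_bound_of_continuousOn h.continuousOn_vel
  have hH : ∀ t ∈ Icc 0 T, ∀ x, HasDerivAt (fun x => initialMass η₀ x + rep (N t) x)
      (height (η t) x) x := fun t ht x => by
    refine ((hasDerivAt_initialMass η₀ x).add (hNx t ht x)).congr_deriv ?_
    rw [height_eq]
    ring
  have hex : ∀ t, ∃ X : ℝ → ℝ, t ∈ Icc 0 T →
      (∀ x, X (initialMass η₀ x + rep (N t) x) = x) ∧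
      (∀ m, initialMass η₀ (X m) + rep (N t) (X m) = m) ∧
      (∀ a b, |X a - X b| ≤ c⁻¹ * |a - b|) ∧
      (∀ m, HasDerivAt X (height (η t) (X m))⁻¹ m) ∧ Tendsto X (cocompact ℝ) (cocompact ℝ) := by
    intro t
    by_cases ht : t ∈ Icc 0 T
    · obtain ⟨X, hX⟩ := exists_inverse hc (hH t ht) fun x => (hb t ht x).1
      exact ⟨X, fun _ => hX⟩
    · exact ⟨0, fun h => absurd h ht⟩
  choose X hX using hex
  have hpos : ∀ t ∈ Icc 0 T, ∀ x, 0 < height (η t) x := fun t ht x => hc.trans_le (hb t ht x).1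
  have timeX : ∀ t ∈ Icc 0 T, ∀ m, HasDerivWithinAt (fun τ => X τ m) (rep (u t) (X t m))
      (Icc 0 T) t := by
    intro t ht m
    -- As for `phiInv`: the motion of the inverse is expressed through the fixed map `X t`.
    have e : ∀ τ ∈ Icc 0 T, X τ m = X t (m - rep (N τ - N t) (X τ m)) := by
      intro τ hτ
      have h1 := (hX τ hτ).2.1 m
      have h2 : m - rep (N τ - N t) (X τ m) = initialMass η₀ (X τ m) + rep (N t) (X τ m) := by
        rw [rep_sub]
        linarith
      rw [h2, (hX t ht).1]
    have hcont : ContinuousWithinAt (fun τ => X τ m) (Icc 0 T) t := by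
      have hl := (tendsto_iff_norm_sub_tendsto_zero.1
        (hN t ht).continuousWithinAt.tendsto).const_mul (c⁻¹ * supConst s)
      rw [mul_zero] at hl
      refine tendsto_iff_norm_sub_tendsto_zero.2 (squeeze_zero' (Eventually.of_forall
        fun _ => norm_nonneg _) ?_ hl)
      filter_upwards [self_mem_nhdsWithin] with τ hτ
      have h1 := (hX t ht).2.2.1 (m - rep (N τ - N t) (X τ m)) m
      rw [← e τ hτ, sub_sub_cancel_left, abs_neg] at h1
      refine h1.trans ?_
      rw [mul_assoc]
      exact mul_le_mul_of_nonneg_left (abs_rep_le _ _) (inv_nonneg.2 hc.le)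
    have h1 := (hasDerivWithinAt_rep_sub (hN t ht) hcont).const_sub m
    have e0 : m - rep (N t - N t) (X t m) = m := by rw [sub_self, rep_zero, sub_zero]
    have h2 := ((hX t ht).2.2.2.1 (m - rep (N t - N t) (X t m))).comp_hasDerivWithinAt t h1
    rw [e0] at h2
    refine (h2.congr e (e t ht)).congr_deriv ?_
    rw [rep_neg, rep_massFlux, neg_neg, ← mul_assoc, inv_mul_cancel₀ (hpos t ht _).ne', one_mul]
  set p : ℝ → ℝ → ℝ := fun t m => (height (η t) (X t m))⁻¹ with hp
  set z : ℝ → ℝ → ℝ := fun t m => rep (der (u t)) (X t m) * p t m with hz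
  set q : ℝ → ℝ → ℝ := fun t m => rep (der (w t)) (X t m) * p t m with hq
  have hflux : ∀ t ∈ Icc 0 T, ∀ m, massElliptic (p t m, z t m, q t m) =
      nonlocalFlux (η t) (u t) (w t) (X t m) := by
    intro t ht m
    have h0 := (hpos t ht (X t m)).ne'
    simp only [massElliptic, nonlocalFlux, rep_heightSq, hz, hq, hp, inv_inv]
    field_simp
  have dX : ∀ t ∈ Icc 0 T, ∀ m, HasDerivAt (X t) (p t m) m := fun t ht m => (hX t ht).2.2.2.1 m
  have dW : ∀ t ∈ Icc 0 T, ∀ m, HasDerivAt (fun m => rep (w t) (X t m)) (q t m) m :=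
    fun t ht m => (hasDerivAt_der (w t) _).comp m (dX t ht m)
  have dk : ∀ t ∈ Icc 0 T, ∀ m, HasDerivAt (fun m => massElliptic (p t m, z t m, q t m))
      (3 * rep (w t) (X t m)) m := by
    intro t ht m
    have h1 := ((hw t ht).1.hasDerivAt (X t m)).comp m (dX t ht m)
    refine (h1.congr_of_eventuallyEq (Eventually.of_forall (hflux t ht))).congr_deriv ?_
    have h0 := (hpos t ht (X t m)).ne'
    simp only [hp]
    field_simp
  have hlim : ∀ t ∈ Icc 0 T, Tendsto (fun m => massElliptic (p t m, z t m, q t m))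
      (cocompact ℝ) (𝓝 0) := by
    intro t ht
    obtain ⟨F, hF⟩ := exists_rep_nonlocalFlux (η t) (u t) (w t)
    refine ((tendsto_rep F).comp (hX t ht).2.2.2.2).congr fun m => ?_
    rw [hflux t ht, hF]
    rfl
  set U' := supConst s * (‖(der : Hs (s + 1) →L[ℝ] Hs s)‖ * U) with hU'
  have hux : ∀ t ∈ Icc 0 T, ∀ x, |rep (der (u t)) x| ≤ U' := fun t ht x =>
    (abs_rep_le _ x).trans (mul_le_mul_of_nonneg_left ((der.le_opNorm _).trans
      (mul_le_mul_of_nonneg_left (hU t ht) (norm_nonneg _))) supConst_nonneg)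
  have hp0 : ∀ t ∈ Icc 0 T, ∀ m, 0 < p t m := fun t ht m => inv_pos.2 (hpos t ht _)
  have hpc : ∀ t ∈ Icc 0 T, ∀ m, p t m ≤ c⁻¹ := fun t ht m =>
    inv_anti₀ hc (hb t ht _).1
  set G := 3 / 2 * (C ^ 2 + 1) + 2 * C ^ 3 * U' ^ 2 with hG
  -- The choice of `w` gives no bound uniform in time; the maximum principle supplies one from the
  -- bounds on `h` and `uₓ`.
  have hqb : ∀ t ∈ Icc 0 T, ∀ m, |q t m| ≤ 2 * G * c⁻¹ ^ 4 := by
    intro t ht m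
    have hC : 0 ≤ C := hc.le.trans ((hb t ht 0).1.trans (hb t ht 0).2)
    have hG0 : 0 ≤ G := by positivity
    have hg : ∀ m, |3 / 2 * ((p t m)⁻¹ ^ 2 - 1) + 2 * (p t m)⁻¹ ^ 5 * z t m ^ 2| ≤ G := by
      intro m
      have h0 := (hpos t ht (X t m))
      have h1 : 2 * (p t m)⁻¹ ^ 5 * z t m ^ 2 =
          2 * height (η t) (X t m) ^ 3 * rep (der (u t)) (X t m) ^ 2 := by
        simp only [hz, hp, inv_inv]
        field_simp
      have h2 : height (η t) (X t m) ^ 2 ≤ C ^ 2 := pow_le_pow_left₀ h0.le (hb t ht _).2 2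
      have h3 : height (η t) (X t m) ^ 3 ≤ C ^ 3 := pow_le_pow_left₀ h0.le (hb t ht _).2 3
      have h4 : rep (der (u t)) (X t m) ^ 2 ≤ U' ^ 2 := sq_le_sq' (abs_le.1 (hux t ht _)).1
        (abs_le.1 (hux t ht _)).2
      have h5 : height (η t) (X t m) ^ 3 * rep (der (u t)) (X t m) ^ 2 ≤ C ^ 3 * U' ^ 2 :=
        mul_le_mul h3 h4 (sq_nonneg _) (by positivity)
      have h6 : 0 ≤ height (η t) (X t m) ^ 3 * rep (der (u t)) (X t m) ^ 2 := by positivity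
      rw [h1, abs_le, hG]
      simp only [hp, inv_inv]
      constructor <;> nlinarith [sq_nonneg (height (η t) (X t m)), sq_nonneg C,
        mul_nonneg (pow_nonneg hC 3) (sq_nonneg U')]
    have := abs_le_of_elliptic (K := fun m => massElliptic (p t m, z t m, q t m))
      (D := fun m => rep (w t) (X t m)) (a := fun m => (p t m)⁻¹ ^ 4) (dk t ht) (dW t ht)
      (fun m => pow_pos (inv_pos.2 (hp0 t ht m)) 4)
      (fun m => by simp only [massElliptic]; ring) hg (hlim t ht) m
    refine this.trans ?_
    rw [inv_pow (p t m), div_inv_eq_mul]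
    exact mul_le_mul_of_nonneg_left (pow_le_pow_left₀ (hp0 t ht m).le (hpc t ht m) 4)
      (by positivity)
  have hzb : ∀ t ∈ Icc 0 T, ∀ m, |z t m| ≤ U' * c⁻¹ := fun t ht m => by
    rw [hz, abs_mul, abs_of_pos (hp0 t ht m)]
    exact mul_le_mul (hux t ht _) (hpc t ht m) (hp0 t ht m).le
      ((abs_nonneg _).trans (hux t ht (X t m)))
  have hC : 0 < C := hc.trans_le ((hb 0 ⟨le_rfl, hT.le⟩ 0).1.trans (hb 0 ⟨le_rfl, hT.le⟩ 0).2)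
  refine ⟨C⁻¹, inv_pos.2 hC, max c⁻¹ (max (U' * c⁻¹) (2 * G * c⁻¹ ^ 4)), X,
    fun t m => rep (w t) (X t m), z, q, ⟨dX, fun t ht m => (hasDerivAt_der (u t) _).comp m
      (dX t ht m), dW, timeX, fun t ht m => ?_, dk, hlim,
      fun t ht => (tendsto_rep (u t)).comp (hX t ht).2.2.2.2,
      fun t ht m => ⟨inv_anti₀ (hpos t ht _) (hb t ht _).2, (hpc t ht m).trans (le_max_left _ _)⟩,
      fun t ht m => abs_le.1 ((hzb t ht m).trans ((le_max_left _ _).trans (le_max_right _ _))),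
      fun t ht m => abs_le.1 ((hqb t ht m).trans ((le_max_right _ _).trans (le_max_right _ _)))⟩,
    fun t ht x => ⟨_, (hX t ht).1 x⟩, fun x => ?_⟩
  · have hd : HasDerivAt (rep (inc (u t))) (rep (der (u t)) (X t m)) (X t m) := by
      rw [rep_inc]
      exact hasDerivAt_der (u t) _
    have h1 := hasDerivWithinAt_rep_comp (hw t ht).2 (timeX t ht m) hd
    simp only [rep_inc] at h1
    refine h1.congr_deriv ?_
    rw [rep_velRate]
    ring
  · have := (hX 0 ⟨le_rfl, hT.le⟩).1 x
    rwa [hN0, rep_zero, add_zero] at this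

/-- After enlarging the constants to common ones, the initial positions agree because both invert
the same initial mass. The solution is recovered from mass coordinates through `X_m = 1 / h` and `v
= u ∘ X`, as `X` reaches every point. -/
theorem IsSolution.unique (hT : 0 < T) {η₁ η₂ : ℝ → Hs s} {u₁ u₂ : ℝ → Hs (s + 1)}
    (h₁ : IsSolution s T η₀ u₀ η₁ u₁) (h₂ : IsSolution s T η₀ u₀ η₂ u₂) :
    EqOn η₁ η₂ (Icc 0 T) ∧ EqOn u₁ u₂ (Icc 0 T) := by
  obtain ⟨c₁, hc₁, M₁, X₁, W₁, z₁, q₁, m₁, s₁, i₁⟩ := h₁.exists_massSolution hT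
  obtain ⟨c₂, hc₂, M₂, X₂, W₂, z₂, q₂, m₂, s₂, i₂⟩ := h₂.exists_massSolution hT
  have hsurj : Function.Surjective (initialMass η₀) := by
    obtain ⟨c, hc, hb⟩ := (isPert_height η₀).exists_lower
      (h₁.initial_height ▸ h₁.mem_Us 0 ⟨le_rfl, hT.le⟩)
    obtain ⟨X, -, hX, -⟩ := exists_inverse hc (hasDerivAt_initialMass η₀) hb
    exact fun m => ⟨X m, hX m⟩
  have hX : X₁ 0 = X₂ 0 := funext fun m => by
    obtain ⟨x, rfl⟩ := hsurj m
    rw [i₁, i₂]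
  have key := (m₁.mono (min_le_left c₁ c₂) (le_max_left M₁ M₂)).unique (lt_min hc₁ hc₂)
    (m₂.mono (min_le_right c₁ c₂) (le_max_right M₁ M₂)) hX
    (by simp only [h₁.initial_vel, h₂.initial_vel, hX])
  constructor <;> intro t ht <;> refine rep_injective (funext fun x => ?_) <;>
    obtain ⟨m, rfl⟩ := s₁ t ht x <;> obtain ⟨e1, e2, e3⟩ := key t ht m
  · have := inv_injective e3
    rw [← e1, height_eq, height_eq] at this
    exact add_left_cancel this
  · rw [e1, ← e2, e1]

end

end GreenNaghdi

end

theorem theorem2 (s : ℝ) (hs : 1 / 2 < s) :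
    (∀ η₀ ∈ GreenNaghdi.Us s, ∀ u₀ : GreenNaghdi.Hs (s + 1),
      ∃ T > 0, ∃ V ∈ 𝓝 (η₀, u₀), V ⊆ GreenNaghdi.Us s ×ˢ univ ∧
        ∃ (η : GreenNaghdi.Hs s × GreenNaghdi.Hs (s + 1) → ℝ → GreenNaghdi.Hs s)
          (u : GreenNaghdi.Hs s × GreenNaghdi.Hs (s + 1) → ℝ → GreenNaghdi.Hs (s + 1)),
          (∀ d ∈ V, GreenNaghdi.IsSolution s T d.1 d.2 (η d) (u d)) ∧
          ∀ d ∈ V,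
            TendstoUniformlyOn η (η d) (𝓝[V] d) (Icc 0 T) ∧
            TendstoUniformlyOn u (u d) (𝓝[V] d) (Icc 0 T) ∧
            TendstoUniformlyOn (fun d' => GreenNaghdi.heightDeriv T (η d'))
              (GreenNaghdi.heightDeriv T (η d)) (𝓝[V] d) (Icc 0 T) ∧
            TendstoUniformlyOn (fun d' => GreenNaghdi.velDeriv T (u d'))
              (GreenNaghdi.velDeriv T (u d)) (𝓝[V] d) (Icc 0 T)) ∧
    (∀ η₀ ∈ GreenNaghdi.Us s, ∀ u₀ : GreenNaghdi.Hs (s + 1), ∀ T > 0,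
      ∀ (η₁ η₂ : ℝ → GreenNaghdi.Hs s) (u₁ u₂ : ℝ → GreenNaghdi.Hs (s + 1)),
        GreenNaghdi.IsSolution s T η₀ u₀ η₁ u₁ → GreenNaghdi.IsSolution s T η₀ u₀ η₂ u₂ →
          EqOn η₁ η₂ (Icc 0 T) ∧ EqOn u₁ u₂ (Icc 0 T)) := by
  have : Fact (1 / 2 < s) := ⟨hs⟩
  exact ⟨fun _ hη₀ u₀ => GreenNaghdi.exists_solutions hη₀ u₀,
    fun _ _ _ _ hT _ _ _ _ h₁ h₂ => h₁.unique hT h₂⟩
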